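/- Let $M$ be a compact connected smooth manifold without boundary and let $F : TM \to \mathbb R_{\ge 0}$ be a (possibly irreversible) Finsler metric, i.e. $F(x,\lambda\xi)=\lambda F(x,\xi)$ for all $\lambda>0$, $F$ is smooth on $TM\setminus 0$, and at every $(x,\xi)$ with $\xi\neq 0$ the fibre Hessian of $\tfrac12F^2$ is positive definite. Geodesics of $F$ are the solutions of the Euler–Lagrange equation of $L=\tfrac12F^2$, and the geodesic flow $\varphi^t$ on the compact unit tangent bundle $SM=\{v\in TM : F(v)=1\}$ sends $v$ to the velocity at time $t$ of the geodesic with initial velocity $v$. For a metric $d$ on $SM$ inducing its topology, the topological entropy is $$h_{\mathrm{top}}=\lim_{\epsilon\to0}\limsup_{t\to\infty}\tfrac1t\log H^t_\epsilon ,$$ where $H^t_\epsilon$ is the maximal cardinality of a set that is $\epsilon$-separated for $d^t(v,w)=\max_{0\le\tau\le t}d(\varphi^\tau v,\varphi^\tau w)$. For a finite generating set $S$ of a group $G$ let $B_n$ be the set of products of at most $n$ elements of $S$ and their inverses; $G$ has exponential growth if for some finite generating set $S$ and some $k>0$ one has $\#B_n\ge e^{kn}$ for all $n\in\mathbb N$.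 Suppose that the fundamental group $\pi_1(M,x)$ has exponential growth. Then, for every metric $d$ on $SM$ inducing its topology, $h_{\mathrm{top}}>0$. More precisely, let $S$ be a finite generating set of $\pi_1(M,x)$, let $k>0$ be such that $\#B_n\ge e^{kn}$ for all $n$, and let $s_0>0$ be such that every element of $S\cup S^{-1}$ is represented by a $C^1$ loop at $x$ of $F$-length at most $s_0$; then $$h_{\mathrm{top}}\ \ge\ \frac{k}{2s_0}.$$ -/

import Mathlib

open scoped Manifold ContDiff Topology ENNReal

noncomputable section

/-! ### Growth of groups -/

/-- The elements of `G` that are products of at most `n` elements of `S` and inverses of such. -/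
def wordBall {G : Type*} [Group G] (S : Set G) (n : ℕ) : Set G :=
  {g | ∃ l : List G, l.length ≤ n ∧ (∀ a ∈ l, a ∈ S ∨ a⁻¹ ∈ S) ∧ l.prod = g}

/-- `#B_n ≥ e^{kn}` for all `n`, where `B_n` is the ball of radius `n` for the word length of `S`.
(The balls are finite when `S` is.) -/
def GrowsAtRate {G : Type*} [Group G] (S : Set G) (k : ℝ) : Prop :=
  ∀ n : ℕ, Real.exp (k * n) ≤ ((wordBall S n).ncard : ℝ)

/-- A finitely generated group of exponential growth. -/
def HasExponentialGrowth (G : Type*) [Group G] : Prop :=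
  ∃ S : Finset G, Subgroup.closure (S : Set G) = ⊤ ∧ ∃ k : ℝ, 0 < k ∧ GrowsAtRate (S : Set G) k

/-! ### Topological entropy of a flow -/

section Entropy

variable {X : Type*} (d : X → X → ℝ) (φ : ℝ → X → X)

/-- `d^t(x, y) = max_{0 ≤ τ ≤ t} d (φ^τ x, φ^τ y)`. -/
def flowDist (t : ℝ) (x y : X) : ℝ :=
  sSup ((fun τ : ℝ => d (φ τ x) (φ τ y)) '' Set.Icc 0 t)

/-- `A` is `ε`-separated for the distance `d^t`. -/
def IsFlowSeparated (t ε : ℝ) (A : Set X) : Prop :=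
  A.Pairwise fun x y => ε ≤ flowDist d φ t x y

/-- The maximal cardinality `H^t_ε` of an `ε`-separated set for `d^t`. -/
def maxSeparated (t ε : ℝ) : ℕ∞ :=
  ⨆ (A : Set X) (_ : IsFlowSeparated d φ t ε A), A.encard

/-- The topological entropy `lim_{ε → 0} limsup_{t → ∞} (1/t) log H^t_ε`. The limit over `ε → 0` is
a supremum because `H^t_ε` increases as `ε` decreases. -/
def topologicalEntropy : EReal :=
  ⨆ (ε : ℝ) (_ : 0 < ε), Filter.limsup
    (fun t : ℝ => ((t⁻¹ : ℝ) : EReal) * ENNReal.log (maxSeparated d φ t ε : ℝ≥0∞)) Filter.atTop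

end Entropy

/-! ### Finsler metrics -/

/-- A (possibly irreversible) Finsler metric on a manifold `M` modelled on `E`. -/
structure FinslerMetric (E : Type*) [NormedAddCommGroup E] [NormedSpace ℝ E]
    (M : Type*) [TopologicalSpace M] [ChartedSpace E M] [IsManifold 𝓘(ℝ, E) ∞ M] where
  toFun : TangentBundle 𝓘(ℝ, E) M → ℝ
  nonneg : ∀ v, 0 ≤ toFun v
  homogeneous : ∀ (x : M) (ξ : TangentSpace 𝓘(ℝ, E) x) (r : ℝ), 0 < r →
    toFun ⟨x, r • ξ⟩ = r * toFun ⟨x, ξ⟩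
  smooth : ContMDiffOn 𝓘(ℝ, E).tangent 𝓘(ℝ, ℝ) ∞ toFun {v | v.2 ≠ 0}
  /-- The second derivative of `½ F²` along the fibre `T_x M` (which is `E` as a vector space) is
  positive definite at every nonzero vector. -/
  hessian_pos : ∀ (x : M) (ξ η : E), ξ ≠ 0 → η ≠ 0 →
    0 < fderiv ℝ (fderiv ℝ fun ζ : E => (1 / 2 : ℝ) * toFun ⟨x, ζ⟩ ^ 2) ξ η η

section Curves

variable {E : Type*} [NormedAddCommGroup E] [NormedSpace ℝ E]
  {M : Type*} [TopologicalSpace M] [ChartedSpace E M]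

variable (E) in
/-- The velocity of a curve `c : ℝ → M` at time `t`, as a point of the tangent bundle. -/
def velocity (c : ℝ → M) (t : ℝ) : TangentBundle 𝓘(ℝ, E) M :=
  ⟨c t, mfderiv 𝓘(ℝ, ℝ) 𝓘(ℝ, E) c t (1 : ℝ)⟩

variable (E) in
/-- The one-sided version of `velocity` for curves defined on `[0, 1]`. -/
def velocityIcc (c : ℝ → M) (t : ℝ) : TangentBundle 𝓘(ℝ, E) M :=
  ⟨c t, mfderivWithin 𝓘(ℝ, ℝ) 𝓘(ℝ, E) c (Set.Icc 0 1) t (1 : ℝ)⟩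

end Curves

namespace FinslerMetric

variable {E : Type*} [NormedAddCommGroup E] [NormedSpace ℝ E]
  {M : Type*} [TopologicalSpace M] [ChartedSpace E M] [IsManifold 𝓘(ℝ, E) ∞ M]
  (F : FinslerMetric E M)

/-- The Lagrangian `L = ½ F²` in the coordinates `(y, w)` on the tangent bundle that are induced by
the chart `e`. -/
def localLagrangian (e : OpenPartialHomeomorph M E) (y w : E) : ℝ :=
  (1 / 2 : ℝ) * F.toFun ⟨e.symm y, mfderiv 𝓘(ℝ, E) 𝓘(ℝ, E) e.symm y w⟩ ^ 2

/-- A geodesic defined on all of `ℝ`: in every chart it satisfies the Euler-Lagrange equation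
`d/dt (∂L/∂w (u, u')) = ∂L/∂y (u, u')`, where `u = e ∘ c`. -/
def IsGeodesic (c : ℝ → M) : Prop :=
  ContMDiff 𝓘(ℝ, ℝ) 𝓘(ℝ, E) 2 c ∧
  ∀ e ∈ atlas E M, ∀ t : ℝ, c t ∈ e.source →
    HasDerivAt
      (fun s => fderiv ℝ (fun w => F.localLagrangian e (e (c s)) w) (deriv (fun r => e (c r)) s))
      (fderiv ℝ (fun y => F.localLagrangian e y (deriv (fun r => e (c r)) t)) (e (c t))) t

/-- The unit tangent bundle `{v ∈ TM | F v = 1}`, with the subspace topology. -/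
abbrev UnitBundle : Type _ := {v : TangentBundle 𝓘(ℝ, E) M // F.toFun v = 1}

/-- `σ` is the velocity curve of a unit speed geodesic defined on `ℝ`. -/
def IsGeodesicLift (σ : ℝ → F.UnitBundle) : Prop :=
  ∃ c : ℝ → M, F.IsGeodesic c ∧ ∀ t, (σ t : TangentBundle 𝓘(ℝ, E) M) = velocity E c t

open Classical in
/-- The geodesic flow on the unit tangent bundle: `φ^t v` is the velocity at time `t` of the
geodesic with initial velocity `v`. (Such a geodesic is unique, and it exists for all times when
`M` is compact; the value `v` is a placeholder for the case that it does not.) -/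
def geodesicFlow (t : ℝ) (v : F.UnitBundle) : F.UnitBundle :=
  if h : ∃ σ : ℝ → F.UnitBundle, F.IsGeodesicLift σ ∧ σ 0 = v then h.choose t else v

/-- The `F`-length of a curve parametrized by `[0, 1]`. -/
def length (c : ℝ → M) : ℝ :=
  ∫ t in (0 : ℝ)..1, F.toFun (velocityIcc E c t)

/-- The class `g` contains a `C^1` loop of `F`-length at most `s`. -/
def HasLoopOfLengthLE {x : M} (g : FundamentalGroup M x) (s : ℝ) : Prop :=
  ∃ p : Path x x, FundamentalGroup.fromPath (Path.Homotopic.Quotient.mk p) = g ∧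
    ContMDiffOn 𝓘(ℝ, ℝ) 𝓘(ℝ, E) 1 p.extend (Set.Icc 0 1) ∧ F.length p.extend ≤ s

end FinslerMetric

end

open scoped Manifold ContDiff Topology ENNReal

noncomputable section

open Set Metric Filter MeasureTheory

/-! ### Lagrangians that are homogeneous of degree two in the velocity -/

/-- `L` is a smooth Lagrangian on `U × (E \ 0)`, `2`-homogeneous and strictly convex in the
velocity. -/
structure IsFinslerLagrangian {E : Type*} [NormedAddCommGroup E] [NormedSpace ℝ E]
    (U : Set E) (L : E → E → ℝ) : Prop where
  isOpen : IsOpen U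
  smooth : ContDiffOn ℝ ∞ (fun z : E × E => L z.1 z.2) (U ×ˢ {0}ᶜ)
  homog : ∀ y ∈ U, ∀ (w : E) (r : ℝ), 0 < r → L y (r • w) = r ^ 2 * L y w
  hess : ∀ y ∈ U, ∀ ξ η : E, ξ ≠ 0 → η ≠ 0 → 0 < fderiv ℝ (fderiv ℝ (L y)) ξ η η

section Derivatives

variable {E : Type*} [NormedAddCommGroup E] [NormedSpace ℝ E] (L : E → E → ℝ)

/-- The partial derivative of the Lagrangian in the velocity. -/
def velDeriv (y w : E) : E →L[ℝ] ℝ := fderiv ℝ (L y) w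

/-- The partial derivative of the Lagrangian in the position. -/
def posDeriv (y w : E) : E →L[ℝ] ℝ := fderiv ℝ (fun y => L y w) y

/-- The second partial derivative of the Lagrangian in the velocity. -/
def velHess (y w : E) : E →L[ℝ] E →L[ℝ] ℝ := fderiv ℝ (velDeriv L y) w

/-- The mixed second partial derivative of the Lagrangian. -/
def mixedHess (y w : E) : E →L[ℝ] E →L[ℝ] ℝ := fderiv ℝ (fun y => velDeriv L y w) y

/-- The acceleration prescribed by the Euler-Lagrange equation. -/
def spray (y w : E) : E :=
  (velHess L y w).inverse (posDeriv L y w - mixedHess L y w w)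

end Derivatives

/-- A positive continuous function on a compact set has a positive lower bound. -/
theorem IsCompact.exists_pos_forall_le {X : Type*} [TopologicalSpace X] {K : Set X}
    (hK : IsCompact K) {f : X → ℝ} (hf : ContinuousOn f K) (hpos : ∀ x ∈ K, 0 < f x) :
    ∃ c > 0, ∀ x ∈ K, c ≤ f x := by
  rcases K.eq_empty_or_nonempty with rfl | hne
  · exact ⟨1, one_pos, by simp⟩
  · obtain ⟨x, hx, h⟩ := hK.exists_isMinOn hne hf
    exact ⟨f x, hpos x hx, fun y hy => h hy⟩

/-- A continuous function on a compact set is bounded in norm by a positive constant. -/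
theorem IsCompact.exists_pos_forall_norm_le {X G : Type*} [TopologicalSpace X]
    [SeminormedAddCommGroup G] {K : Set X}
    (hK : IsCompact K) {f : X → G} (hf : ContinuousOn f K) :
    ∃ C > 0, ∀ x ∈ K, ‖f x‖ ≤ C := by
  obtain ⟨C, hC⟩ := hK.exists_bound_of_continuousOn hf
  exact ⟨max C 1, by positivity, fun x hx => (hC x hx).trans (le_max_left _ _)⟩

theorem fderiv_const_smul_field_fun {E G : Type*} [NormedAddCommGroup E] [NormedSpace ℝ E]
    [NormedAddCommGroup G] [NormedSpace ℝ G] (f : E → G) (c : ℝ) (x : E) :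
    fderiv ℝ (fun y => c • f y) x = c • fderiv ℝ f x :=
  congrFun (fderiv_const_smul_field c) x

theorem fderiv_prod_left {E G : Type*} [NormedAddCommGroup E] [NormedSpace ℝ E]
    [NormedAddCommGroup G] [NormedSpace ℝ G] {f : E × E → G} {y w : E}
    (h : DifferentiableAt ℝ f (y, w)) :
    HasFDerivAt (fun y => f (y, w)) ((fderiv ℝ f (y, w)).comp (ContinuousLinearMap.inl ℝ E E)) y :=
  h.hasFDerivAt.comp y (hasFDerivAt_prodMk_left y w)

theorem fderiv_prod_right {E G : Type*} [NormedAddCommGroup E] [NormedSpace ℝ E]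
    [NormedAddCommGroup G] [NormedSpace ℝ G] {f : E × E → G} {y w : E}
    (h : DifferentiableAt ℝ f (y, w)) :
    HasFDerivAt (fun w => f (y, w)) ((fderiv ℝ f (y, w)).comp (ContinuousLinearMap.inr ℝ E E)) w :=
  h.hasFDerivAt.comp w (hasFDerivAt_prodMk_right y w)

/-- If `f` is `C^1` on `U × (E \ 0)`, then `f(·, w)` is Lipschitz on compact balls, uniformly for
unit vectors `w`. -/
theorem exists_lipschitz_of_contDiffOn {E G : Type*} [NormedAddCommGroup E] [NormedSpace ℝ E]
    [FiniteDimensional ℝ E] [NormedAddCommGroup G] [NormedSpace ℝ G] {U : Set E} (hU : IsOpen U)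
    {f : E × E → G} (hf : ContDiffOn ℝ 1 f (U ×ˢ {0}ᶜ)) {y₀ : E} {R : ℝ}
    (hR : closedBall y₀ R ⊆ U) :
    ∃ C > 0, ∀ y ∈ closedBall y₀ R, ∀ y' ∈ closedBall y₀ R, ∀ w : E, ‖w‖ = 1 →
      ‖f (y', w) - f (y, w)‖ ≤ C * ‖y' - y‖ := by
  have hop : IsOpen (U ×ˢ ({0}ᶜ : Set E)) := hU.prod isOpen_compl_singleton
  have hcont : ContinuousOn (fderiv ℝ f) (U ×ˢ {0}ᶜ) := hf.continuousOn_fderiv_of_isOpen hop le_rfl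
  have hsub : closedBall y₀ R ×ˢ sphere (0 : E) 1 ⊆ U ×ˢ {0}ᶜ := by
    rintro ⟨y, w⟩ ⟨hy, hw⟩
    exact ⟨hR hy, by rintro rfl; simp at hw⟩
  have : ProperSpace E := FiniteDimensional.proper_real E
  obtain ⟨C, hC, hb⟩ := ((isCompact_closedBall y₀ R).prod
    (isCompact_sphere (0 : E) 1)).exists_pos_forall_norm_le (hcont.mono hsub)
  refine ⟨C, hC, fun y hy y' hy' w hw => ?_⟩
  have hdiff : ∀ z ∈ closedBall y₀ R, DifferentiableAt ℝ f (z, w) := fun z hz =>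
    (hf.differentiableOn one_ne_zero).differentiableAt
      (hop.mem_nhds (hsub ⟨hz, by simpa using hw⟩))
  refine (convex_closedBall y₀ R).norm_image_sub_le_of_norm_hasFDerivWithin_le
    (f := fun z => f (z, w)) (fun z hz => (fderiv_prod_left (hdiff z hz)).hasFDerivWithinAt)
    (fun z hz => ?_) hy hy'
  refine (ContinuousLinearMap.opNorm_comp_le _ _).trans ?_
  calc _ ≤ C * 1 := by
        gcongr
        · exact hb (z, w) ⟨hz, by simpa using hw⟩
        · exact ContinuousLinearMap.norm_inl_le_one ℝ E E
    _ = C := mul_one C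

namespace IsFinslerLagrangian

variable {E : Type*} [NormedAddCommGroup E] [NormedSpace ℝ E]
  {U : Set E} {L : E → E → ℝ} (hL : IsFinslerLagrangian U L)

include hL

theorem isOpen_prod : IsOpen (U ×ˢ ({0}ᶜ : Set E)) := hL.isOpen.prod isOpen_compl_singleton

theorem contDiffAt {y w : E} (hy : y ∈ U) (hw : w ≠ 0) :
    ContDiffAt ℝ ∞ (fun z : E × E => L z.1 z.2) (y, w) :=
  hL.smooth.contDiffAt (hL.isOpen_prod.mem_nhds ⟨hy, hw⟩)

theorem differentiableAt {y w : E} (hy : y ∈ U) (hw : w ≠ 0) :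
    DifferentiableAt ℝ (fun z : E × E => L z.1 z.2) (y, w) :=
  (hL.contDiffAt hy hw).differentiableAt (by simp)

theorem hasFDerivAt_vel {y w : E} (hy : y ∈ U) (hw : w ≠ 0) :
    HasFDerivAt (L y) (velDeriv L y w) w :=
  (fderiv_prod_right (hL.differentiableAt hy hw)).differentiableAt.hasFDerivAt

theorem hasFDerivAt_pos {y w : E} (hy : y ∈ U) (hw : w ≠ 0) :
    HasFDerivAt (fun y => L y w) (posDeriv L y w) y :=
  (fderiv_prod_left (hL.differentiableAt hy hw)).differentiableAt.hasFDerivAt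

theorem contDiffOn_velDeriv :
    ContDiffOn ℝ ∞ (fun z : E × E => velDeriv L z.1 z.2) (U ×ˢ {0}ᶜ) := by
  have h := hL.smooth.fderiv_of_isOpen hL.isOpen_prod (m := ∞) (by simp)
  refine (h.clm_comp (contDiffOn_const (c := ContinuousLinearMap.inr ℝ E E))).congr ?_
  rintro ⟨y, w⟩ ⟨hy, hw⟩
  exact (fderiv_prod_right (hL.differentiableAt hy hw)).fderiv

theorem contDiffOn_posDeriv :
    ContDiffOn ℝ ∞ (fun z : E × E => posDeriv L z.1 z.2) (U ×ˢ {0}ᶜ) := by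
  have h := hL.smooth.fderiv_of_isOpen hL.isOpen_prod (m := ∞) (by simp)
  refine (h.clm_comp (contDiffOn_const (c := ContinuousLinearMap.inl ℝ E E))).congr ?_
  rintro ⟨y, w⟩ ⟨hy, hw⟩
  exact (fderiv_prod_left (hL.differentiableAt hy hw)).fderiv

theorem differentiableAt_velDeriv {y w : E} (hy : y ∈ U) (hw : w ≠ 0) :
    DifferentiableAt ℝ (fun z : E × E => velDeriv L z.1 z.2) (y, w) :=
  (hL.contDiffOn_velDeriv.contDiffAt (hL.isOpen_prod.mem_nhds (mk_mem_prod hy hw))).differentiableAt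
    (by simp)

theorem contDiffOn_velHess :
    ContDiffOn ℝ ∞ (fun z : E × E => velHess L z.1 z.2) (U ×ˢ {0}ᶜ) := by
  have h := hL.contDiffOn_velDeriv.fderiv_of_isOpen hL.isOpen_prod (m := ∞) (by simp)
  refine (h.clm_comp (contDiffOn_const (c := ContinuousLinearMap.inr ℝ E E))).congr ?_
  rintro ⟨y, w⟩ ⟨hy, hw⟩
  exact (fderiv_prod_right (hL.differentiableAt_velDeriv hy hw)).fderiv

theorem contDiffOn_mixedHess :
    ContDiffOn ℝ ∞ (fun z : E × E => mixedHess L z.1 z.2) (U ×ˢ {0}ᶜ) := by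
  have h := hL.contDiffOn_velDeriv.fderiv_of_isOpen hL.isOpen_prod (m := ∞) (by simp)
  refine (h.clm_comp (contDiffOn_const (c := ContinuousLinearMap.inl ℝ E E))).congr ?_
  rintro ⟨y, w⟩ ⟨hy, hw⟩
  exact (fderiv_prod_left (hL.differentiableAt_velDeriv hy hw)).fderiv

theorem hasFDerivAt_velDeriv {y w : E} (hy : y ∈ U) (hw : w ≠ 0) :
    HasFDerivAt (velDeriv L y) (velHess L y w) w :=
  (fderiv_prod_right (hL.differentiableAt_velDeriv hy hw)).differentiableAt.hasFDerivAt

/-- The momentum along a curve is differentiable. -/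
theorem hasDerivAt_momentum {u v : ℝ → E} {t : ℝ} {u' v' : E} (hu : HasDerivAt u u' t)
    (hv : HasDerivAt v v' t) (hy : u t ∈ U) (hw : v t ≠ 0) :
    HasDerivAt (fun s => velDeriv L (u s) (v s))
      (mixedHess L (u t) (v t) u' + velHess L (u t) (v t) v') t := by
  have hd := hL.differentiableAt_velDeriv hy hw
  have h := hd.hasFDerivAt.comp_hasDerivAt t (hu.prodMk hv)
  have h1 : mixedHess L (u t) (v t) = _ := (fderiv_prod_left hd).fderiv
  have h2 : velHess L (u t) (v t) = _ := (fderiv_prod_right hd).fderiv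
  refine h.congr_deriv ?_
  rw [h1, h2]
  simp [← map_add]

theorem hasDerivAt_lagrangian {u v : ℝ → E} {t : ℝ} {u' v' : E} (hu : HasDerivAt u u' t)
    (hv : HasDerivAt v v' t) (hy : u t ∈ U) (hw : v t ≠ 0) :
    HasDerivAt (fun s => L (u s) (v s))
      (posDeriv L (u t) (v t) u' + velDeriv L (u t) (v t) v') t := by
  have hd := hL.differentiableAt hy hw
  have h := hd.hasFDerivAt.comp_hasDerivAt t (hu.prodMk hv)
  have h1 : posDeriv L (u t) (v t) = _ := (fderiv_prod_left hd).fderiv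
  have h2 : velDeriv L (u t) (v t) = _ := (fderiv_prod_right hd).fderiv
  refine h.congr_deriv ?_
  rw [h1, h2]
  simp [← map_add]

/-! #### Homogeneity -/

theorem apply_zero {y : E} (hy : y ∈ U) : L y 0 = 0 := by
  have := hL.homog y hy 0 2 two_pos
  rw [smul_zero] at this
  linarith

theorem posDeriv_zero {y : E} (hy : y ∈ U) : posDeriv L y 0 = 0 := by
  have : (fun y => L y 0) =ᶠ[𝓝 y] fun _ => 0 := by
    filter_upwards [hL.isOpen.mem_nhds hy] with z hz using hL.apply_zero hz
  rw [posDeriv, this.fderiv_eq]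
  simp

theorem spray_zero {y : E} (hy : y ∈ U) : spray L y 0 = 0 := by
  simp [spray, hL.posDeriv_zero hy]

theorem velDeriv_smul {y w : E} (hy : y ∈ U) {r : ℝ} (hr : 0 < r) :
    velDeriv L y (r • w) = r • velDeriv L y w := by
  have h1 : L y = fun w => r ^ 2 * L y (r⁻¹ • w) := by
    funext w
    rw [hL.homog y hy _ _ (inv_pos.2 hr)]
    field_simp
  have h2 : fderiv ℝ (fun w => r ^ 2 * L y (r⁻¹ • w)) (r • w) = r • velDeriv L y w := by
    have := fderiv_comp_smul (𝕜 := ℝ) (f := L y) (c := r⁻¹) (x := r • w)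
    change fderiv ℝ (fun w => (r ^ 2) • L y (r⁻¹ • w)) (r • w) = _
    rw [fderiv_const_smul_field_fun, this, smul_smul, inv_smul_smul₀ hr.ne']
    rw [velDeriv]
    congr 1
    field_simp
  conv_lhs => rw [velDeriv, h1]
  exact h2

theorem posDeriv_smul {y w : E} (hy : y ∈ U) {r : ℝ} (hr : 0 < r) :
    posDeriv L y (r • w) = r ^ 2 • posDeriv L y w := by
  have : (fun y => L y (r • w)) =ᶠ[𝓝 y] fun y => (r ^ 2) • L y w := by
    filter_upwards [hL.isOpen.mem_nhds hy] with z hz using hL.homog z hz _ _ hr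
  rw [posDeriv, this.fderiv_eq, fderiv_const_smul_field_fun]
  rfl

theorem mixedHess_smul {y w : E} (hy : y ∈ U) {r : ℝ} (hr : 0 < r) :
    mixedHess L y (r • w) = r • mixedHess L y w := by
  have : (fun y => velDeriv L y (r • w)) =ᶠ[𝓝 y] fun y => r • velDeriv L y w := by
    filter_upwards [hL.isOpen.mem_nhds hy] with z hz using hL.velDeriv_smul hz hr
  rw [mixedHess, this.fderiv_eq]
  exact fderiv_const_smul_field_fun (fun y => velDeriv L y w) r y

theorem velHess_smul {y w : E} (hy : y ∈ U) {r : ℝ} (hr : 0 < r) :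
    velHess L y (r • w) = velHess L y w := by
  have h1 : velDeriv L y = fun w => r • velDeriv L y (r⁻¹ • w) := by
    funext w
    rw [hL.velDeriv_smul hy (inv_pos.2 hr), smul_smul, mul_inv_cancel₀ hr.ne', one_smul]
  have h2 : fderiv ℝ (fun w => r • velDeriv L y (r⁻¹ • w)) (r • w) = velHess L y w := by
    have := fderiv_comp_smul (𝕜 := ℝ) (f := velDeriv L y) (c := r⁻¹) (x := r • w)
    refine (fderiv_const_smul_field_fun (fun w => velDeriv L y (r⁻¹ • w)) r _).trans ?_
    rw [this, smul_smul, inv_smul_smul₀ hr.ne', mul_inv_cancel₀ hr.ne', one_smul]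
    rfl
  conv_lhs => rw [velHess, h1]
  exact h2

theorem spray_smul {y w : E} (hy : y ∈ U) {r : ℝ} (hr : 0 < r) :
    spray L y (r • w) = r ^ 2 • spray L y w := by
  simp only [spray, hL.velHess_smul hy hr, hL.posDeriv_smul hy hr, hL.mixedHess_smul hy hr]
  rw [← map_smul, smul_sub]
  congr 2
  simp [smul_smul, sq]

/-- Euler's identity for the velocity derivative. -/
theorem velDeriv_self {y w : E} (hy : y ∈ U) (hw : w ≠ 0) : velDeriv L y w w = 2 * L y w := by
  have h1 : HasDerivAt (fun r : ℝ => L y (r • w)) (velDeriv L y w w) 1 := by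
    have := (hL.hasFDerivAt_vel hy (w := (1 : ℝ) • w) (by simpa using hw)).comp_hasDerivAt (1 : ℝ)
      ((hasDerivAt_id (1 : ℝ)).smul_const w)
    simpa [Function.comp_def] using this
  have h2 : HasDerivAt (fun r : ℝ => r ^ 2 * L y w) (2 * L y w) 1 := by
    simpa using (hasDerivAt_pow 2 (1 : ℝ)).mul_const (L y w)
  refine h1.unique (h2.congr_of_eventuallyEq ?_)
  filter_upwards [lt_mem_nhds one_pos] with r hr using hL.homog y hy w r hr

/-- Euler's identity for the fibre Hessian. -/
theorem velHess_self {y w : E} (hy : y ∈ U) (hw : w ≠ 0) :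
    velHess L y w w = velDeriv L y w := by
  have h1 : HasDerivAt (fun r : ℝ => velDeriv L y (r • w)) (velHess L y w w) 1 := by
    have := (hL.hasFDerivAt_velDeriv hy (w := (1 : ℝ) • w) (by simpa using hw)).comp_hasDerivAt
      (1 : ℝ) ((hasDerivAt_id (1 : ℝ)).smul_const w)
    simpa [Function.comp_def] using this
  have h2 : HasDerivAt (fun r : ℝ => r • velDeriv L y w) (velDeriv L y w) 1 := by
    simpa using (hasDerivAt_id (1 : ℝ)).smul_const (velDeriv L y w)
  refine h1.unique (h2.congr_of_eventuallyEq ?_)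
  filter_upwards [lt_mem_nhds one_pos] with r hr using hL.velDeriv_smul hy hr

theorem velHess_pos {y ξ η : E} (hy : y ∈ U) (hξ : ξ ≠ 0) (hη : η ≠ 0) :
    0 < velHess L y ξ η η := hL.hess y hy ξ η hξ hη

theorem pos {y w : E} (hy : y ∈ U) (hw : w ≠ 0) : 0 < L y w := by
  have := hL.velHess_pos hy hw hw
  rw [hL.velHess_self hy hw, hL.velDeriv_self hy hw] at this
  linarith

theorem nonneg {y : E} (w : E) (hy : y ∈ U) : 0 ≤ L y w := by
  by_cases hw : w = 0
  · rw [hw, hL.apply_zero hy]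
  · exact (hL.pos hy hw).le

theorem velHess_injective {y w : E} (hy : y ∈ U) (hw : w ≠ 0) :
    Function.Injective (velHess L y w) := by
  refine (injective_iff_map_eq_zero _).2 fun η h => ?_
  by_contra hη
  have := hL.velHess_pos hy hw hη
  simp [h] at this

theorem isInvertible_velHess [FiniteDimensional ℝ E] {y w : E} (hy : y ∈ U) (hw : w ≠ 0) :
    (velHess L y w).IsInvertible := by
  have hinj := hL.velHess_injective hy hw
  have hdim : Module.finrank ℝ E = Module.finrank ℝ (E →L[ℝ] ℝ) := by
    rw [← LinearEquiv.finrank_eq (LinearMap.toContinuousLinearMap (𝕜 := ℝ) (E := E) (F' := ℝ))]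
    exact (Subspace.dual_finrank_eq (K := ℝ) (V := E)).symm
  let e : E ≃ₗ[ℝ] (E →L[ℝ] ℝ) := LinearEquiv.ofInjectiveOfFinrankEq
    ((velHess L y w : E →ₗ[ℝ] (E →L[ℝ] ℝ))) hinj hdim
  exact ⟨e.toContinuousLinearEquiv, by ext; rfl⟩

theorem velHess_spray [FiniteDimensional ℝ E] {y w : E} (hy : y ∈ U) (hw : w ≠ 0) :
    velHess L y w (spray L y w) = posDeriv L y w - mixedHess L y w w := by
  obtain ⟨e, he⟩ := hL.isInvertible_velHess hy hw
  rw [spray, ← he, ContinuousLinearMap.inverse_equiv]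
  simp

theorem contDiffOn_spray [FiniteDimensional ℝ E] :
    ContDiffOn ℝ ∞ (fun z : E × E => spray L z.1 z.2) (U ×ˢ {0}ᶜ) := by
  have h1 : ContDiffOn ℝ ∞ (fun z : E × E => (velHess L z.1 z.2).inverse) (U ×ˢ {0}ᶜ) := by
    rintro ⟨y, w⟩ hz
    obtain ⟨e, he⟩ := hL.isInvertible_velHess hz.1 hz.2
    have h := contDiffAt_map_inverse (n := ∞) e
    rw [he] at h
    exact ContDiffAt.comp_contDiffWithinAt (y, w) h (hL.contDiffOn_velHess _ hz)
  exact h1.clm_apply (hL.contDiffOn_posDeriv.sub (hL.contDiffOn_mixedHess.clm_apply contDiffOn_snd))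

end IsFinslerLagrangian

theorem norm_inv_smul_self_eq_one {E : Type*} [NormedAddCommGroup E] [NormedSpace ℝ E] {w : E}
    (hw : w ≠ 0) : ‖(‖w‖⁻¹ • w)‖ = 1 := by
  rw [norm_smul, norm_inv, norm_norm, inv_mul_cancel₀ (norm_ne_zero_iff.2 hw)]

/-- If `f` is `C^1` with second derivative at least `m` on `[0, 1]`, then
`f 1 ≥ f 0 + f' 0 + m / 2`. -/
theorem add_deriv_add_half_le {f f' f'' : ℝ → ℝ} {m : ℝ}
    (h1 : ∀ s ∈ Icc (0 : ℝ) 1, HasDerivAt f (f' s) s)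
    (h2 : ∀ s ∈ Icc (0 : ℝ) 1, HasDerivAt f' (f'' s) s)
    (hm : ∀ s ∈ Icc (0 : ℝ) 1, m ≤ f'' s) : f 0 + f' 0 + m / 2 ≤ f 1 := by
  have hmono' : MonotoneOn (fun s => f' s - m * s) (Icc 0 1) := by
    refine monotoneOn_of_hasDerivWithinAt_nonneg (convex_Icc 0 1) (f' := fun s => f'' s - m)
      (fun s hs => ?_) (fun s hs => ?_) (fun s hs => ?_)
    · exact ((h2 s hs).continuousAt.sub (by fun_prop)).continuousWithinAt
    · have := (h2 s (interior_subset hs)).sub ((hasDerivAt_id s).const_mul m)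
      exact (this.congr_deriv (by simp)).hasDerivWithinAt
    · have := hm s (interior_subset hs)
      simpa using this
  have hmono : MonotoneOn (fun s => f s - f' 0 * s - m / 2 * s ^ 2) (Icc 0 1) := by
    refine monotoneOn_of_hasDerivWithinAt_nonneg (convex_Icc 0 1)
      (f' := fun s => f' s - f' 0 - m * s) (fun s hs => ?_) (fun s hs => ?_) (fun s hs => ?_)
    · exact (((h1 s hs).continuousAt.sub (by fun_prop)).sub (by fun_prop)).continuousWithinAt
    · have := ((h1 s (interior_subset hs)).sub ((hasDerivAt_id s).const_mul (f' 0))).sub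
        ((hasDerivAt_pow 2 s).const_mul (m / 2))
      refine (this.congr_deriv ?_).hasDerivWithinAt
      simp; ring
    · have hs' := interior_subset hs
      have := hmono' (left_mem_Icc.2 zero_le_one) hs' hs'.1
      simp at this
      linarith
  have := hmono (left_mem_Icc.2 zero_le_one) (right_mem_Icc.2 zero_le_one) zero_le_one
  simp at this
  linarith

namespace IsFinslerLagrangian

variable {E : Type*} [NormedAddCommGroup E] [NormedSpace ℝ E] [FiniteDimensional ℝ E]
  {U : Set E} {L : E → E → ℝ} (hL : IsFinslerLagrangian U L)

include hL

theorem exists_bounds {y₀ : E} {R : ℝ} (hR : closedBall y₀ R ⊆ U) :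
    ∃ c > 0, ∃ C > 0, ∀ y ∈ closedBall y₀ R, ∀ w : E,
      c * ‖w‖ ^ 2 ≤ L y w ∧ L y w ≤ C * ‖w‖ ^ 2 := by
  have : ProperSpace E := FiniteDimensional.proper_real E
  have hsub : closedBall y₀ R ×ˢ sphere (0 : E) 1 ⊆ U ×ˢ {0}ᶜ := by
    rintro ⟨y, w⟩ ⟨hy, hw⟩
    exact ⟨hR hy, by rintro rfl; simp at hw⟩
  have hK := (isCompact_closedBall y₀ R).prod (isCompact_sphere (0 : E) 1)
  obtain ⟨c, hc, hcb⟩ := hK.exists_pos_forall_le (hL.smooth.continuousOn.mono hsub)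
    (fun z hz => hL.pos (hsub hz).1 (hsub hz).2)
  obtain ⟨C, hC, hCb⟩ := hK.exists_pos_forall_norm_le (hL.smooth.continuousOn.mono hsub)
  refine ⟨c, hc, C, hC, fun y hy w => ?_⟩
  by_cases hw : w = 0
  · simp [hw, hL.apply_zero (hR hy)]
  have hn := norm_inv_smul_self_eq_one hw
  have h0 : 0 < ‖w‖ := norm_pos_iff.2 hw
  have hw' : L y w = ‖w‖ ^ 2 * L y (‖w‖⁻¹ • w) := by
    rw [hL.homog y (hR hy) _ _ (inv_pos.2 h0)]
    field_simp
  have h1 := hcb (y, ‖w‖⁻¹ • w) ⟨hy, by simpa using hn⟩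
  have h2 := (le_abs_self _).trans (hCb (y, ‖w‖⁻¹ • w) ⟨hy, by simpa using hn⟩)
  simp only at h1 h2
  rw [hw']
  constructor <;> nlinarith [sq_nonneg ‖w‖, sq_pos_of_pos h0]

theorem hasFDerivAt_vel_zero {y : E} (hy : y ∈ U) : HasFDerivAt (L y) (0 : E →L[ℝ] ℝ) 0 := by
  obtain ⟨R, hR, hsub⟩ := Metric.nhds_basis_closedBall.mem_iff.1 (hL.isOpen.mem_nhds hy)
  obtain ⟨c, hc, C, hC, hb⟩ := hL.exists_bounds hsub
  refine HasFDerivAt.of_isLittleO ?_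
  have h1 : (fun w : E => L y w - L y 0 - (0 : E →L[ℝ] ℝ) (w - 0)) =O[𝓝 0] fun w => ‖w‖ ^ 2 := by
    refine Asymptotics.IsBigO.of_bound C (Eventually.of_forall fun w => ?_)
    have := hb y (mem_closedBall_self hR.le) w
    rw [hL.apply_zero hy, Real.norm_eq_abs, abs_le]
    simp
    constructor <;> nlinarith [this.1, this.2, sq_nonneg ‖w‖]
  refine h1.trans_isLittleO ?_
  simpa using (Asymptotics.isLittleO_norm_pow_id (n := 2) (E' := E) one_lt_two)

theorem velDeriv_zero {y : E} (hy : y ∈ U) : velDeriv L y 0 = 0 :=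
  (hL.hasFDerivAt_vel_zero hy).fderiv

/-- Uniform strict convexity in the velocity. -/
theorem exists_convexity {y₀ : E} {R : ℝ} (hR : closedBall y₀ R ⊆ U) :
    ∃ c > 0, ∀ y ∈ closedBall y₀ R, ∀ w w' : E,
      L y w + velDeriv L y w (w' - w) + c * ‖w' - w‖ ^ 2 ≤ L y w' := by
  have : ProperSpace E := FiniteDimensional.proper_real E
  have hsub : closedBall y₀ R ×ˢ sphere (0 : E) 1 ⊆ U ×ˢ {0}ᶜ := by
    rintro ⟨y, w⟩ ⟨hy, hw⟩
    exact ⟨hR hy, by rintro rfl; simp at hw⟩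
  have hK := ((isCompact_closedBall y₀ R).prod (isCompact_sphere (0 : E) 1)).prod
    (isCompact_sphere (0 : E) 1)
  obtain ⟨m, hm, hmb⟩ := hK.exists_pos_forall_le
    (f := fun z : (E × E) × E => velHess L z.1.1 z.1.2 z.2 z.2) (by
      have h1 : ContinuousOn (fun z : (E × E) × E => velHess L z.1.1 z.1.2)
          ((closedBall y₀ R ×ˢ sphere (0 : E) 1) ×ˢ sphere (0 : E) 1) :=
        (hL.contDiffOn_velHess.continuousOn.mono hsub).comp continuousOn_fst (fun z hz => hz.1)
      exact (h1.clm_apply continuousOn_snd).clm_apply continuousOn_snd)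
    (fun z hz => hL.velHess_pos (hsub hz.1).1 (hsub hz.1).2
      (by intro h; have := hz.2; rw [h] at this; simp at this))
  have hess : ∀ y ∈ closedBall y₀ R, ∀ w η : E, w ≠ 0 → m * ‖η‖ ^ 2 ≤ velHess L y w η η := by
    intro y hy w η hw
    by_cases hη : η = 0
    · simp [hη]
    have h0 : 0 < ‖w‖ := norm_pos_iff.2 hw
    have h1 : 0 < ‖η‖ := norm_pos_iff.2 hη
    have h2 := hmb ((y, ‖w‖⁻¹ • w), ‖η‖⁻¹ • η) ⟨⟨hy, by simpa using norm_inv_smul_self_eq_one hw⟩,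
      by simpa using norm_inv_smul_self_eq_one hη⟩
    simp only [hL.velHess_smul (hR hy) (inv_pos.2 h0), map_smul, smul_apply,
      smul_eq_mul] at h2
    calc m * ‖η‖ ^ 2 ≤ (‖η‖⁻¹ * (‖η‖⁻¹ * velHess L y w η η)) * ‖η‖ ^ 2 := by gcongr
      _ = velHess L y w η η := by field_simp
  obtain ⟨c, hc, C, hC, hb⟩ := hL.exists_bounds hR
  refine ⟨min c (m / 2), lt_min hc (by positivity), fun y hy w w' => ?_⟩
  have hyU := hR hy
  by_cases hw : w = 0
  · have := (hb y hy w').1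
    rw [hw, hL.velDeriv_zero hyU, hL.apply_zero hyU]
    simp only [sub_zero, zero_apply, zero_add]
    exact (mul_le_mul_of_nonneg_right (min_le_left _ _) (sq_nonneg _)).trans this
  by_cases hseg : ∃ s ∈ Icc (0 : ℝ) 1, w + s • (w' - w) = 0
  · obtain ⟨s, hs, h⟩ := hseg
    have hs0 : 0 < s := by
      rcases hs.1.lt_or_eq with h' | h'
      · exact h'
      · rw [← h'] at h; simp at h; exact absurd h hw
    have hΔ : w' - w = -(s⁻¹ • w) := by
      have : s • (w' - w) = -w := (neg_eq_of_add_eq_zero_right h).symm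
      rw [← smul_neg, ← this, inv_smul_smul₀ hs0.ne']
    have h1 : velDeriv L y w (w' - w) = -(s⁻¹ * (2 * L y w)) := by
      rw [hΔ, map_neg, map_smul, hL.velDeriv_self hyU hw, smul_eq_mul]
    have hw' : w' = -((s⁻¹ - 1) • w) := by
      rw [sub_smul, one_smul, neg_sub, sub_eq_add_neg w, ← hΔ]; abel
    have hr : 1 ≤ s⁻¹ := (one_le_inv₀ hs0).2 hs.2
    have h2 : ‖w'‖ = (s⁻¹ - 1) * ‖w‖ := by
      rw [hw', norm_neg, norm_smul, Real.norm_eq_abs, abs_of_nonneg (by linarith)]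
    have h3 : ‖w' - w‖ = s⁻¹ * ‖w‖ := by
      rw [hΔ, norm_neg, norm_smul, Real.norm_eq_abs, abs_of_nonneg (by linarith)]
    have h4 := (hb y hy w').1
    have h5 := (hb y hy w).1
    have h6 : min c (m / 2) * ‖w' - w‖ ^ 2 ≤ c * ‖w' - w‖ ^ 2 := by
      gcongr; exact min_le_left _ _
    rw [h1]
    rw [h2] at h4
    rw [h3] at h6 ⊢
    nlinarith [mul_le_mul_of_nonneg_left h5 (show 0 ≤ 2 * s⁻¹ - 1 by linarith)]
  · push Not at hseg
    have hd : ∀ s : ℝ, HasDerivAt (fun s : ℝ => w + s • (w' - w)) (w' - w) s := fun s => by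
      simpa using ((hasDerivAt_id s).smul_const (w' - w)).const_add w
    have key := add_deriv_add_half_le (m := m * ‖w' - w‖ ^ 2) (f := fun s => L y (w + s • (w' - w)))
      (f' := fun s => velDeriv L y (w + s • (w' - w)) (w' - w))
      (f'' := fun s => velHess L y (w + s • (w' - w)) (w' - w) (w' - w))
      (fun s hs => (hL.hasFDerivAt_vel hyU (hseg s hs)).comp_hasDerivAt s (hd s))
      (fun s hs => by
        have := (hL.hasFDerivAt_velDeriv hyU (hseg s hs)).comp_hasDerivAt s (hd s)
        exact ((ContinuousLinearMap.apply ℝ ℝ (w' - w)).hasFDerivAt).comp_hasDerivAt s this)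
      (fun s hs => hess y hy _ _ (hseg s hs))
    simp only [zero_smul, add_zero, one_smul, add_sub_cancel] at key
    have h6 : min c (m / 2) * ‖w' - w‖ ^ 2 ≤ m / 2 * ‖w' - w‖ ^ 2 := by
      gcongr; exact min_le_right _ _
    linarith

/-- The quantitative form of the convexity of the Lagrangian in position and velocity. -/
theorem exists_remainder {y₀ : E} {R : ℝ} (hR : closedBall y₀ R ⊆ U) :
    ∃ c > 0, ∃ C > 0, ∀ y ∈ closedBall y₀ R, ∀ y' ∈ closedBall y₀ R, ∀ w w' : E,
      L y w + posDeriv L y w (y' - y) + velDeriv L y w (w' - w) + c * ‖w' - w‖ ^ 2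
        - C * ‖w‖ ^ 2 * ‖y' - y‖ ^ 2 - C * ‖w‖ * ‖y' - y‖ * ‖w' - w‖ ≤ L y' w' := by
  obtain ⟨c, hc, hconv⟩ := hL.exists_convexity hR
  obtain ⟨C₁, hC₁, h₁⟩ := exists_lipschitz_of_contDiffOn hL.isOpen
    (hL.contDiffOn_posDeriv.of_le (by simp)) hR
  obtain ⟨C₂, hC₂, h₂⟩ := exists_lipschitz_of_contDiffOn hL.isOpen
    (hL.contDiffOn_velDeriv.of_le (by simp)) hR
  have hpos : ∀ y ∈ closedBall y₀ R, ∀ y' ∈ closedBall y₀ R, ∀ w : E, ‖w‖ = 1 →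
      L y w + posDeriv L y w (y' - y) - C₁ * ‖y' - y‖ ^ 2 ≤ L y' w := by
    intro y hy y' hy' w hw
    have hw0 : w ≠ 0 := by rintro rfl; simp at hw
    have hsub : segment ℝ y y' ⊆ closedBall y₀ R := (convex_closedBall y₀ R).segment_subset hy hy'
    have := (convex_segment y y').norm_image_sub_le_of_norm_hasFDerivWithin_le' (C := C₁ * ‖y' - y‖)
      (f := fun z => L z w) (f' := fun z => posDeriv L z w) (φ := posDeriv L y w)
      (fun z hz => (hL.hasFDerivAt_pos (hR (hsub hz)) hw0).hasFDerivWithinAt)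
      (fun z hz => (h₁ y hy z (hsub hz) w hw).trans (by
        gcongr
        have := (convex_closedBall y (dist y' y)).segment_subset
          (mem_closedBall_self dist_nonneg) (mem_closedBall.2 le_rfl) hz
        simpa [dist_eq_norm] using this))
      (left_mem_segment ℝ y y') (right_mem_segment ℝ y y')
    have := (abs_le.1 this).1
    nlinarith
  refine ⟨c, hc, max C₁ C₂, by positivity, fun y hy y' hy' w w' => ?_⟩
  have hA : L y w + posDeriv L y w (y' - y) - max C₁ C₂ * ‖w‖ ^ 2 * ‖y' - y‖ ^ 2 ≤ L y' w := by
    by_cases hw : w = 0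
    · simp [hw, hL.apply_zero (hR hy), hL.apply_zero (hR hy'), hL.posDeriv_zero (hR hy)]
    have h0 : 0 < ‖w‖ := norm_pos_iff.2 hw
    have h := hpos y hy y' hy' (‖w‖⁻¹ • w) (norm_inv_smul_self_eq_one hw)
    rw [hL.homog y (hR hy) _ _ (inv_pos.2 h0), hL.homog y' (hR hy') _ _ (inv_pos.2 h0),
      hL.posDeriv_smul (hR hy) (inv_pos.2 h0), smul_apply, smul_eq_mul] at h
    have h' : L y w + posDeriv L y w (y' - y) - ‖w‖ ^ 2 * (C₁ * ‖y' - y‖ ^ 2) ≤ L y' w := by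
      have := mul_le_mul_of_nonneg_left h (sq_nonneg ‖w‖)
      have e : ∀ a : ℝ, ‖w‖ ^ 2 * ((‖w‖⁻¹) ^ 2 * a) = a := fun a => by field_simp
      rw [mul_sub, mul_add, e, e, e] at this
      exact this
    have : ‖w‖ ^ 2 * (C₁ * ‖y' - y‖ ^ 2) ≤ max C₁ C₂ * ‖w‖ ^ 2 * ‖y' - y‖ ^ 2 := by
      have := le_max_left C₁ C₂
      calc _ = C₁ * ‖w‖ ^ 2 * ‖y' - y‖ ^ 2 := by ring
        _ ≤ _ := by gcongr
    linarith
  have hB : velDeriv L y w (w' - w) - max C₁ C₂ * ‖w‖ * ‖y' - y‖ * ‖w' - w‖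
      ≤ velDeriv L y' w (w' - w) := by
    have hlip : ‖velDeriv L y' w - velDeriv L y w‖ ≤ max C₁ C₂ * ‖w‖ * ‖y' - y‖ := by
      by_cases hw : w = 0
      · simp [hw, hL.velDeriv_zero (hR hy), hL.velDeriv_zero (hR hy')]
      have h0 : 0 < ‖w‖ := norm_pos_iff.2 hw
      have h := h₂ y hy y' hy' (‖w‖⁻¹ • w) (norm_inv_smul_self_eq_one hw)
      have hs : ‖(‖w‖⁻¹ • velDeriv L y' w - ‖w‖⁻¹ • velDeriv L y w)‖
          = ‖w‖⁻¹ * ‖velDeriv L y' w - velDeriv L y w‖ := by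
        have := norm_smul ‖w‖⁻¹ (velDeriv L y' w - velDeriv L y w)
        rwa [norm_inv, norm_norm, smul_sub] at this
      simp only [hL.velDeriv_smul (hR hy) (inv_pos.2 h0),
        hL.velDeriv_smul (hR hy') (inv_pos.2 h0)] at h
      have h2 := mul_le_mul_of_nonneg_left (hs.symm.trans_le h) h0.le
      rw [mul_inv_cancel_left₀ h0.ne'] at h2
      calc _ ≤ ‖w‖ * (C₂ * ‖y' - y‖) := h2
        _ = C₂ * ‖w‖ * ‖y' - y‖ := by ring
        _ ≤ _ := by gcongr; exact le_max_right _ _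
    have h1 := (velDeriv L y' w - velDeriv L y w).le_of_opNorm_le hlip (w' - w)
    have h2 := (abs_le.1 h1).1
    simp only [sub_apply] at h2
    linarith
  have := hconv y' hy' w w'
  linarith

/-- The spray is Lipschitz near the zero section, with the bounds dictated by homogeneity. -/
theorem exists_spray_lipschitz {y₀ : E} {R : ℝ} (hR : closedBall y₀ R ⊆ U) :
    ∃ K > 0, ∀ y ∈ closedBall y₀ R, ∀ y' ∈ closedBall y₀ R, ∀ (r : ℝ) (w w' : E), ‖w‖ ≤ r →
      ‖w'‖ ≤ r → ‖spray L y w - spray L y' w'‖ ≤ K * r * ‖w - w'‖ + K * r ^ 2 * ‖y - y'‖ := by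
  have : ProperSpace E := FiniteDimensional.proper_real E
  have hsub : closedBall y₀ R ×ˢ sphere (0 : E) 1 ⊆ U ×ˢ {0}ᶜ := by
    rintro ⟨y, w⟩ ⟨hy, hw⟩
    exact ⟨hR hy, by rintro rfl; simp at hw⟩
  have hK := (isCompact_closedBall y₀ R).prod (isCompact_sphere (0 : E) 1)
  have hspray := hL.contDiffOn_spray
  obtain ⟨C₀, hC₀, h₀⟩ := hK.exists_pos_forall_norm_le (hspray.continuousOn.mono hsub)
  obtain ⟨C₁, hC₁, h₁⟩ := exists_lipschitz_of_contDiffOn hL.isOpen (hspray.of_le (by simp)) hR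
  obtain ⟨C₂, hC₂, h₂⟩ := hK.exists_pos_forall_norm_le
    ((hspray.continuousOn_fderiv_of_isOpen hL.isOpen_prod (by simp)).mono hsub)
  have hdiff : ∀ y ∈ U, ∀ w ≠ 0, DifferentiableAt ℝ (fun z : E × E => spray L z.1 z.2) (y, w) :=
    fun y hy w hw => (hspray.contDiffAt
      (hL.isOpen_prod.mem_nhds (mk_mem_prod hy hw))).differentiableAt (by simp)
  have hscale : ∀ y ∈ U, ∀ w ≠ 0, spray L y w = ‖w‖ ^ 2 • spray L y (‖w‖⁻¹ • w) := by
    intro y hy w hw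
    have h0 : 0 < ‖w‖ := norm_pos_iff.2 hw
    rw [hL.spray_smul hy (inv_pos.2 h0), smul_smul]
    simp [h0.ne']
  have hnorm : ∀ y ∈ closedBall y₀ R, ∀ w, ‖spray L y w‖ ≤ C₀ * ‖w‖ ^ 2 := by
    intro y hy w
    by_cases hw : w = 0
    · simp [hw, hL.spray_zero (hR hy)]
    rw [hscale y (hR hy) w hw, norm_smul, norm_pow, norm_norm, mul_comm]
    gcongr
    exact h₀ (y, ‖w‖⁻¹ • w) ⟨hy, by simpa using norm_inv_smul_self_eq_one hw⟩
  have hderiv : ∀ y ∈ closedBall y₀ R, ∀ w, ∃ D : E →L[ℝ] E, HasFDerivAt (spray L y) D w ∧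
      ‖D‖ ≤ C₂ * ‖w‖ := by
    intro y hy w
    by_cases hw : w = 0
    · refine ⟨0, ?_, by simp [hw]⟩
      subst hw
      refine HasFDerivAt.of_isLittleO ?_
      have hO : (fun w : E => spray L y w - spray L y 0 - (0 : E →L[ℝ] E) (w - 0)) =O[𝓝 0]
          fun w => ‖w‖ ^ 2 := by
        refine Asymptotics.IsBigO.of_bound C₀ (Eventually.of_forall fun w => ?_)
        simpa [hL.spray_zero (hR hy)] using hnorm y hy w
      refine hO.trans_isLittleO ?_
      simpa using (Asymptotics.isLittleO_norm_pow_id (n := 2) (E' := E) one_lt_two)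
    · have h0 : 0 < ‖w‖ := norm_pos_iff.2 hw
      have hd := (fderiv_prod_right (hdiff y (hR hy) (‖w‖⁻¹ • w)
        (smul_ne_zero (inv_ne_zero h0.ne') hw)))
      set D := (fderiv ℝ (fun z : E × E => spray L z.1 z.2) (y, ‖w‖⁻¹ • w)).comp
        (ContinuousLinearMap.inr ℝ E E) with hD
      have hDn : ‖D‖ ≤ C₂ := by
        refine (ContinuousLinearMap.opNorm_comp_le _ _).trans ?_
        calc _ ≤ C₂ * 1 := by
              gcongr
              · exact h₂ (y, _) ⟨hy, by simpa using norm_inv_smul_self_eq_one hw⟩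
              · exact ContinuousLinearMap.norm_inr_le_one ℝ E E
          _ = C₂ := mul_one _
      refine ⟨‖w‖ • D, ?_, ?_⟩
      · have h1 : HasFDerivAt (fun z : E => ‖w‖⁻¹ • z) (‖w‖⁻¹ • ContinuousLinearMap.id ℝ E) w :=
          (hasFDerivAt_id w).const_smul ‖w‖⁻¹
        have h2 := (HasFDerivAt.comp w hd h1).const_smul (‖w‖ ^ 2)
        have h3 : spray L y = fun z => ‖w‖ ^ 2 • spray L y (‖w‖⁻¹ • z) := by
          funext z
          rw [hL.spray_smul (hR hy) (inv_pos.2 h0), smul_smul]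
          simp [h0.ne']
        have h4 : ‖w‖ ^ 2 • D.comp (‖w‖⁻¹ • ContinuousLinearMap.id ℝ E) = ‖w‖ • D := by
          ext z
          simp [smul_smul, sq, h0.ne']
        rw [h3, ← h4]
        exact h2
      · rw [norm_smul, norm_norm, mul_comm]
        gcongr
  refine ⟨max C₁ C₂, by positivity, fun y hy y' hy' r w w' hw hw' => ?_⟩
  have hr : 0 ≤ r := (norm_nonneg w).trans hw
  choose! D hD hDn using hderiv
  have h1 : ‖spray L y w - spray L y w'‖ ≤ max C₁ C₂ * r * ‖w - w'‖ := by
    refine (convex_closedBall (0 : E) r).norm_image_sub_le_of_norm_hasFDerivWithin_le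
      (fun z _ => (hD y hy z).hasFDerivWithinAt) (fun z hz => ?_) (by simpa using hw')
      (by simpa using hw)
    refine (hDn y hy z).trans ?_
    have : ‖z‖ ≤ r := by simpa using hz
    gcongr
    exact le_max_right _ _
  have h2 : ‖spray L y w' - spray L y' w'‖ ≤ max C₁ C₂ * r ^ 2 * ‖y - y'‖ := by
    by_cases h0 : w' = 0
    · simp only [h0, hL.spray_zero (hR hy), hL.spray_zero (hR hy'), sub_zero, norm_zero]
      positivity
    rw [hscale y (hR hy) w' h0, hscale y' (hR hy') w' h0, ← smul_sub, norm_smul, norm_pow,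
      norm_norm]
    calc ‖w'‖ ^ 2 * ‖spray L y (‖w'‖⁻¹ • w') - spray L y' (‖w'‖⁻¹ • w')‖
        ≤ r ^ 2 * (C₁ * ‖y - y'‖) := by
          gcongr
          exact h₁ y' hy' y hy _ (norm_inv_smul_self_eq_one h0)
      _ = C₁ * r ^ 2 * ‖y - y'‖ := by ring
      _ ≤ _ := by gcongr; exact le_max_left _ _
  calc ‖spray L y w - spray L y' w'‖
      = ‖(spray L y w - spray L y w') + (spray L y w' - spray L y' w')‖ := by abel_nf
    _ ≤ _ := (norm_add_le _ _).trans (add_le_add h1 h2)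

end IsFinslerLagrangian

/-! ### Short geodesics with prescribed endpoints -/

section Extend

open unitInterval

variable {E : Type*} [NormedAddCommGroup E]

/-- The continuous extension of a curve on the unit interval. -/
def extendIcc (h : C(I, E)) : ℝ → E := IccExtend zero_le_one h

theorem continuous_extendIcc (h : C(I, E)) : Continuous (extendIcc h) :=
  h.continuous.Icc_extend'

theorem extendIcc_of_mem (h : C(I, E)) {t : ℝ} (ht : t ∈ Icc (0 : ℝ) 1) :
    extendIcc h t = h ⟨t, ht⟩ := IccExtend_of_mem _ _ ht

theorem norm_extendIcc_le (h : C(I, E)) (t : ℝ) : ‖extendIcc h t‖ ≤ ‖h‖ :=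
  h.norm_coe_le_norm _

theorem norm_extendIcc_sub_le (h h' : C(I, E)) (t : ℝ) :
    ‖extendIcc h t - extendIcc h' t‖ ≤ ‖h - h'‖ :=
  (h - h').norm_coe_le_norm _

end Extend

section BoundaryValue

open unitInterval

variable {E : Type*} [NormedAddCommGroup E] [NormedSpace ℝ E]

/-- The primitive of a curve on the unit interval. -/
def primitiveIcc (h : C(I, E)) (t : ℝ) : E := ∫ s in (0 : ℝ)..t, extendIcc h s

theorem hasDerivAt_primitiveIcc [CompleteSpace E] (h : C(I, E)) (t : ℝ) :
    HasDerivAt (primitiveIcc h) (extendIcc h t) t :=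
  intervalIntegral.integral_hasDerivAt_right
    ((continuous_extendIcc h).intervalIntegrable _ _)
    ((continuous_extendIcc h).stronglyMeasurableAtFilter _ _) (continuous_extendIcc h).continuousAt

theorem continuous_primitiveIcc [CompleteSpace E] (h : C(I, E)) : Continuous (primitiveIcc h) :=
  continuous_iff_continuousAt.2 fun t => (hasDerivAt_primitiveIcc h t).continuousAt

theorem primitiveIcc_sub (h h' : C(I, E)) (t : ℝ) :
    primitiveIcc h t - primitiveIcc h' t = primitiveIcc (h - h') t :=
  (intervalIntegral.integral_sub ((continuous_extendIcc h).intervalIntegrable _ _)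
    ((continuous_extendIcc h').intervalIntegrable _ _)).symm

theorem norm_primitiveIcc_le (h : C(I, E)) {t : ℝ} (ht : t ∈ Icc (0 : ℝ) 1) :
    ‖primitiveIcc h t‖ ≤ ‖h‖ := by
  have := intervalIntegral.norm_integral_le_of_norm_le_const (a := 0) (b := t)
    (f := extendIcc h) (C := ‖h‖) fun s _ => norm_extendIcc_le h s
  refine this.trans ?_
  rw [sub_zero, abs_of_nonneg ht.1]
  exact mul_le_of_le_one_right (norm_nonneg h) ht.2

/-- The primitive with mean zero of a curve on the unit interval. -/
def centeredPrimitive [CompleteSpace E] (h : C(I, E)) : C(I, E) where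
  toFun t := primitiveIcc h t - ∫ s in (0 : ℝ)..1, primitiveIcc h s
  continuous_toFun := by
    have := continuous_primitiveIcc h
    fun_prop

theorem norm_integral_primitiveIcc_le (h : C(I, E)) :
    ‖∫ s in (0 : ℝ)..1, primitiveIcc h s‖ ≤ ‖h‖ := by
  have := intervalIntegral.norm_integral_le_of_norm_le_const (a := 0) (b := 1)
    (f := primitiveIcc h) (C := ‖h‖) fun s hs => norm_primitiveIcc_le h (by
      rw [uIoc_of_le zero_le_one] at hs
      exact ⟨hs.1.le, hs.2⟩)
  simpa using this

theorem centeredPrimitive_sub [CompleteSpace E] (h h' : C(I, E)) :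
    centeredPrimitive h - centeredPrimitive h' = centeredPrimitive (h - h') := by
  ext t
  have h1 := primitiveIcc_sub h h'
  have h2 : ∫ s in (0 : ℝ)..1, primitiveIcc (h - h') s
      = (∫ s in (0 : ℝ)..1, primitiveIcc h s) - ∫ s in (0 : ℝ)..1, primitiveIcc h' s := by
    rw [← intervalIntegral.integral_sub ((continuous_primitiveIcc h).intervalIntegrable _ _)
      ((continuous_primitiveIcc h').intervalIntegrable _ _)]
    simp only [h1]
  simp only [centeredPrimitive, ContinuousMap.sub_apply, ContinuousMap.coe_mk, h2]
  rw [← h1]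
  abel

theorem norm_centeredPrimitive_le [CompleteSpace E] (h : C(I, E)) :
    ‖centeredPrimitive h‖ ≤ 2 * ‖h‖ := by
  refine (ContinuousMap.norm_le _ (by positivity)).2 fun t => ?_
  calc ‖primitiveIcc h t - ∫ s in (0 : ℝ)..1, primitiveIcc h s‖
      ≤ ‖primitiveIcc h t‖ + ‖∫ s in (0 : ℝ)..1, primitiveIcc h s‖ := norm_sub_le _ _
    _ ≤ ‖h‖ + ‖h‖ := add_le_add (norm_primitiveIcc_le h t.2) (norm_integral_primitiveIcc_le h)
    _ = 2 * ‖h‖ := by ring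

theorem primitiveIcc_const_add_centeredPrimitive [CompleteSpace E] (a : E) (h : C(I, E)) :
    primitiveIcc (ContinuousMap.const I a + centeredPrimitive h) 1 = a := by
  have h1 : ∀ s ∈ uIcc (0 : ℝ) 1,
      extendIcc (ContinuousMap.const I a + centeredPrimitive h) s
        = a + (primitiveIcc h s - ∫ s in (0 : ℝ)..1, primitiveIcc h s) := by
    intro s hs
    rw [uIcc_of_le zero_le_one] at hs
    rw [extendIcc_of_mem _ hs]
    rfl
  have hi := (continuous_primitiveIcc h).intervalIntegrable (μ := MeasureTheory.volume) 0 1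
  rw [primitiveIcc, intervalIntegral.integral_congr h1, intervalIntegral.integral_add (by simp)
    (hi.sub (by simp)), intervalIntegral.integral_sub hi (by simp)]
  simp

end BoundaryValue

namespace IsFinslerLagrangian

open unitInterval

variable {E : Type*} [NormedAddCommGroup E] [NormedSpace ℝ E] [FiniteDimensional ℝ E]
  {U : Set E} {L : E → E → ℝ} (hL : IsFinslerLagrangian U L)

include hL

theorem continuousOn_spray :
    ContinuousOn (fun z : E × E => spray L z.1 z.2) (U ×ˢ univ) := by
  rintro ⟨y, w⟩ ⟨hy, -⟩
  obtain ⟨R, hR, hsub⟩ := Metric.nhds_basis_closedBall.mem_iff.1 (hL.isOpen.mem_nhds hy)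
  obtain ⟨K, hK, hlip⟩ := hL.exists_spray_lipschitz hsub
  refine ContinuousAt.continuousWithinAt ?_
  rw [ContinuousAt, tendsto_iff_norm_sub_tendsto_zero]
  have hev : ∀ᶠ z : E × E in 𝓝 (y, w), ‖spray L z.1 z.2 - spray L y w‖ ≤
      K * (‖w‖ + 1) * ‖z.2 - w‖ + K * (‖w‖ + 1) ^ 2 * ‖z.1 - y‖ := by
    have h1 : ∀ᶠ z : E × E in 𝓝 (y, w), z.1 ∈ closedBall y R :=
      continuous_fst.continuousAt.eventually (closedBall_mem_nhds y hR)
    have h2 : ∀ᶠ z : E × E in 𝓝 (y, w), ‖z.2‖ < ‖w‖ + 1 :=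
      (continuous_snd.norm.continuousAt (x := (y, w))).eventually
        (gt_mem_nhds (by simp))
    filter_upwards [h1, h2] with z hz1 hz2
    exact hlip z.1 hz1 y (mem_closedBall_self hR.le) _ _ _ hz2.le (by simp)
  refine squeeze_zero' (Eventually.of_forall fun _ => norm_nonneg _) hev ?_
  have : ContinuousAt (fun z : E × E => K * (‖w‖ + 1) * ‖z.2 - w‖ + K * (‖w‖ + 1) ^ 2 * ‖z.1 - y‖)
      (y, w) := by fun_prop
  simpa [ContinuousAt] using this

/-- Nearby points are joined by a short solution of the Euler-Lagrange equation over the unit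
interval, depending continuously on the endpoints. The curve is given by its velocity. -/
theorem exists_boundary_value {y₀ : E} {R ε : ℝ} (hR0 : 0 < R) (hR : closedBall y₀ R ⊆ U)
    (hε : 0 < ε) :
    ∃ ρ > 0, ρ ≤ ε ∧ ρ ≤ R ∧ ∃ (C : ℝ) (w : E → E → C(I, E)), 0 < C ∧
      ∀ p ∈ closedBall y₀ ρ, ∀ q ∈ closedBall y₀ ρ,
        ‖w p q‖ ≤ 2 * ‖q - p‖ ∧ (p ≠ q → ∀ t, w p q t ≠ 0) ∧
        (∀ t ∈ Icc (0 : ℝ) 1, p + primitiveIcc (w p q) t ∈ closedBall y₀ R) ∧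
        primitiveIcc (w p q) 1 = q - p ∧
        (∀ t ∈ Ioo (0 : ℝ) 1, HasDerivAt (extendIcc (w p q))
          (spray L (p + primitiveIcc (w p q) t) (extendIcc (w p q) t)) t) ∧
        ∀ p' ∈ closedBall y₀ ρ, ∀ q' ∈ closedBall y₀ ρ,
          ‖w p q - w p' q'‖ ≤ C * (‖p - p'‖ + ‖q - q'‖) := by
  obtain ⟨K, hK, hlip⟩ := hL.exists_spray_lipschitz hR
  obtain ⟨ρ, hρ0, hρε, hρR, hρ1, hρK⟩ : ∃ ρ > 0, ρ ≤ ε ∧ 5 * ρ ≤ R ∧ 4 * ρ ≤ 1 ∧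
      8 * K * (4 * ρ) ≤ 1 := by
    refine ⟨min (min ε (R / 5)) (min (1 / 4) (1 / (32 * K))), by positivity,
      (min_le_left _ _).trans (min_le_left _ _), ?_, ?_, ?_⟩
    · have := (min_le_left (min ε (R / 5)) (min (1 / 4) (1 / (32 * K)))).trans (min_le_right _ _)
      linarith
    · have := (min_le_right (min ε (R / 5)) (min (1 / 4) (1 / (32 * K)))).trans (min_le_left _ _)
      linarith
    · have := (min_le_right (min ε (R / 5)) (min (1 / 4) (1 / (32 * K)))).trans (min_le_right _ _)
      rw [le_div_iff₀ (by positivity)] at this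
      linarith
  set r := 4 * ρ with hr
  have hr0 : 0 < r := by positivity
  have hmem : ∀ p ∈ closedBall y₀ ρ, ∀ w : C(I, E), ‖w‖ ≤ r → ∀ t ∈ Icc (0 : ℝ) 1,
      p + primitiveIcc w t ∈ closedBall y₀ R := by
    intro p hp w hw t ht
    rw [mem_closedBall_iff_norm] at hp ⊢
    calc ‖p + primitiveIcc w t - y₀‖ = ‖(p - y₀) + primitiveIcc w t‖ := by congr 1; abel
      _ ≤ ρ + r := (norm_add_le _ _).trans
          (add_le_add hp ((norm_primitiveIcc_le w ht).trans hw))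
      _ ≤ R := by linarith
  have hcont : ∀ p ∈ closedBall y₀ ρ, ∀ w : C(I, E), ‖w‖ ≤ r →
      Continuous fun t : I => spray L (p + primitiveIcc w t) (w t) := by
    intro p hp w hw
    have h1 : Continuous fun t : I => (p + primitiveIcc w t, w t) := by
      have := continuous_primitiveIcc w
      fun_prop
    exact hL.continuousOn_spray.comp_continuous h1 fun t => ⟨hR (hmem p hp w hw t t.2), trivial⟩
  let g : ∀ p ∈ closedBall y₀ ρ, ∀ w : C(I, E), ‖w‖ ≤ r → C(I, E) := fun p hp w hw =>
    ⟨fun t : I => spray L (p + primitiveIcc w t) (w t), hcont p hp w hw⟩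
  have hgn : ∀ p (hp : p ∈ closedBall y₀ ρ) (w : C(I, E)) (hw : ‖w‖ ≤ r),
      ‖g p hp w hw‖ ≤ K * ‖w‖ ^ 2 := by
    intro p hp w hw
    refine (ContinuousMap.norm_le _ (by positivity)).2 fun t => ?_
    have hm := hmem p hp w hw t t.2
    have := hlip _ hm _ hm ‖w‖ (w t) 0 (w.norm_coe_le_norm t) (by simp)
    rw [hL.spray_zero (hR hm)] at this
    simp only [sub_zero, sub_self, norm_zero, mul_zero, add_zero] at this
    calc _ ≤ K * ‖w‖ * ‖w t‖ := this
      _ ≤ K * ‖w‖ * ‖w‖ := by gcongr; exact w.norm_coe_le_norm t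
      _ = K * ‖w‖ ^ 2 := by ring
  have hgd : ∀ p (hp : p ∈ closedBall y₀ ρ) (w : C(I, E)) (hw : ‖w‖ ≤ r)
      p' (hp' : p' ∈ closedBall y₀ ρ) (w' : C(I, E)) (hw' : ‖w'‖ ≤ r),
      ‖g p hp w hw - g p' hp' w' hw'‖ ≤ 2 * K * r * ‖w - w'‖ + K * ‖p - p'‖ := by
    intro p hp w hw p' hp' w' hw'
    refine (ContinuousMap.norm_le _ (by positivity)).2 fun t => ?_
    have hm := hmem p hp w hw t t.2
    have hm' := hmem p' hp' w' hw' t t.2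
    have h1 := hlip _ hm _ hm' r (w t) (w' t) ((w.norm_coe_le_norm t).trans hw)
      ((w'.norm_coe_le_norm t).trans hw')
    have h2 : ‖w t - w' t‖ ≤ ‖w - w'‖ := (w - w').norm_coe_le_norm t
    have h3 : ‖p + primitiveIcc w t - (p' + primitiveIcc w' t)‖ ≤ ‖p - p'‖ + ‖w - w'‖ := by
      rw [add_sub_add_comm, primitiveIcc_sub]
      exact (norm_add_le _ _).trans (by gcongr; exact norm_primitiveIcc_le _ t.2)
    have hrr : r ^ 2 ≤ r := by nlinarith
    calc _ ≤ K * r * ‖w t - w' t‖ + K * r ^ 2 *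
            ‖p + primitiveIcc w t - (p' + primitiveIcc w' t)‖ := h1
      _ ≤ K * r * ‖w - w'‖ + K * r ^ 2 * (‖p - p'‖ + ‖w - w'‖) := by gcongr
      _ = K * r * ‖w - w'‖ + K * r ^ 2 * ‖w - w'‖ + K * r ^ 2 * ‖p - p'‖ := by ring
      _ ≤ K * r * ‖w - w'‖ + K * r * ‖w - w'‖ + K * 1 * ‖p - p'‖ := by
          gcongr
          exact hrr.trans hρ1
      _ = _ := by ring
  have hdist : ∀ p ∈ closedBall y₀ ρ, ∀ q ∈ closedBall y₀ ρ, ‖q - p‖ ≤ 2 * ρ := by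
    intro p hp q hq
    rw [mem_closedBall_iff_norm] at hp hq
    calc ‖q - p‖ = ‖(q - y₀) - (p - y₀)‖ := by congr 1; abel
      _ ≤ ρ + ρ := (norm_sub_le _ _).trans (add_le_add hq hp)
      _ = 2 * ρ := by ring
  have hfix : ∀ p (hp : p ∈ closedBall y₀ ρ) q (_ : q ∈ closedBall y₀ ρ),
      ∃ (w : C(I, E)) (hw : ‖w‖ ≤ r),
        w = ContinuousMap.const I (q - p) + centeredPrimitive (g p hp w hw) := by
    intro p hp q hq
    let S := closedBall (0 : C(I, E)) r
    have hS : ∀ w : S, ‖(w : C(I, E))‖ ≤ r := fun w => mem_closedBall_zero_iff.1 w.2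
    have hconstn : ‖ContinuousMap.const I (q - p)‖ ≤ 2 * ρ :=
      (ContinuousMap.norm_le _ (by positivity)).2 fun t => hdist p hp q hq
    let f : S → S := fun w =>
      ⟨ContinuousMap.const I (q - p) + centeredPrimitive (g p hp w (hS w)), by
        rw [mem_closedBall_zero_iff]
        have h1 := norm_centeredPrimitive_le (g p hp w (hS w))
        have h2 := hgn p hp w (hS w)
        have h3 := hS w
        have h4 : K * ‖(w : C(I, E))‖ ^ 2 ≤ K * r * r := by
          rw [sq, ← mul_assoc]; gcongr
        have h5 : 8 * (K * r * r) ≤ r := by nlinarith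
        refine (norm_add_le _ _).trans ?_
        linarith⟩
    have hf : ContractingWith (1 / 2) f := by
      refine ⟨by rw [← NNReal.coe_lt_coe]; norm_num, LipschitzWith.of_dist_le_mul fun w w' => ?_⟩
      rw [Subtype.dist_eq, Subtype.dist_eq, dist_eq_norm, dist_eq_norm]
      change ‖(ContinuousMap.const I (q - p) + centeredPrimitive (g p hp w (hS w))) -
        (ContinuousMap.const I (q - p) + centeredPrimitive (g p hp w' (hS w')))‖ ≤ _
      rw [add_sub_add_left_eq_sub, centeredPrimitive_sub]
      refine (norm_centeredPrimitive_le _).trans ?_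
      have h1 := hgd p hp w (hS w) p hp w' (hS w')
      rw [sub_self, norm_zero, mul_zero, add_zero] at h1
      have h2 : 8 * K * r * ‖(w : C(I, E)) - w'‖ ≤ 1 * ‖(w : C(I, E)) - w'‖ := by gcongr
      push_cast
      linarith
    have : Nonempty S := ⟨⟨0, mem_closedBall_self hr0.le⟩⟩
    have : CompleteSpace S := isClosed_closedBall.completeSpace_coe
    have hfp : f (ContractingWith.fixedPoint f hf) = ContractingWith.fixedPoint f hf :=
      hf.fixedPoint_isFixedPt
    exact ⟨(ContractingWith.fixedPoint f hf).1, hS _, (congrArg Subtype.val hfp).symm⟩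
  choose w hw hweq using hfix
  classical
  refine ⟨ρ, hρ0, hρε, by linarith, 4 + 4 * K, fun p q =>
    if h : p ∈ closedBall y₀ ρ ∧ q ∈ closedBall y₀ ρ then w p h.1 q h.2 else 0, by positivity, ?_⟩
  intro p hp q hq
  simp only [hp, hq, and_self, dif_pos]
  set v := w p hp q hq with hv
  have hvr : ‖v‖ ≤ r := hw p hp q hq
  have hveq : v = ContinuousMap.const I (q - p) + centeredPrimitive (g p hp v hvr) :=
    hweq p hp q hq
  have hcn : ‖ContinuousMap.const I (q - p)‖ ≤ ‖q - p‖ :=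
    (ContinuousMap.norm_le _ (norm_nonneg _)).2 fun t => le_rfl
  have hJ : ‖centeredPrimitive (g p hp v hvr)‖ ≤ 2 * (K * ‖v‖ ^ 2) :=
    (norm_centeredPrimitive_le _).trans (by gcongr; exact hgn p hp v hvr)
  have hKv : 8 * (K * ‖v‖ ^ 2) ≤ ‖v‖ := by
    have h1 : 8 * K * ‖v‖ ≤ 1 := by
      calc _ ≤ 8 * K * r := by gcongr
        _ ≤ 1 := hρK
    nlinarith [norm_nonneg v]
  have hv2 : ‖v‖ ≤ 2 * ‖q - p‖ := by
    have : ‖v‖ ≤ ‖q - p‖ + 2 * (K * ‖v‖ ^ 2) := by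
      conv_lhs => rw [hveq]
      exact (norm_add_le _ _).trans (add_le_add hcn hJ)
    linarith [norm_nonneg v]
  refine ⟨hv2, fun hpq t h0 => ?_, hmem p hp v hvr, ?_, fun t ht => ?_, fun p' hp' q' hq' => ?_⟩
  · have h1 : v t = (q - p) + centeredPrimitive (g p hp v hvr) t := by
      conv_lhs => rw [hveq]
      rfl
    have h2 : ‖q - p‖ ≤ 2 * (K * ‖v‖ ^ 2) := by
      have : q - p = -centeredPrimitive (g p hp v hvr) t := by
        rw [h0] at h1
        exact eq_neg_of_add_eq_zero_left h1.symm
      rw [this, norm_neg]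
      exact (ContinuousMap.norm_coe_le_norm _ t).trans hJ
    have h3 : 0 < ‖q - p‖ := norm_pos_iff.2 (sub_ne_zero.2 hpq.symm)
    linarith
  · conv_lhs => rw [hveq]
    exact primitiveIcc_const_add_centeredPrimitive _ _
  · have ht' := Ioo_subset_Icc_self ht
    have h1 : extendIcc v =ᶠ[𝓝 t] fun s => (q - p) + (primitiveIcc (g p hp v hvr) s
        - ∫ s in (0 : ℝ)..1, primitiveIcc (g p hp v hvr) s) := by
      filter_upwards [Ioo_mem_nhds ht.1 ht.2] with s hs
      have hs' := Ioo_subset_Icc_self hs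
      rw [extendIcc_of_mem _ hs']
      conv_lhs => rw [hveq]
      rfl
    have h2 := ((hasDerivAt_primitiveIcc (g p hp v hvr) t).sub_const
      (∫ s in (0 : ℝ)..1, primitiveIcc (g p hp v hvr) s)).const_add (q - p)
    refine (h2.congr_of_eventuallyEq h1).congr_deriv ?_
    rw [extendIcc_of_mem _ ht', extendIcc_of_mem _ ht']
    rfl
  · simp only [hp', hq', and_self, dif_pos]
    set v' := w p' hp' q' hq' with hv'
    have hvr' : ‖v'‖ ≤ r := hw p' hp' q' hq'
    have hveq' : v' = ContinuousMap.const I (q' - p') + centeredPrimitive (g p' hp' v' hvr') :=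
      hweq p' hp' q' hq'
    have h1 : ‖v - v'‖ ≤ (‖p - p'‖ + ‖q - q'‖) + 2 * (2 * K * r * ‖v - v'‖ + K * ‖p - p'‖) := by
      conv_lhs => rw [hveq, hveq']
      rw [add_sub_add_comm, centeredPrimitive_sub]
      refine (norm_add_le _ _).trans (add_le_add ?_ ((norm_centeredPrimitive_le _).trans ?_))
      · refine (ContinuousMap.norm_le _ (by positivity)).2 fun t => ?_
        change ‖(q - p) - (q' - p')‖ ≤ _
        rw [sub_sub_sub_comm, add_comm]
        exact norm_sub_le _ _
      · gcongr
        exact hgd p hp v hvr p' hp' v' hvr'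
    have h2 : 8 * K * r * ‖v - v'‖ ≤ 1 * ‖v - v'‖ := by gcongr
    nlinarith [norm_nonneg (p - p'), norm_nonneg (q - q'),
      mul_nonneg hK.le (norm_nonneg (q - q'))]

end IsFinslerLagrangian

/-! ### The energy of curves in a chart -/

theorem ofReal_integral_le_lintegral {α : Type*} [MeasurableSpace α] {μ : Measure α} {f : α → ℝ}
    (hf : Integrable f μ) : ENNReal.ofReal (∫ x, f x ∂μ) ≤ ∫⁻ x, ENNReal.ofReal (f x) ∂μ := by
  rw [integral_eq_lintegral_pos_part_sub_lintegral_neg_part hf]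
  refine (ENNReal.ofReal_le_ofReal (sub_le_self _ ENNReal.toReal_nonneg)).trans ?_
  exact ENNReal.ofReal_toReal_le

/-- The Cauchy-Schwarz inequality for the integral of a norm over an interval. -/
theorem sq_integral_norm_le {E : Type*} [NormedAddCommGroup E] {a b : ℝ}
    (hab : a < b) {g : ℝ → E} (h1 : IntegrableOn g (Ioc a b))
    (h2 : IntegrableOn (fun t => ‖g t‖ ^ 2) (Ioc a b)) :
    (∫ t in Ioc a b, ‖g t‖) ^ 2 ≤ (b - a) * ∫ t in Ioc a b, ‖g t‖ ^ 2 := by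
  set S := ∫ t in Ioc a b, ‖g t‖ with hS
  set N := ∫ t in Ioc a b, ‖g t‖ ^ 2 with hN
  have hl : 0 < b - a := sub_pos.2 hab
  have h3 : 0 ≤ ∫ t in Ioc a b, (‖g t‖ - S / (b - a)) ^ 2 := integral_nonneg fun _ => sq_nonneg _
  have h4 : ∫ t in Ioc a b, (‖g t‖ - S / (b - a)) ^ 2
      = N - 2 * (S / (b - a)) * S + (b - a) * (S / (b - a)) ^ 2 := by
    have e : (fun t => (‖g t‖ - S / (b - a)) ^ 2)
        = fun t => (‖g t‖ ^ 2 - (2 * (S / (b - a))) * ‖g t‖) + (S / (b - a)) ^ 2 := by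
      funext t; ring
    have i1 : IntegrableOn (fun t => ‖g t‖) (Ioc a b) := h1.norm
    have i2 : IntegrableOn (fun t => 2 * (S / (b - a)) * ‖g t‖) (Ioc a b) := i1.const_mul _
    have i3 : IntegrableOn (fun t => ‖g t‖ ^ 2 - 2 * (S / (b - a)) * ‖g t‖) (Ioc a b) := h2.sub i2
    have i4 : IntegrableOn (fun _ : ℝ => (S / (b - a)) ^ 2) (Ioc a b) := by simp
    rw [e, integral_add i3 i4, integral_sub h2 i2, integral_const_mul, ← hS, ← hN]
    simp [hab.le]
  rw [h4] at h3
  have h5 : (b - a) * (N - 2 * (S / (b - a)) * S + (b - a) * (S / (b - a)) ^ 2)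
      = (b - a) * N - S ^ 2 := by field_simp; ring
  nlinarith [mul_nonneg hl.le h3]

section

variable {E : Type*} [NormedAddCommGroup E] [NormedSpace ℝ E] [FiniteDimensional ℝ E]

theorem integrableOn_sq_norm_deriv {u : ℝ → E} {ℓ : ℝ → ℝ} {a b c : ℝ} (hc : 0 < c)
    (hle : ∀ t ∈ Ioc a b, c * ‖deriv u t‖ ^ 2 ≤ ℓ t)
    (hfin : ∫⁻ t in Ioc a b, ENNReal.ofReal (ℓ t) ≠ ⊤) :
    IntegrableOn (fun t => ‖deriv u t‖ ^ 2) (Ioc a b) := by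
  have hm : StronglyMeasurable fun t => c * ‖deriv u t‖ ^ 2 :=
    ((stronglyMeasurable_deriv u).norm.pow 2).const_mul c
  have h1 : IntegrableOn (fun t => c * ‖deriv u t‖ ^ 2) (Ioc a b) := by
    refine ⟨hm.aestronglyMeasurable, ?_⟩
    rw [hasFiniteIntegral_iff_ofReal (Eventually.of_forall fun t => by positivity)]
    refine lt_of_le_of_lt ?_ (lt_top_iff_ne_top.2 hfin)
    refine setLIntegral_mono_ae' measurableSet_Ioc (Eventually.of_forall fun t ht => ?_)
    exact ENNReal.ofReal_le_ofReal (hle t ht)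
  have h2 := h1.const_mul c⁻¹
  refine h2.congr (Eventually.of_forall fun t => ?_)
  simp [hc.ne']

theorem integrableOn_deriv_of_sq {u : ℝ → E} {a b : ℝ}
    (h : IntegrableOn (fun t => ‖deriv u t‖ ^ 2) (Ioc a b)) :
    IntegrableOn (deriv u) (Ioc a b) := by
  have h0 : IntegrableOn (fun _ : ℝ => (1 : ℝ)) (Ioc a b) := by simp
  have h1 : IntegrableOn (fun t => 1 + ‖deriv u t‖ ^ 2) (Ioc a b) := h0.add h
  refine h1.mono' (stronglyMeasurable_deriv u).aestronglyMeasurable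
    (Eventually.of_forall fun t => ?_)
  nlinarith [sq_nonneg (‖deriv u t‖ - 1), norm_nonneg (deriv u t)]

/-- The displacement of a curve is controlled by its energy. -/
theorem sq_norm_sub_le_energy {u : ℝ → E} {ℓ : ℝ → ℝ} {a b c : ℝ} (hab : a < b) (hc : 0 < c)
    (hle : ∀ t ∈ Ioc a b, c * ‖deriv u t‖ ^ 2 ≤ ℓ t) (hu : ContinuousOn u (Icc a b)) {s : Set ℝ}
    (hs : s.Countable) (hd : ∀ t ∈ Ioo a b \ s, DifferentiableAt ℝ u t) :
    ENNReal.ofReal (c * ‖u b - u a‖ ^ 2 / (b - a)) ≤ ∫⁻ t in Ioc a b, ENNReal.ofReal (ℓ t) := by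
  by_cases hfin : ∫⁻ t in Ioc a b, ENNReal.ofReal (ℓ t) = ⊤
  · simp [hfin]
  have h2 := integrableOn_sq_norm_deriv hc hle hfin
  have h1 := integrableOn_deriv_of_sq h2
  have hftc := integral_eq_of_hasDerivAt_off_countable_of_le u (deriv u) hab.le hs hu
    (fun t ht => (hd t ht).hasDerivAt)
    ((intervalIntegrable_iff_integrableOn_Ioc_of_le hab.le).2 h1)
  rw [intervalIntegral.integral_of_le hab.le] at hftc
  have h3 : ‖u b - u a‖ ≤ ∫ t in Ioc a b, ‖deriv u t‖ := by
    rw [← hftc]; exact norm_integral_le_integral_norm _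
  have h4 := sq_integral_norm_le hab h1 h2
  have hl : 0 < b - a := sub_pos.2 hab
  calc ENNReal.ofReal (c * ‖u b - u a‖ ^ 2 / (b - a))
      ≤ ENNReal.ofReal (∫ t in Ioc a b, c * ‖deriv u t‖ ^ 2) := by
        refine ENNReal.ofReal_le_ofReal ?_
        rw [integral_const_mul, div_le_iff₀ hl, mul_assoc]
        have := pow_le_pow_left₀ (norm_nonneg _) h3 2
        gcongr
        linarith
    _ ≤ ∫⁻ t in Ioc a b, ENNReal.ofReal (c * ‖deriv u t‖ ^ 2) :=
        ofReal_integral_le_lintegral (h2.const_mul c)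
    _ ≤ _ := setLIntegral_mono_ae' measurableSet_Ioc
        (Eventually.of_forall fun t ht => ENNReal.ofReal_le_ofReal (hle t ht))

namespace IsFinslerLagrangian

variable {U : Set E} {L : E → E → ℝ} (hL : IsFinslerLagrangian U L)

include hL

theorem continuousOn_lagrangian : ContinuousOn (fun z : E × E => L z.1 z.2) (U ×ˢ univ) := by
  rintro ⟨y, w⟩ ⟨hy, -⟩
  refine ContinuousAt.continuousWithinAt ?_
  by_cases hw : w = 0
  · subst hw
    obtain ⟨R, hR, hsub⟩ := Metric.nhds_basis_closedBall.mem_iff.1 (hL.isOpen.mem_nhds hy)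
    obtain ⟨c, hc, C, hC, hb⟩ := hL.exists_bounds hsub
    have h1 : ∀ᶠ z : E × E in 𝓝 (y, 0), z.1 ∈ closedBall y R :=
      continuous_fst.continuousAt.eventually (closedBall_mem_nhds y hR)
    rw [ContinuousAt, hL.apply_zero hy]
    refine squeeze_zero' (h1.mono fun z hz => hL.nonneg _ (hsub hz))
      (h1.mono fun z hz => (hb z.1 hz z.2).2) ?_
    have : ContinuousAt (fun z : E × E => C * ‖z.2‖ ^ 2) (y, 0) := by fun_prop
    simpa [ContinuousAt] using this
  · exact (hL.contDiffAt hy hw).continuousAt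

/-- Conservation of energy. -/
theorem hasDerivAt_energy {u v : ℝ → E} {t : ℝ} (hu : HasDerivAt u (v t) t)
    (hv : HasDerivAt v (spray L (u t) (v t)) t) (hy : u t ∈ U) (hw : v t ≠ 0) :
    HasDerivAt (fun s => L (u s) (v s)) 0 t := by
  have h1 := hL.hasDerivAt_lagrangian hu hv hy hw
  have h2 := (hL.hasDerivAt_momentum hu hv hy hw)
  rw [hL.velHess_spray hy hw, add_sub_cancel] at h2
  have h3 := h2.clm_apply hv
  have h4 : (fun s => velDeriv L (u s) (v s) (v s)) =ᶠ[𝓝 t] fun s => 2 * L (u s) (v s) := by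
    filter_upwards [hu.continuousAt.eventually (hL.isOpen.mem_nhds hy),
      hv.continuousAt.eventually_ne hw] with s hs1 hs2
    exact hL.velDeriv_self hs1 hs2
  have h5 := (h3.congr_of_eventuallyEq h4.symm).unique (h1.const_mul 2)
  refine h1.congr_deriv ?_
  linarith

theorem hasDerivAt_momentum_of_spray {u v : ℝ → E} {t : ℝ} (hu : HasDerivAt u (v t) t)
    (hv : HasDerivAt v (spray L (u t) (v t)) t) (hy : u t ∈ U) (hw : v t ≠ 0) :
    HasDerivAt (fun s => velDeriv L (u s) (v s)) (posDeriv L (u t) (v t)) t := by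
  have h2 := (hL.hasDerivAt_momentum hu hv hy hw)
  rwa [hL.velHess_spray hy hw, add_sub_cancel] at h2

theorem energy_eq {γ v : ℝ → E} {a b : ℝ} (hγ : ContinuousOn γ (Icc a b))
    (hv : ContinuousOn v (Icc a b)) (hU : ∀ t ∈ Icc a b, γ t ∈ U)
    (hγd : ∀ t ∈ Ioo a b, HasDerivAt γ (v t) t)
    (hvd : ∀ t ∈ Ioo a b, HasDerivAt v (spray L (γ t) (v t)) t)
    (hne : (∀ t, v t ≠ 0) ∨ ∀ t, v t = 0) :
    ∀ t ∈ Icc a b, L (γ t) (v t) = L (γ a) (v a) := by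
  intro t ht
  rcases hne with hne | h0
  · have hcont : ContinuousOn (fun t => L (γ t) (v t)) (Icc a b) :=
      hL.continuousOn_lagrangian.comp (hγ.prodMk hv) fun t ht => ⟨hU t ht, trivial⟩
    have := integral_eq_of_hasDerivAt_off_countable_of_le (fun t => L (γ t) (v t)) (fun _ => 0) ht.1
      countable_empty (hcont.mono (Icc_subset_Icc_right ht.2)) (fun s hs => by
        have hs' : s ∈ Ioo a b := ⟨hs.1.1, hs.1.2.trans_le ht.2⟩
        exact hL.hasDerivAt_energy (hγd s hs') (hvd s hs') (hU s (Ioo_subset_Icc_self hs')) (hne s))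
      (by simp)
    simp only [intervalIntegral.integral_zero] at this
    linarith
  · have ha : a ∈ Icc a b := left_mem_Icc.2 (ht.1.trans ht.2)
    rw [h0, h0, hL.apply_zero (hU t ht), hL.apply_zero (hU a ha)]

/-- Short solutions of the Euler-Lagrange equation minimize the energy. -/
theorem exists_comparison {y₀ : E} {R : ℝ} (hR : closedBall y₀ R ⊆ U) :
    ∃ κ > 0, ∃ μ > 0, ∀ (a b : ℝ) (γ v u : ℝ → E) (s : Set ℝ), a < b →
      ContinuousOn γ (Icc a b) → ContinuousOn v (Icc a b) →
      (∀ t ∈ Icc a b, γ t ∈ closedBall y₀ R) →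
      (∀ t ∈ Ioo a b, HasDerivAt γ (v t) t) →
      (∀ t ∈ Ioo a b, HasDerivAt v (spray L (γ t) (v t)) t) →
      ((∀ t, v t ≠ 0) ∨ ∀ t, v t = 0) →
      (∀ t ∈ Icc a b, (b - a) * ‖v t‖ ≤ μ) →
      ContinuousOn u (Icc a b) → (∀ t ∈ Icc a b, u t ∈ closedBall y₀ R) → s.Countable →
      (∀ t ∈ Ioo a b \ s, DifferentiableAt ℝ u t) → u a = γ a → u b = γ b →
      ∀ t ∈ Icc a b, ENNReal.ofReal ((b - a) * L (γ a) (v a) + κ * ‖u t - γ t‖ ^ 2 / (b - a)) ≤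
        ∫⁻ t in Ioc a b, ENNReal.ofReal (L (u t) (deriv u t)) := by
  obtain ⟨c, hc, C, hC, hrem⟩ := hL.exists_remainder hR
  obtain ⟨c', hc', C', hC', hb⟩ := hL.exists_bounds hR
  obtain ⟨μ, hμ, hμ1, hμC⟩ : ∃ μ > 0, μ ≤ 1 ∧ 4 * C * μ ≤ c :=
    ⟨min 1 (c / (4 * C)), by positivity, min_le_left _ _, by
      have := min_le_right 1 (c / (4 * C))
      rw [le_div_iff₀ (by positivity)] at this
      linarith⟩
  refine ⟨c / 2, by positivity, μ, hμ, ?_⟩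
  intro a b γ v u s hab hγ hv hγR hγd hvd hne hvμ hu huR hs hd ha hb' t₀ ht₀
  by_cases hfin : ∫⁻ t in Ioc a b, ENNReal.ofReal (L (u t) (deriv u t)) = ⊤
  · simp [hfin]
  have hl : 0 < b - a := sub_pos.2 hab
  have hsq := integrableOn_sq_norm_deriv (ℓ := fun t => L (u t) (deriv u t)) hc'
    (fun t ht => (hb (u t) (huR t (Ioc_subset_Icc_self ht)) (deriv u t)).1) hfin
  have hint := integrableOn_deriv_of_sq hsq
  have hvint : IntegrableOn v (Ioc a b) := hv.integrableOn_Icc.mono_set Ioc_subset_Icc_self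
  set η : ℝ → E := fun t => u t - γ t with hη
  set η' : ℝ → E := fun t => deriv u t - v t with hη'
  have hηc : ContinuousOn η (Icc a b) := hu.sub hγ
  have hη'int : IntegrableOn η' (Ioc a b) := hint.sub hvint
  have hη'sq : IntegrableOn (fun t => ‖η' t‖ ^ 2) (Ioc a b) := by
    have h1 : IntegrableOn (fun t => ‖v t‖ ^ 2) (Ioc a b) :=
      (hv.norm.pow 2).integrableOn_Icc.mono_set Ioc_subset_Icc_self
    refine ((hsq.add h1).const_mul 2).mono' (hη'int.aestronglyMeasurable.norm.pow 2)
      (Eventually.of_forall fun t => ?_)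
    have := norm_sub_le (deriv u t) (v t)
    simp only [Pi.add_apply, norm_pow, norm_norm, hη']
    have h3 := pow_le_pow_left₀ (norm_nonneg _) this 2
    nlinarith [sq_nonneg (‖deriv u t‖ - ‖v t‖)]
  have hηd : ∀ t ∈ Ioo a b \ s, HasDerivAt η (η' t) t := fun t ht =>
    (hd t ht).hasDerivAt.sub (hγd t ht.1)
  set S := ∫ t in Ioc a b, ‖η' t‖ with hS
  set N := ∫ t in Ioc a b, ‖η' t‖ ^ 2 with hN
  have hS0 : 0 ≤ S := integral_nonneg fun _ => norm_nonneg _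
  have hSN : S ^ 2 ≤ (b - a) * N := sq_integral_norm_le hab hη'int hη'sq
  have hηS : ∀ t ∈ Icc a b, ‖η t‖ ≤ S := by
    intro t ht
    have hsub : Ioc a t ⊆ Ioc a b := Ioc_subset_Ioc_right ht.2
    have hftc := integral_eq_of_hasDerivAt_off_countable_of_le η η' ht.1 hs
      (hηc.mono (Icc_subset_Icc_right ht.2))
      (fun x hx => hηd x ⟨⟨hx.1.1, hx.1.2.trans_le ht.2⟩, hx.2⟩)
      ((intervalIntegrable_iff_integrableOn_Ioc_of_le ht.1).2 (hη'int.mono_set hsub))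
    have h0 : η a = 0 := by simp [hη, ha]
    rw [h0, sub_zero, intervalIntegral.integral_of_le ht.1] at hftc
    rw [← hftc]
    refine (norm_integral_le_integral_norm _).trans ?_
    exact setIntegral_mono_set hη'int.norm (Eventually.of_forall fun _ => norm_nonneg _)
      hsub.eventuallyLE
  have hP : ContinuousOn (fun t => velDeriv L (γ t) (v t)) (Icc a b) ∧
      ContinuousOn (fun t => posDeriv L (γ t) (v t)) (Icc a b) ∧
      ∀ t ∈ Ioo a b, HasDerivAt (fun t => velDeriv L (γ t) (v t)) (posDeriv L (γ t) (v t)) t := by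
    rcases hne with hne | h0
    · have hmaps : ∀ t ∈ Icc a b, (γ t, v t) ∈ U ×ˢ ({0}ᶜ : Set E) := fun t ht =>
        ⟨hR (hγR t ht), hne t⟩
      refine ⟨hL.contDiffOn_velDeriv.continuousOn.comp (hγ.prodMk hv) hmaps,
        hL.contDiffOn_posDeriv.continuousOn.comp (hγ.prodMk hv) hmaps, fun t ht => ?_⟩
      exact hL.hasDerivAt_momentum_of_spray (hγd t ht) (hvd t ht)
        (hR (hγR t (Ioo_subset_Icc_self ht))) (hne t)
    · have e1 : ∀ t ∈ Icc a b, velDeriv L (γ t) (v t) = 0 := fun t ht => by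
        rw [h0, hL.velDeriv_zero (hR (hγR t ht))]
      have e2 : ∀ t ∈ Icc a b, posDeriv L (γ t) (v t) = 0 := fun t ht => by
        rw [h0, hL.posDeriv_zero (hR (hγR t ht))]
      refine ⟨continuousOn_const.congr e1, continuousOn_const.congr e2, fun t ht => ?_⟩
      rw [e2 t (Ioo_subset_Icc_self ht)]
      refine (hasDerivAt_const t (0 : E →L[ℝ] ℝ)).congr_of_eventuallyEq ?_
      filter_upwards [Ioo_mem_nhds ht.1 ht.2] with x hx using e1 x (Ioo_subset_Icc_self hx)
  obtain ⟨hPc, hQc, hPd⟩ := hP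
  have hlin_int : IntegrableOn (fun t => posDeriv L (γ t) (v t) (η t) +
      velDeriv L (γ t) (v t) (η' t)) (Ioc a b) := by
    refine Integrable.add ((hQc.clm_apply hηc).integrableOn_Icc.mono_set Ioc_subset_Icc_self) ?_
    obtain ⟨B, hB⟩ := isCompact_Icc.exists_bound_of_continuousOn hPc
    refine Integrable.mono' (hη'int.norm.const_mul B) ?_ ?_
    · have h1 : AEStronglyMeasurable (fun t => velDeriv L (γ t) (v t))
          (volume.restrict (Ioc a b)) :=
        (hPc.mono Ioc_subset_Icc_self).aestronglyMeasurable measurableSet_Ioc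
      exact isBoundedBilinearMap_apply.continuous.comp_aestronglyMeasurable
        (h1.prodMk hη'int.aestronglyMeasurable)
    · refine (ae_restrict_iff' measurableSet_Ioc).2 (Eventually.of_forall fun t ht => ?_)
      refine (ContinuousLinearMap.le_opNorm _ _).trans ?_
      gcongr
      exact hB t (Ioc_subset_Icc_self ht)
  have hlin : ∫ t in Ioc a b, (posDeriv L (γ t) (v t) (η t) + velDeriv L (γ t) (v t) (η' t))
      = 0 := by
    have := integral_eq_of_hasDerivAt_off_countable_of_le
      (fun t => velDeriv L (γ t) (v t) (η t))
      (fun t => posDeriv L (γ t) (v t) (η t) + velDeriv L (γ t) (v t) (η' t)) hab.le hs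
      (hPc.clm_apply hηc) (fun t ht => (hPd t ht.1).clm_apply (hηd t ht))
      ((intervalIntegrable_iff_integrableOn_Ioc_of_le hab.le).2 hlin_int)
    rw [intervalIntegral.integral_of_le hab.le] at this
    rw [this]
    simp [hη, ha, hb']
  set m := μ / (b - a) with hm
  have hm0 : 0 < m := by positivity
  have hvm : ∀ t ∈ Icc a b, ‖v t‖ ≤ m := fun t ht => by
    rw [hm, le_div_iff₀ hl, mul_comm]; exact hvμ t ht
  have henergy := hL.energy_eq hγ hv (fun t ht => hR (hγR t ht)) hγd hvd hne
  set A := L (γ a) (v a) with hA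
  have hptw : ∀ t ∈ Ioc a b, (A - C * m ^ 2 * S ^ 2) +
      (posDeriv L (γ t) (v t) (η t) + velDeriv L (γ t) (v t) (η' t)) + c * ‖η' t‖ ^ 2
      - C * m * S * ‖η' t‖ ≤ L (u t) (deriv u t) := by
    intro t ht
    have ht' := Ioc_subset_Icc_self ht
    have h1 := hrem (γ t) (hγR t ht') (u t) (huR t ht') (v t) (deriv u t)
    rw [henergy t ht'] at h1
    have h2 : C * ‖v t‖ ^ 2 * ‖u t - γ t‖ ^ 2 ≤ C * m ^ 2 * S ^ 2 := by
      gcongr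
      · exact hvm t ht'
      · exact hηS t ht'
    have h3 : C * ‖v t‖ * ‖u t - γ t‖ * ‖deriv u t - v t‖ ≤ C * m * S * ‖deriv u t - v t‖ := by
      gcongr
      · exact hvm t ht'
      · exact hηS t ht'
    simp only [hη, hη']
    linarith
  have hconst : IntegrableOn (fun _ : ℝ => A - C * m ^ 2 * S ^ 2) (Ioc a b) := by simp
  have hIntAll : IntegrableOn (fun t => (A - C * m ^ 2 * S ^ 2) +
      (posDeriv L (γ t) (v t) (η t) + velDeriv L (γ t) (v t) (η' t)) + c * ‖η' t‖ ^ 2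
      - C * m * S * ‖η' t‖) (Ioc a b) :=
    (((hconst.add hlin_int).add (hη'sq.const_mul c)).sub (hη'int.norm.const_mul (C * m * S)))
  have hval : ∫ t in Ioc a b, ((A - C * m ^ 2 * S ^ 2) +
      (posDeriv L (γ t) (v t) (η t) + velDeriv L (γ t) (v t) (η' t)) + c * ‖η' t‖ ^ 2
      - C * m * S * ‖η' t‖) = (b - a) * (A - C * m ^ 2 * S ^ 2) + c * N - C * m * S * S := by
    have i1 : IntegrableOn (fun t => (A - C * m ^ 2 * S ^ 2) + (posDeriv L (γ t) (v t) (η t) +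
      velDeriv L (γ t) (v t) (η' t))) (Ioc a b) := hconst.add hlin_int
    have i2 : IntegrableOn (fun t => c * ‖η' t‖ ^ 2) (Ioc a b) := hη'sq.const_mul c
    have i3 : IntegrableOn (fun t => (A - C * m ^ 2 * S ^ 2) + (posDeriv L (γ t) (v t) (η t) +
      velDeriv L (γ t) (v t) (η' t)) + c * ‖η' t‖ ^ 2) (Ioc a b) := i1.add i2
    have i4 : IntegrableOn (fun t => C * m * S * ‖η' t‖) (Ioc a b) := hη'int.norm.const_mul _
    rw [integral_sub i3 i4, integral_add i1 i2, integral_add hconst hlin_int, hlin,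
      integral_const_mul, integral_const_mul, ← hS, ← hN]
    simp [hab.le]
  have hN0 : 0 ≤ N := integral_nonneg fun _ => sq_nonneg _
  have hfinal : (b - a) * A + c / 2 * ‖u t₀ - γ t₀‖ ^ 2 / (b - a) ≤
      (b - a) * (A - C * m ^ 2 * S ^ 2) + c * N - C * m * S * S := by
    have e1 : (b - a) * (C * m ^ 2 * S ^ 2) ≤ C * μ * N := by
      have : (b - a) * (C * m ^ 2 * S ^ 2) = C * μ ^ 2 * (S ^ 2 / (b - a)) := by
        rw [hm]; field_simp
      rw [this]
      have h1 : S ^ 2 / (b - a) ≤ N := by rw [div_le_iff₀ hl]; linarith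
      have h2 : μ ^ 2 ≤ μ := by nlinarith
      gcongr
    have e2 : C * m * S * S ≤ C * μ * N := by
      have : C * m * S * S = C * μ * (S ^ 2 / (b - a)) := by rw [hm]; field_simp
      rw [this]
      have h1 : S ^ 2 / (b - a) ≤ N := by rw [div_le_iff₀ hl]; linarith
      gcongr
    have e3 : c / 2 * ‖u t₀ - γ t₀‖ ^ 2 / (b - a) ≤ c / 2 * N := by
      rw [div_le_iff₀ hl, mul_assoc]
      have := pow_le_pow_left₀ (norm_nonneg _) (hηS t₀ ht₀) 2
      gcongr
      exact this.trans (by linarith)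
    have e4 : 4 * C * μ * N ≤ c * N := by gcongr
    nlinarith
  calc ENNReal.ofReal ((b - a) * A + c / 2 * ‖u t₀ - γ t₀‖ ^ 2 / (b - a))
      ≤ ENNReal.ofReal (∫ t in Ioc a b, ((A - C * m ^ 2 * S ^ 2) +
      (posDeriv L (γ t) (v t) (η t) + velDeriv L (γ t) (v t) (η' t)) + c * ‖η' t‖ ^ 2
      - C * m * S * ‖η' t‖)) := ENNReal.ofReal_le_ofReal (hfinal.trans_eq hval.symm)
    _ ≤ _ := ofReal_integral_le_lintegral hIntAll
    _ ≤ _ := setLIntegral_mono_ae' measurableSet_Ioc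
        (Eventually.of_forall fun t ht => ENNReal.ofReal_le_ofReal (hptw t ht))

end IsFinslerLagrangian

end

/-- The family `γ p q`, with velocities `v p q`, consists of the short solutions over `[a, b]` of
the Euler-Lagrange equation of `L` that join `p` to `q`, for `p, q` in the ball of radius `ρ`
around `y₀`. They minimize the energy among the curves in the ball of radius `R`. -/
structure IsShortGeodesicFamily {E : Type*} [NormedAddCommGroup E] [NormedSpace ℝ E]
    (L : E → E → ℝ) (y₀ : E) (R ρ κ C a b : ℝ) (γ v : E → E → ℝ → E) (p q : E) : Prop where
  continuous : Continuous (γ p q)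
  left : γ p q a = p
  right : γ p q b = q
  mem : ∀ t ∈ Icc a b, γ p q t ∈ closedBall y₀ R
  hasDerivAt : ∀ t ∈ Ioo a b, HasDerivAt (γ p q) (v p q t) t
  hasDerivAt_vel : ∀ t ∈ Ioo a b, HasDerivAt (v p q) (spray L (γ p q t) (v p q t)) t
  ne_or_eq : (∀ t, v p q t ≠ 0) ∨ ∀ t, v p q t = 0
  energy : ∀ t ∈ Icc a b, L (γ p q t) (v p q t) = L p (v p q a)
  comparison : ∀ (u : ℝ → E) (s : Set ℝ), ContinuousOn u (Icc a b) →
    (∀ t ∈ Icc a b, u t ∈ closedBall y₀ R) → s.Countable →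
    (∀ t ∈ Ioo a b \ s, DifferentiableAt ℝ u t) → u a = p → u b = q → ∀ t ∈ Icc a b,
    ENNReal.ofReal ((b - a) * L p (v p q a) + κ * ‖u t - γ p q t‖ ^ 2 / (b - a)) ≤
      ∫⁻ t in Ioc a b, ENNReal.ofReal (L (u t) (deriv u t))
  dist_le : ∀ p' ∈ closedBall y₀ ρ, ∀ q' ∈ closedBall y₀ ρ, ∀ t ∈ Icc a b,
    ‖γ p q t - γ p' q' t‖ ≤ C * (‖p - p'‖ + ‖q - q'‖)
  dist_vel_le : ∀ p' ∈ closedBall y₀ ρ, ∀ q' ∈ closedBall y₀ ρ, ∀ t ∈ Icc a b,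
    ‖v p q t - v p' q' t‖ ≤ (b - a)⁻¹ * (C * (‖p - p'‖ + ‖q - q'‖))

namespace IsFinslerLagrangian

variable {E : Type*} [NormedAddCommGroup E] [NormedSpace ℝ E] [FiniteDimensional ℝ E]
  {U : Set E} {L : E → E → ℝ} (hL : IsFinslerLagrangian U L)

include hL

theorem exists_short_geodesics {y₀ : E} (hy₀ : y₀ ∈ U) {ε : ℝ} (hε : 0 < ε) :
    ∃ R > 0, R ≤ ε ∧ closedBall y₀ R ⊆ U ∧ ∃ ρ > 0, ρ ≤ R ∧ ∃ κ > 0, ∃ C > 0, ∀ a b : ℝ, a < b →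
      ∃ γ v : E → E → ℝ → E, ∀ p ∈ closedBall y₀ ρ, ∀ q ∈ closedBall y₀ ρ,
        IsShortGeodesicFamily L y₀ R ρ κ C a b γ v p q := by
  obtain ⟨R₁, hR₁, hsub₁⟩ := Metric.nhds_basis_closedBall.mem_iff.1 (hL.isOpen.mem_nhds hy₀)
  have hR0 : 0 < min R₁ ε := lt_min hR₁ hε
  have hR : closedBall y₀ (min R₁ ε) ⊆ U := (closedBall_subset_closedBall (min_le_left _ _)).trans
    hsub₁
  refine ⟨min R₁ ε, hR0, min_le_right _ _, hR, ?_⟩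
  set R := min R₁ ε
  obtain ⟨κ, hκ, μ, hμ, hcomp⟩ := hL.exists_comparison hR
  obtain ⟨ρ, hρ, hρμ, hρR, C, w, hC, hw⟩ := hL.exists_boundary_value hR0 hR
    (show 0 < μ / 4 by positivity)
  refine ⟨ρ, hρ, hρR, κ, hκ, C + 1, by positivity, fun a b hab => ?_⟩
  have hl : 0 < b - a := sub_pos.2 hab
  set τ : ℝ → ℝ := fun t => (t - a) / (b - a) with hτ
  have hτd : ∀ t, HasDerivAt τ (b - a)⁻¹ t := fun t => by
    simpa [hτ, div_eq_mul_inv] using ((hasDerivAt_id t).sub_const a).mul_const (b - a)⁻¹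
  have hτc : Continuous τ := by fun_prop
  have hτmem : ∀ t ∈ Icc a b, τ t ∈ Icc (0 : ℝ) 1 := fun t ht =>
    ⟨div_nonneg (sub_nonneg.2 ht.1) hl.le, (div_le_one hl).2 (by linarith [ht.2])⟩
  have hτmem' : ∀ t ∈ Ioo a b, τ t ∈ Ioo (0 : ℝ) 1 := fun t ht =>
    ⟨div_pos (sub_pos.2 ht.1) hl, (div_lt_one hl).2 (by linarith [ht.2])⟩
  have hτa : τ a = 0 := by simp [hτ]
  have hτb : τ b = 1 := by simp [hτ, hl.ne']
  refine ⟨fun p q t => p + primitiveIcc (w p q) (τ t),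
    fun p q t => (b - a)⁻¹ • extendIcc (w p q) (τ t), fun p hp q hq => ?_⟩
  obtain ⟨h1, h2, h3, h4, h5, h6⟩ := hw p hp q hq
  have hcγ : Continuous fun t => p + primitiveIcc (w p q) (τ t) := by
    have := continuous_primitiveIcc (w p q)
    fun_prop
  have hcv : Continuous fun t => (b - a)⁻¹ • extendIcc (w p q) (τ t) := by
    have := continuous_extendIcc (w p q)
    fun_prop
  have hmem : ∀ t ∈ Icc a b, p + primitiveIcc (w p q) (τ t) ∈ closedBall y₀ R := fun t ht =>
    h3 _ (hτmem t ht)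
  have hγd : ∀ t, HasDerivAt (fun t => p + primitiveIcc (w p q) (τ t))
      ((b - a)⁻¹ • extendIcc (w p q) (τ t)) t := fun t =>
    ((hasDerivAt_primitiveIcc (w p q) (τ t)).scomp t (hτd t)).const_add p
  have hvd : ∀ t ∈ Ioo a b, HasDerivAt (fun t => (b - a)⁻¹ • extendIcc (w p q) (τ t))
      (spray L (p + primitiveIcc (w p q) (τ t)) ((b - a)⁻¹ • extendIcc (w p q) (τ t))) t := by
    intro t ht
    have := ((h5 (τ t) (hτmem' t ht)).scomp t (hτd t)).const_smul (b - a)⁻¹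
    refine this.congr_deriv ?_
    rw [hL.spray_smul (hR (hmem t (Ioo_subset_Icc_self ht))) (inv_pos.2 hl), smul_smul, sq]
  have hne : (∀ t, (b - a)⁻¹ • extendIcc (w p q) (τ t) ≠ 0) ∨
      ∀ t, (b - a)⁻¹ • extendIcc (w p q) (τ t) = 0 := by
    by_cases hpq : p = q
    · refine Or.inr fun t => ?_
      have : w p q = 0 := by
        rw [hpq, sub_self, norm_zero, mul_zero] at h1
        rw [hpq]
        exact norm_le_zero_iff.1 h1
      simp [this, extendIcc, IccExtend]
    · exact Or.inl fun t => smul_ne_zero (inv_ne_zero hl.ne') (h2 hpq _)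
  have hleft : p + primitiveIcc (w p q) (τ a) = p := by simp [hτa, primitiveIcc]
  have hright : p + primitiveIcc (w p q) (τ b) = q := by rw [hτb, h4]; abel
  have hen := hL.energy_eq hcγ.continuousOn hcv.continuousOn (fun t ht => hR (hmem t ht))
    (fun t _ => hγd t) hvd hne
  rw [hleft] at hen
  have hμ' : ∀ t ∈ Icc a b, (b - a) * ‖(b - a)⁻¹ • extendIcc (w p q) (τ t)‖ ≤ μ := by
    intro t ht
    rw [norm_smul, norm_inv, Real.norm_of_nonneg hl.le, mul_inv_cancel_left₀ hl.ne']
    refine (norm_extendIcc_le _ _).trans (h1.trans ?_)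
    have : ‖q - p‖ ≤ ρ + ρ := by
      rw [mem_closedBall_iff_norm] at hp hq
      calc ‖q - p‖ = ‖(q - y₀) - (p - y₀)‖ := by congr 1; abel
        _ ≤ ρ + ρ := (norm_sub_le _ _).trans (add_le_add hq hp)
    linarith
  exact {
    continuous := hcγ
    left := hleft
    right := hright
    mem := hmem
    hasDerivAt := fun t _ => hγd t
    hasDerivAt_vel := hvd
    ne_or_eq := hne
    energy := hen
    comparison := by
      intro u s hu huR hs hd ha hb t ht
      have := hcomp a b _ _ u s hab hcγ.continuousOn hcv.continuousOn hmem (fun t _ => hγd t) hvd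
        hne hμ' hu huR hs hd (ha.trans hleft.symm) (hb.trans hright.symm) t ht
      rwa [hleft] at this
    dist_le := by
      intro p' hp' q' hq' t ht
      rw [add_sub_add_comm, primitiveIcc_sub]
      refine (norm_add_le _ _).trans ?_
      have h7 := (norm_primitiveIcc_le (w p q - w p' q') (hτmem t ht)).trans (h6 p' hp' q' hq')
      nlinarith [norm_nonneg (q - q')]
    dist_vel_le := by
      intro p' hp' q' hq' t ht
      rw [← smul_sub, norm_smul, norm_inv, Real.norm_of_nonneg hl.le]
      refine mul_le_mul_of_nonneg_left ?_ (inv_pos.2 hl).le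
      have h7 := (norm_extendIcc_sub_le (w p q) (w p' q') (τ t)).trans (h6 p' hp' q' hq')
      nlinarith [norm_nonneg (q - q'), norm_nonneg (p - p')] }

/-- Solutions of the initial value problem near a given one exist over a uniform time. -/
theorem exists_initial_value_nhds {y₀ w₀ : E} (hy : y₀ ∈ U) (hw : w₀ ≠ 0) :
    ∃ δ > 0, ∀ᶠ z : E × E in 𝓝 (y₀, w₀), ∃ u v : ℝ → E, u 0 = z.1 ∧ v 0 = z.2 ∧
      ∀ t ∈ Ioo (-δ) δ, HasDerivAt u (v t) t ∧ HasDerivAt v (spray L (u t) (v t)) t ∧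
        u t ∈ U ∧ v t ≠ 0 := by
  have hX : ContDiffAt ℝ 1 (fun z : E × E => (z.2, spray L z.1 z.2)) (y₀, w₀) :=
    contDiffAt_snd.prodMk ((hL.contDiffOn_spray.contDiffAt
      (hL.isOpen_prod.mem_nhds (mk_mem_prod hy hw))).of_le (by simp))
  obtain ⟨ε, hε, a, r, M, K, hr, hpl⟩ := IsPicardLindelof.of_contDiffAt_one hX
  obtain ⟨α, hα, hαc⟩ :=
    (hpl 0).exists_forall_mem_closedBall_eq_hasDerivWithinAt_continuousOn
  have hα0 : α ((y₀, w₀), 0) = (y₀, w₀) := (hα (y₀, w₀) (mem_closedBall_self r.2)).1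
  have hcat : ContinuousAt α ((y₀, w₀), 0) := by
    refine hαc.continuousAt (prod_mem_nhds (closedBall_mem_nhds _ hr) (Icc_mem_nhds ?_ ?_)) <;>
    simp [hε]
  have hev : ∀ᶠ x : (E × E) × ℝ in 𝓝 ((y₀, w₀), 0), α x ∈ U ×ˢ ({0}ᶜ : Set E) := by
    refine hcat.eventually ?_
    rw [hα0]
    exact hL.isOpen_prod.mem_nhds (mk_mem_prod hy hw)
  rw [nhds_prod_eq, eventually_prod_iff] at hev
  obtain ⟨pa, hpa, pb, hpb, hpab⟩ := hev
  obtain ⟨δ₀, hδ₀, hδsub⟩ := Metric.mem_nhds_iff.1 hpb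
  refine ⟨min δ₀ ε, lt_min hδ₀ hε, ?_⟩
  filter_upwards [hpa, closedBall_mem_nhds (y₀, w₀) hr] with z hz hzr
  obtain ⟨h0, hd⟩ := hα z hzr
  refine ⟨fun t => (α (z, t)).1, fun t => (α (z, t)).2, congrArg Prod.fst h0, congrArg Prod.snd h0,
    fun t ht => ?_⟩
  have ht1 : pb t := hδsub (by
    rw [mem_ball, Real.dist_eq, sub_zero, abs_lt]
    exact ⟨by linarith [ht.1, min_le_left δ₀ ε], ht.2.trans_le (min_le_left _ _)⟩)
  have ht2 : t ∈ Ioo (0 - ε) (0 + ε) :=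
    ⟨by linarith [ht.1, min_le_right δ₀ ε], by linarith [ht.2, min_le_right δ₀ ε]⟩
  have hm := hpab hz ht1
  have hdt := (hd t (Ioo_subset_Icc_self ht2)).hasDerivAt (Icc_mem_nhds ht2.1 ht2.2)
  exact ⟨(ContinuousLinearMap.fst ℝ E E).hasFDerivAt.comp_hasDerivAt t hdt,
    (ContinuousLinearMap.snd ℝ E E).hasFDerivAt.comp_hasDerivAt t hdt, hm.1, hm.2⟩

/-- Solutions of the initial value problem exist for a uniform time over compact sets. -/
theorem exists_initial_value {K : Set (E × E)} (hK : IsCompact K) (hsub : K ⊆ U ×ˢ {0}ᶜ) :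
    ∃ δ > 0, ∀ z ∈ K, ∃ u v : ℝ → E, u 0 = z.1 ∧ v 0 = z.2 ∧
      ∀ t ∈ Ioo (-δ) δ, HasDerivAt u (v t) t ∧ HasDerivAt v (spray L (u t) (v t)) t ∧
        u t ∈ U ∧ v t ≠ 0 := by
  refine hK.induction_on (p := fun K => ∃ δ > 0, ∀ z ∈ K, ∃ u v : ℝ → E, u 0 = z.1 ∧ v 0 = z.2 ∧
      ∀ t ∈ Ioo (-δ) δ, HasDerivAt u (v t) t ∧ HasDerivAt v (spray L (u t) (v t)) t ∧
        u t ∈ U ∧ v t ≠ 0) ⟨1, one_pos, by simp⟩ ?_ ?_ ?_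
  · rintro s t hst ⟨δ, hδ, h⟩
    exact ⟨δ, hδ, fun z hz => h z (hst hz)⟩
  · rintro s t ⟨δ, hδ, h⟩ ⟨δ', hδ', h'⟩
    refine ⟨min δ δ', lt_min hδ hδ', fun z hz => ?_⟩
    rcases hz with hz | hz
    · obtain ⟨u, v, h0, h1, h2⟩ := h z hz
      exact ⟨u, v, h0, h1, fun t ht => h2 t
        ⟨by linarith [ht.1, min_le_left δ δ'], ht.2.trans_le (min_le_left _ _)⟩⟩
    · obtain ⟨u, v, h0, h1, h2⟩ := h' z hz
      exact ⟨u, v, h0, h1, fun t ht => h2 t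
        ⟨by linarith [ht.1, min_le_right δ δ'], ht.2.trans_le (min_le_right _ _)⟩⟩
  · rintro ⟨y, w⟩ hz
    obtain ⟨δ, hδ, h⟩ := hL.exists_initial_value_nhds (hsub hz).1 (hsub hz).2
    exact ⟨_, mem_nhdsWithin_of_mem_nhds h, δ, hδ, fun z hz => hz⟩

/-- Local uniqueness for the initial value problem. -/
theorem eventually_eq_of_initial {u₁ v₁ u₂ v₂ : ℝ → E} {t₀ : ℝ}
    (h₁ : ∀ᶠ t in 𝓝 t₀, HasDerivAt u₁ (v₁ t) t ∧ HasDerivAt v₁ (spray L (u₁ t) (v₁ t)) t)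
    (h₂ : ∀ᶠ t in 𝓝 t₀, HasDerivAt u₂ (v₂ t) t ∧ HasDerivAt v₂ (spray L (u₂ t) (v₂ t)) t)
    (hU : u₁ t₀ ∈ U) (hne : v₁ t₀ ≠ 0) (hu : u₁ t₀ = u₂ t₀) (hv : v₁ t₀ = v₂ t₀) :
    ∀ᶠ t in 𝓝 t₀, u₁ t = u₂ t ∧ v₁ t = v₂ t := by
  have hX : ContDiffAt ℝ 1 (fun z : E × E => (z.2, spray L z.1 z.2)) (u₁ t₀, v₁ t₀) :=
    contDiffAt_snd.prodMk ((hL.contDiffOn_spray.contDiffAt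
      (hL.isOpen_prod.mem_nhds (mk_mem_prod hU hne))).of_le (by simp))
  obtain ⟨K, s, hs, hlip⟩ := hX.exists_lipschitzOnWith
  have c₁ : ContinuousAt (fun t => (u₁ t, v₁ t)) t₀ :=
    h₁.self_of_nhds.1.continuousAt.prodMk h₁.self_of_nhds.2.continuousAt
  have c₂ : ContinuousAt (fun t => (u₂ t, v₂ t)) t₀ :=
    h₂.self_of_nhds.1.continuousAt.prodMk h₂.self_of_nhds.2.continuousAt
  have hs₂ : ∀ᶠ z in 𝓝 (u₂ t₀, v₂ t₀), z ∈ s := by rwa [← hu, ← hv]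
  have := ODE_solution_unique_of_eventually 
    (v := fun (_ : ℝ) (z : E × E) => (z.2, spray L z.1 z.2))
    (s := fun _ => s) (f := fun t => (u₁ t, v₁ t)) (g := fun t => (u₂ t, v₂ t)) (K := K) (t₀ := t₀)
    (Eventually.of_forall fun _ => hlip)
    ((h₁.mono fun t h => h.1.prodMk h.2).and (c₁.eventually hs))
    ((h₂.mono fun t h => h.1.prodMk h.2).and (c₂.eventually hs₂))
    (by simp [hu, hv])
  filter_upwards [this] with t ht
  exact Prod.ext_iff.1 ht

end IsFinslerLagrangian

/-! ### The Lagrangian of a Finsler metric in a chart -/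

section ChartVector

variable {E : Type*} [NormedAddCommGroup E] [NormedSpace ℝ E]
  {M : Type*} [TopologicalSpace M] [ChartedSpace E M]

/-- The tangent vector with coordinates `(y, w)` in the chart `e`. -/
def chartVector (e : OpenPartialHomeomorph M E) (z : E × E) : TangentBundle 𝓘(ℝ, E) M :=
  ⟨e.symm z.1, mfderiv 𝓘(ℝ, E) 𝓘(ℝ, E) e.symm z.1 z.2⟩

theorem velocity_comp {c : ℝ → M} {f : ℝ → ℝ} {t r : ℝ}
    (hc : MDifferentiableAt 𝓘(ℝ, ℝ) 𝓘(ℝ, E) c (f t)) (hf : HasDerivAt f r t) :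
    velocity E (fun s => c (f s)) t = ⟨c (f t), r • (velocity E c (f t)).2⟩ := by
  have h1 := (hc.hasMFDerivAt.comp t hf.hasFDerivAt.hasMFDerivAt).mfderiv
  refine Bundle.TotalSpace.ext rfl (heq_of_eq ?_)
  have h2 : mfderiv 𝓘(ℝ, ℝ) 𝓘(ℝ, E) (c ∘ f) t (1 : ℝ) =
      mfderiv 𝓘(ℝ, ℝ) 𝓘(ℝ, E) c (f t) ((1 : ℝ) • r : ℝ) := by
    rw [h1]
    rfl
  refine h2.trans ?_
  rw [one_smul, ← mul_one r]
  exact ((mfderiv 𝓘(ℝ, ℝ) 𝓘(ℝ, E) c (f t)).map_smul r (1 : ℝ)).trans (by rw [mul_one]; rfl)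

theorem velocity_comp_add_const {c : ℝ → M} {a s t : ℝ} (hs : s + a = t)
    (hc : MDifferentiableAt 𝓘(ℝ, ℝ) 𝓘(ℝ, E) c t) :
    velocity E (fun r => c (r + a)) s = velocity E c t := by
  subst hs
  rw [velocity_comp (f := fun r => r + a) hc ((hasDerivAt_id s).add_const a), one_smul]
  rfl

variable [IsManifold 𝓘(ℝ, E) ∞ M] {e : OpenPartialHomeomorph M E}

theorem contMDiffOn_symm_of_mem_atlas (he : e ∈ atlas E M) :
    ContMDiffOn 𝓘(ℝ, E) 𝓘(ℝ, E) ∞ e.symm e.target :=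
  contMDiffOn_symm_of_mem_maximalAtlas (IsManifold.subset_maximalAtlas he)

theorem contMDiffOn_of_mem_atlas (he : e ∈ atlas E M) :
    ContMDiffOn 𝓘(ℝ, E) 𝓘(ℝ, E) ∞ e e.source :=
  contMDiffOn_of_mem_maximalAtlas (IsManifold.subset_maximalAtlas he)

theorem contMDiff_mk_tangentBundle : ContMDiff 𝓘(ℝ, E × E) 𝓘(ℝ, E).tangent ∞
    (fun z : E × E => (⟨z.1, z.2⟩ : TangentBundle 𝓘(ℝ, E) E)) := by
  intro z
  rw [Bundle.contMDiffAt_totalSpace]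
  refine ⟨?_, ?_⟩
  · exact (contDiffAt_fst : ContDiffAt ℝ ∞ (fun z : E × E => z.1) z).contMDiffAt
  · refine ContMDiffAt.congr_of_eventuallyEq
      (contDiffAt_snd : ContDiffAt ℝ ∞ (fun z : E × E => z.2) z).contMDiffAt
      (Eventually.of_forall fun x => ?_)
    change (tangentBundleCore 𝓘(ℝ, E) E).coordChange (achart E x.1) (achart E z.1) x.1 x.2 = x.2
    rw [tangentBundleCore_coordChange_model_space]
    rfl

theorem contMDiffOn_chartVector (he : e ∈ atlas E M) :
    ContMDiffOn 𝓘(ℝ, E × E) 𝓘(ℝ, E).tangent ∞ (chartVector e) (e.target ×ˢ univ) := by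
  have h1 := (contMDiffOn_symm_of_mem_atlas he).contMDiffOn_tangentMapWithin (m := ∞) (by simp)
    e.open_target.uniqueMDiffOn
  have h3 := h1.comp (contMDiff_mk_tangentBundle.contMDiffOn (s := e.target ×ˢ univ))
    (fun z hz => hz.1)
  refine h3.congr fun z hz => ?_
  simp only [Function.comp, chartVector, tangentMapWithin]
  rw [mfderivWithin_of_isOpen e.open_target (by exact hz.1)]

theorem continuousOn_chartVector (he : e ∈ atlas E M) :
    ContinuousOn (chartVector e) (e.target ×ˢ univ) :=
  (contMDiffOn_chartVector he).continuousOn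

/-- The derivative of the inverse chart, as a linear automorphism of `E`. -/
theorem exists_equiv_mfderiv_symm (he : e ∈ atlas E M) {y : E} (hy : y ∈ e.target) :
    ∃ A : E ≃L[ℝ] E, ∀ w : E, mfderiv 𝓘(ℝ, E) 𝓘(ℝ, E) e.symm y w = A w := by
  have he' := (mdifferentiable_of_mem_atlas (I := 𝓘(ℝ, E)) he).symm
  exact ⟨he'.mfderiv (x := y) hy, fun w => rfl⟩

theorem chartVector_snd_ne_zero (he : e ∈ atlas E M) {y w : E} (hy : y ∈ e.target) (hw : w ≠ 0) :
    (chartVector e (y, w)).2 ≠ 0 := by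
  obtain ⟨A, hA⟩ := exists_equiv_mfderiv_symm he hy
  intro h
  have h1 : A w = 0 := (hA w).symm.trans h
  exact hw (A.map_eq_zero_iff.1 h1)

theorem exists_chartVector_eq (he : e ∈ atlas E M) (v : TangentBundle 𝓘(ℝ, E) M)
    (hv : v.1 ∈ e.source) : ∃ w : E, chartVector e (e v.1, w) = v := by
  obtain ⟨x, ξ⟩ := v
  obtain ⟨A, hA⟩ := exists_equiv_mfderiv_symm he (e.map_source hv)
  refine ⟨A.symm ξ, ?_⟩
  have h1 : mfderiv 𝓘(ℝ, E) 𝓘(ℝ, E) e.symm (e x) (A.symm ξ : E) = (ξ : E) :=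
    (hA _).trans (A.apply_symm_apply ξ)
  have h2 : e.symm (e x) = x := e.left_inv hv
  unfold chartVector
  simp only
  refine Bundle.TotalSpace.ext h2 ?_
  exact heq_of_eq h1

theorem mdifferentiableAt_iff_chart (he : e ∈ atlas E M) {c : ℝ → M} {t : ℝ}
    (hc : ContinuousAt c t) (ht : c t ∈ e.source) :
    MDifferentiableAt 𝓘(ℝ, ℝ) 𝓘(ℝ, E) c t ↔ DifferentiableAt ℝ (fun s => e (c s)) t := by
  constructor
  · intro h
    exact ((mdifferentiableAt_atlas (I := 𝓘(ℝ, E)) he ht).comp t h).differentiableAt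
  · intro h
    have h1 : MDifferentiableAt 𝓘(ℝ, ℝ) 𝓘(ℝ, E) (e.symm ∘ fun s => e (c s)) t :=
      (mdifferentiableAt_atlas_symm (I := 𝓘(ℝ, E)) he (e.map_source ht)).comp t
        h.mdifferentiableAt
    refine h1.congr_of_eventuallyEq ?_
    filter_upwards [hc.eventually (e.open_source.mem_nhds ht)] with s hs
    exact (e.left_inv hs).symm

theorem velocity_eq_chartVector (he : e ∈ atlas E M) {c : ℝ → M} {t : ℝ}
    (hc : MDifferentiableAt 𝓘(ℝ, ℝ) 𝓘(ℝ, E) c t) (ht : c t ∈ e.source) :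
    velocity E c t = chartVector e (e (c t), deriv (fun s => e (c s)) t) := by
  have hd := (mdifferentiableAt_iff_chart he hc.continuousAt ht).1 hc
  have h1 := mfderiv_comp t (g := e.symm) (f := fun s => e (c s))
    (mdifferentiableAt_atlas_symm (I := 𝓘(ℝ, E)) he (e.map_source ht)) hd.mdifferentiableAt
  have h2 : (e.symm ∘ fun s => e (c s)) =ᶠ[𝓝 t] c := by
    filter_upwards [hc.continuousAt.eventually (e.open_source.mem_nhds ht)] with s hs
    exact e.left_inv hs
  have h3 : mfderiv 𝓘(ℝ, ℝ) 𝓘(ℝ, E) (e.symm ∘ fun s => e (c s)) t = mfderiv 𝓘(ℝ, ℝ) 𝓘(ℝ, E) c t :=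
    h2.mfderiv_eq
  refine Bundle.TotalSpace.ext (e.left_inv ht).symm (heq_of_eq ?_)
  change (mfderiv 𝓘(ℝ, ℝ) 𝓘(ℝ, E) c t (1 : ℝ) : E) = _
  rw [← h3, h1]
  change (mfderiv 𝓘(ℝ, E) 𝓘(ℝ, E) e.symm (e (c t)))
    (mfderiv 𝓘(ℝ, ℝ) 𝓘(ℝ, E) (fun s => e (c s)) t (1 : ℝ)) = _
  rw [mfderiv_eq_fderiv]
  rfl

end ChartVector

namespace FinslerMetric

variable {E : Type*} [NormedAddCommGroup E] [NormedSpace ℝ E]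
  {M : Type*} [TopologicalSpace M] [ChartedSpace E M] [IsManifold 𝓘(ℝ, E) ∞ M]
  (F : FinslerMetric E M) {e : OpenPartialHomeomorph M E}

theorem localLagrangian_eq (y w : E) :
    F.localLagrangian e y w = (1 / 2 : ℝ) * F.toFun (chartVector e (y, w)) ^ 2 := rfl

theorem isFinslerLagrangian (he : e ∈ atlas E M) :
    IsFinslerLagrangian e.target (F.localLagrangian e) where
  isOpen := e.open_target
  smooth := by
    have h1 : ContMDiffOn 𝓘(ℝ, E × E) 𝓘(ℝ, ℝ) ∞ (fun z => F.toFun (chartVector e z))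
        (e.target ×ˢ {0}ᶜ) :=
      F.smooth.comp ((contMDiffOn_chartVector he).mono (prod_mono le_rfl (subset_univ _)))
        fun z hz => chartVector_snd_ne_zero he hz.1 hz.2
    exact contDiffOn_const.mul ((contMDiffOn_iff_contDiffOn.1 h1).pow 2)
  homog := by
    intro y hy w r hr
    have h1 : chartVector e (y, r • w) =
        ⟨e.symm y, r • (mfderiv 𝓘(ℝ, E) 𝓘(ℝ, E) e.symm y w)⟩ :=
      congrArg (Bundle.TotalSpace.mk (e.symm y)) ((mfderiv 𝓘(ℝ, E) 𝓘(ℝ, E) e.symm y).map_smul r w)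
    rw [localLagrangian_eq, h1, F.homogeneous _ _ _ hr, localLagrangian]
    ring
  hess := by
    intro y hy ξ η hξ hη
    obtain ⟨A, hA⟩ := exists_equiv_mfderiv_symm he hy
    set g : E → ℝ := fun ζ => (1 / 2 : ℝ) * F.toFun ⟨e.symm y, ζ⟩ ^ 2 with hg
    have h1 : F.localLagrangian e y = g ∘ A := by
      funext w
      simp only [localLagrangian, hA, hg, Function.comp]
    have hpos : 0 < fderiv ℝ (fderiv ℝ g) (A ξ) (A η) (A η) :=
      F.hessian_pos (e.symm y) (A ξ) (A η) (by simpa using hξ) (by simpa using hη)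
    have hdiff : DifferentiableAt ℝ (fderiv ℝ g) (A ξ) := by
      by_contra h
      rw [fderiv_zero_of_not_differentiableAt h] at hpos
      simp at hpos
    have h2 : fderiv ℝ (F.localLagrangian e y)
        = fun w => (fderiv ℝ g (A w)).comp (A : E →L[ℝ] E) := by
      funext w
      rw [h1, A.comp_right_fderiv]
    have h3 : HasFDerivAt (fun w => fderiv ℝ g (A w))
        ((fderiv ℝ (fderiv ℝ g) (A ξ)).comp (A : E →L[ℝ] E)) ξ :=
      hdiff.hasFDerivAt.comp ξ A.hasFDerivAt
    have h4 := h3.clm_comp (hasFDerivAt_const (A : E →L[ℝ] E) ξ)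
    rw [h2, h4.fderiv]
    simpa using hpos

theorem half_sq_velocity (he : e ∈ atlas E M) {c : ℝ → M} {t : ℝ}
    (hc : MDifferentiableAt 𝓘(ℝ, ℝ) 𝓘(ℝ, E) c t) (ht : c t ∈ e.source) :
    (1 / 2 : ℝ) * F.toFun (velocity E c t) ^ 2
      = F.localLagrangian e (e (c t)) (deriv (fun s => e (c s)) t) := by
  rw [velocity_eq_chartVector he hc ht, localLagrangian_eq]

theorem toFun_eq_sqrt (v : TangentBundle 𝓘(ℝ, E) M) :
    F.toFun v = Real.sqrt (2 * ((1 / 2 : ℝ) * F.toFun v ^ 2)) := by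
  rw [← mul_assoc]
  norm_num
  rw [Real.sqrt_sq (F.nonneg v)]

end FinslerMetric

namespace IsFinslerLagrangian

variable {E : Type*} [NormedAddCommGroup E] [NormedSpace ℝ E]
  {U : Set E} {L : E → E → ℝ}

theorem velDeriv_of_change (hL : IsFinslerLagrangian U L) {U' : Set E} {L' : E → E → ℝ}
    (hL' : IsFinslerLagrangian U' L') {y y' w : E} {A : E →L[ℝ] E} (hy : y ∈ U) (hy' : y' ∈ U')
    (heq : ∀ w, L y w = L' y' (A w)) (hw : w ≠ 0) (hw' : A w ≠ 0) (η : E) :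
    velDeriv L y w η = velDeriv L' y' (A w) (A η) := by
  have h1 := (hL'.hasFDerivAt_vel hy' hw').comp w A.hasFDerivAt
  have h2 := hL.hasFDerivAt_vel hy hw
  have h3 : L y = L' y' ∘ A := funext heq
  exact DFunLike.congr_fun (h2.unique (h3 ▸ h1)) η

theorem posDeriv_of_change (hL : IsFinslerLagrangian U L) {U' : Set E} {L' : E → E → ℝ}
    (hL' : IsFinslerLagrangian U' L') {φ : E → E} {y w : E} {D : E →L[ℝ] E →L[ℝ] E}
    (hy : y ∈ U) (hy' : φ y ∈ U') (hφ : HasFDerivAt φ (fderiv ℝ φ y) y)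
    (hD : HasFDerivAt (fderiv ℝ φ) D y) (heq : ∀ᶠ z in 𝓝 y, L z w = L' (φ z) (fderiv ℝ φ z w))
    (hw : w ≠ 0) (hw' : fderiv ℝ φ y w ≠ 0) (η : E) :
    posDeriv L y w η = posDeriv L' (φ y) (fderiv ℝ φ y w) (fderiv ℝ φ y η) +
      velDeriv L' (φ y) (fderiv ℝ φ y w) (D η w) := by
  have h0 : y = (fun s : ℝ => y + s • η) 0 := by simp
  have hline : HasDerivAt (fun s : ℝ => y + s • η) η 0 := by
    simpa using ((hasDerivAt_id (0 : ℝ)).smul_const η).const_add y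
  generalize (fun s : ℝ => y + s • η) = ℓ at h0 hline
  subst h0
  have ha : HasDerivAt (fun s : ℝ => φ (ℓ s)) (fderiv ℝ φ (ℓ 0) η) 0 :=
    hφ.comp_hasDerivAt (0 : ℝ) hline
  have hb : HasDerivAt (fun s : ℝ => fderiv ℝ φ (ℓ s) w) (D η w) 0 := by
    refine ((hD.comp_hasDerivAt (0 : ℝ) hline).clm_apply
      (hasDerivAt_const (0 : ℝ) w)).congr_deriv ?_
    rw [map_zero, add_zero]
  have h1 := hL'.hasDerivAt_lagrangian ha hb hy' hw'
  have h2 := hL.hasDerivAt_lagrangian hline (hasDerivAt_const (0 : ℝ) w) hy hw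
  have h3 : (fun s : ℝ => L (ℓ s) w) =ᶠ[𝓝 0] fun s => L' (φ (ℓ s)) (fderiv ℝ φ (ℓ s) w) :=
    hline.continuousAt.eventually heq
  have h4 := (h2.congr_of_eventuallyEq h3.symm).unique h1
  rwa [map_zero, add_zero] at h4

variable [FiniteDimensional ℝ E]

theorem eq_spray (hL : IsFinslerLagrangian U L) {u v : ℝ → E} {t : ℝ} {a : E}
    (hu : HasDerivAt u (v t) t) (hv : HasDerivAt v a t) (hy : u t ∈ U) (hw : v t ≠ 0)
    (h : HasDerivAt (fun s => velDeriv L (u s) (v s)) (posDeriv L (u t) (v t)) t) :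
    a = spray L (u t) (v t) := by
  have h1 := (hL.hasDerivAt_momentum hu hv hy hw).unique h
  apply hL.velHess_injective hy hw
  rw [hL.velHess_spray hy hw, ← h1, add_sub_cancel_left]

/-- The Euler-Lagrange equation does not depend on the coordinates. -/
theorem hasDerivAt_spray_of_change (hL : IsFinslerLagrangian U L) {U' : Set E} {L' : E → E → ℝ}
    (hL' : IsFinslerLagrangian U' L') {V : Set E} (hV : IsOpen V) (hVU : V ⊆ U) {φ : E → E}
    (hφ : ContDiffOn ℝ ∞ φ V) (hmaps : MapsTo φ V U')
    (hbij : ∀ y ∈ V, Function.Bijective (fderiv ℝ φ y))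
    (heq : ∀ y ∈ V, ∀ w, L y w = L' (φ y) (fderiv ℝ φ y w))
    {u v : ℝ → E} {t : ℝ} (hu : HasDerivAt u (v t) t)
    (hv : HasDerivAt v (spray L (u t) (v t)) t) (hy : u t ∈ V) (hw : v t ≠ 0) :
    HasDerivAt (fun s => fderiv ℝ φ (u s) (v s))
      (spray L' (φ (u t)) (fderiv ℝ φ (u t) (v t))) t := by
  have hφt : ContDiffAt ℝ 2 φ (u t) :=
    (hφ.contDiffAt (hV.mem_nhds hy)).of_le ENat.LEInfty.out
  have hφ1 : HasFDerivAt φ (fderiv ℝ φ (u t)) (u t) := (hφt.differentiableAt (by simp)).hasFDerivAt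
  have hφ2 : HasFDerivAt (fderiv ℝ φ) (fderiv ℝ (fderiv ℝ φ) (u t)) (u t) :=
    ((hφt.fderiv_right (m := 1) (by norm_num)).differentiableAt (by simp)).hasFDerivAt
  have hne : ∀ y ∈ V, ∀ w, w ≠ 0 → fderiv ℝ φ y w ≠ 0 := fun y hy w hw h =>
    hw ((hbij y hy).1 (by rw [h, map_zero]))
  have hsymm : ∀ η, fderiv ℝ (fderiv ℝ φ) (u t) (v t) η = fderiv ℝ (fderiv ℝ φ) (u t) η (v t) :=
    fun η => (hφt.isSymmSndFDerivAt (by simp)) (v t) η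
  generalize fderiv ℝ (fderiv ℝ φ) (u t) = D at hφ2 hsymm
  have hDu : HasDerivAt (fun s => fderiv ℝ φ (u s)) (D (v t)) t := hφ2.comp_hasDerivAt t hu
  have hu' : HasDerivAt (fun s => φ (u s)) (fderiv ℝ φ (u t) (v t)) t := hφ1.comp_hasDerivAt t hu
  have hv' := hDu.clm_apply hv
  have hV' : ∀ᶠ s in 𝓝 t, u s ∈ V := hu.continuousAt.eventually (hV.mem_nhds hy)
  refine hv'.congr_deriv (hL'.eq_spray hu' hv' (hmaps hy) (hne _ hy _ hw) ?_)
  have hP := hL'.hasDerivAt_momentum hu' hv' (hmaps hy) (hne _ hy _ hw)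
  refine hP.congr_deriv (ContinuousLinearMap.ext fun ζ => ?_)
  obtain ⟨η, rfl⟩ := (hbij _ hy).2 ζ
  have hpos := hL.posDeriv_of_change hL' (hVU hy) (hmaps hy) hφ1 hφ2
    (by filter_upwards [hV.mem_nhds hy] with z hz using heq z hz _) hw (hne _ hy _ hw) η
  have h1 := hP.clm_apply (hDu.clm_apply (hasDerivAt_const t η))
  have h2 := (hL.hasDerivAt_momentum_of_spray hu hv (hVU hy) hw).clm_apply (hasDerivAt_const t η)
  have h3 : (fun s => velDeriv L (u s) (v s) η) =ᶠ[𝓝 t]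
      fun s => velDeriv L' (φ (u s)) (fderiv ℝ φ (u s) (v s)) (fderiv ℝ φ (u s) η) := by
    filter_upwards [hV', hv.continuousAt.eventually_ne hw] with s hs hs'
    exact hL.velDeriv_of_change hL' (hVU hs) (hmaps hs) (heq _ hs) hs' (hne _ hs _ hs') η
  have h4 := (h2.congr_of_eventuallyEq h3.symm).unique h1
  rw [map_zero, map_zero, add_zero, add_zero, hpos, hsymm η] at h4
  exact (add_right_cancel h4).symm

theorem isCompact_unit_closedBall (hL : IsFinslerLagrangian U L) {y₀ : E} {R : ℝ}
    (hR : closedBall y₀ R ⊆ U) :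
    IsCompact {z : E × E | z.1 ∈ closedBall y₀ R ∧ L z.1 z.2 = 1 / 2} := by
  have : ProperSpace E := FiniteDimensional.proper_real E
  obtain ⟨c, hc, C, hC, hb⟩ := hL.exists_bounds hR
  have hK : IsCompact (closedBall y₀ R ×ˢ closedBall (0 : E) (c⁻¹ + 1)) :=
    (isCompact_closedBall _ _).prod (isCompact_closedBall _ _)
  have hcont : ContinuousOn (fun z : E × E => L z.1 z.2)
      (closedBall y₀ R ×ˢ closedBall (0 : E) (c⁻¹ + 1)) :=
    hL.continuousOn_lagrangian.mono (prod_mono hR (subset_univ _))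
  have hcl := hcont.preimage_isClosed_of_isClosed hK.isClosed
    (isClosed_singleton (x := (1 / 2 : ℝ)))
  have hsub : {z : E × E | z.1 ∈ closedBall y₀ R ∧ L z.1 z.2 = 1 / 2} =
      closedBall y₀ R ×ˢ closedBall (0 : E) (c⁻¹ + 1) ∩ (fun z => L z.1 z.2) ⁻¹' {1 / 2} := by
    ext z
    refine ⟨fun h => ⟨⟨h.1, mem_closedBall_zero_iff.2 ?_⟩, h.2⟩, fun h => ⟨h.1.1, h.2⟩⟩
    have h1 := (hb z.1 h.1 z.2).1
    rw [h.2] at h1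
    have h2 : ‖z.2‖ ^ 2 ≤ c⁻¹ := by
      rw [inv_eq_one_div, le_div_iff₀ hc]
      linarith
    nlinarith [inv_pos.2 hc]
  rw [hsub]
  exact hK.of_isClosed_subset hcl inter_subset_left

end IsFinslerLagrangian

/-! ### Geodesics as solutions of a second order equation in charts -/

section ChartChange

variable {E : Type*} [NormedAddCommGroup E] [NormedSpace ℝ E]
  {M : Type*} [TopologicalSpace M] [ChartedSpace E M]

theorem velocity_congr {c₁ c₂ : ℝ → M} {t : ℝ} (heq : c₁ =ᶠ[𝓝 t] c₂) :
    velocity E c₁ t = velocity E c₂ t := by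
  refine Bundle.TotalSpace.ext heq.self_of_nhds (heq_of_eq ?_)
  exact congrArg (fun A : ℝ →L[ℝ] E => A 1) heq.mfderiv_eq

variable [IsManifold 𝓘(ℝ, E) ∞ M] {e e' : OpenPartialHomeomorph M E}

theorem contDiffOn_chart_change (he : e ∈ atlas E M) (he' : e' ∈ atlas E M) :
    ContDiffOn ℝ ∞ (fun y => e' (e.symm y)) (e.symm.trans e').source := by
  rw [← contMDiffOn_iff_contDiffOn]
  refine (contMDiffOn_of_mem_atlas he').comp
    ((contMDiffOn_symm_of_mem_atlas he).mono ?_) fun y hy => ?_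
  · exact fun y hy => hy.1
  · exact hy.2

theorem chartVector_change (he : e ∈ atlas E M) (he' : e' ∈ atlas E M) {y : E}
    (hy : y ∈ (e.symm.trans e').source) (w : E) :
    chartVector e (y, w) =
      chartVector e' (e' (e.symm y), fderiv ℝ (fun y => e' (e.symm y)) y w) := by
  have hy1 : y ∈ e.target := hy.1
  have hy2 : e.symm y ∈ e'.source := hy.2
  have hd : DifferentiableAt ℝ (fun y => e' (e.symm y)) y :=
    ((contDiffOn_chart_change he he').contDiffAt
      ((e.symm.trans e').open_source.mem_nhds hy)).differentiableAt (by simp)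
  have h1 := mfderiv_comp y (g := e'.symm) (f := fun y => e' (e.symm y))
    (mdifferentiableAt_atlas_symm (I := 𝓘(ℝ, E)) he' (e'.map_source hy2)) hd.mdifferentiableAt
  have h2 : (e'.symm ∘ fun y => e' (e.symm y)) =ᶠ[𝓝 y] e.symm := by
    filter_upwards [(e.symm.trans e').open_source.mem_nhds hy] with z hz
    exact e'.left_inv hz.2
  have h3 : mfderiv 𝓘(ℝ, E) 𝓘(ℝ, E) (e'.symm ∘ fun y => e' (e.symm y)) y =
      mfderiv 𝓘(ℝ, E) 𝓘(ℝ, E) e.symm y := h2.mfderiv_eq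
  refine Bundle.TotalSpace.ext (e'.left_inv hy2).symm (heq_of_eq ?_)
  change (mfderiv 𝓘(ℝ, E) 𝓘(ℝ, E) e.symm y w : E) = _
  rw [← h3, h1]
  change (mfderiv 𝓘(ℝ, E) 𝓘(ℝ, E) e'.symm (e' (e.symm y)))
    (mfderiv 𝓘(ℝ, E) 𝓘(ℝ, E) (fun y => e' (e.symm y)) y w) = _
  rw [mfderiv_eq_fderiv]
  rfl

theorem injective_fderiv_chart_change (he : e ∈ atlas E M) (he' : e' ∈ atlas E M) {y : E}
    (hy : y ∈ (e.symm.trans e').source) :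
    Function.Injective (fderiv ℝ (fun y => e' (e.symm y)) y) := by
  refine (injective_iff_map_eq_zero _).2 fun w hw => ?_
  by_contra h
  refine chartVector_snd_ne_zero he hy.1 h ?_
  have h1 := chartVector_change he he' hy w
  rw [hw] at h1
  have h2 : (chartVector e' (e' (e.symm y), 0)).2 = 0 :=
    (mfderiv 𝓘(ℝ, E) 𝓘(ℝ, E) e'.symm (e' (e.symm y))).map_zero
  rw [h1]
  exact h2

end ChartChange

namespace FinslerMetric

variable {E : Type*} [NormedAddCommGroup E] [NormedSpace ℝ E]
  {M : Type*} [TopologicalSpace M] [ChartedSpace E M] [IsManifold 𝓘(ℝ, E) ∞ M]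
  (F : FinslerMetric E M) {e e' : OpenPartialHomeomorph M E} {c c₁ c₂ : ℝ → M} {t : ℝ}

theorem toFun_zero (x : M) : F.toFun ⟨x, 0⟩ = 0 := by
  have h := F.homogeneous x 0 2 two_pos
  rw [smul_zero] at h
  linarith

/-- Near time `t` the curve `c` is a nonconstant solution of the Euler-Lagrange equation in the
chart `e`. -/
def IsGeodesicIn (e : OpenPartialHomeomorph M E) (c : ℝ → M) (t : ℝ) : Prop :=
  ∀ᶠ s in 𝓝 t, c s ∈ e.source ∧ deriv (fun r => e (c r)) s ≠ 0 ∧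
    HasDerivAt (fun r => e (c r)) (deriv (fun r => e (c r)) s) s ∧
    HasDerivAt (deriv fun r => e (c r))
      (spray (F.localLagrangian e) (e (c s)) (deriv (fun r => e (c r)) s)) s

/-- Near time `t` the curve `c` is a nonconstant geodesic. -/
def IsGeodesicAt (c : ℝ → M) (t : ℝ) : Prop := ∃ e ∈ atlas E M, F.IsGeodesicIn e c t

variable {F}

theorem IsGeodesicIn.of_hasDerivAt {v : ℝ → E}
    (h : ∀ᶠ s in 𝓝 t, c s ∈ e.source ∧ v s ≠ 0 ∧ HasDerivAt (fun r => e (c r)) (v s) s ∧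
      HasDerivAt v (spray (F.localLagrangian e) (e (c s)) (v s)) s) : F.IsGeodesicIn e c t := by
  have h1 : deriv (fun r => e (c r)) =ᶠ[𝓝 t] v := h.mono fun s hs => hs.2.2.1.deriv
  filter_upwards [h, h1.eventuallyEq_nhds] with s hs hs1
  have h2 : deriv (fun r => e (c r)) s = v s := hs1.self_of_nhds
  rw [h2]
  exact ⟨hs.1, hs.2.1, hs.2.2.1, hs.2.2.2.congr_of_eventuallyEq hs1⟩

theorem IsGeodesicIn.congr (h : F.IsGeodesicIn e c₁ t) (heq : c₁ =ᶠ[𝓝 t] c₂) :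
    F.IsGeodesicIn e c₂ t := by
  refine .of_hasDerivAt (v := deriv fun r => e (c₁ r)) ?_
  filter_upwards [h, heq.eventuallyEq_nhds] with s hs hs1
  have h2 : (fun r => e (c₁ r)) =ᶠ[𝓝 s] fun r => e (c₂ r) := hs1.mono fun r hr => by simp only [hr]
  rw [← hs1.self_of_nhds]
  exact ⟨hs.1, hs.2.1, hs.2.2.1.congr_of_eventuallyEq h2.symm, hs.2.2.2⟩

theorem IsGeodesicAt.congr (h : F.IsGeodesicAt c₁ t) (heq : c₁ =ᶠ[𝓝 t] c₂) :
    F.IsGeodesicAt c₂ t := by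
  obtain ⟨e, he, h⟩ := h
  exact ⟨e, he, h.congr heq⟩

theorem IsGeodesicIn.continuousAt (h : F.IsGeodesicIn e c t) : ContinuousAt c t := by
  have h1 : e.symm ∘ (fun r => e (c r)) =ᶠ[𝓝 t] c := h.mono fun s hs => e.left_inv hs.1
  obtain ⟨ht, -, hd, -⟩ := h.self_of_nhds
  have h2 : ContinuousAt e.symm (e (c t)) := e.continuousAt_symm (e.map_source ht)
  exact (ContinuousAt.comp (f := fun r => e (c r)) h2 hd.continuousAt).congr h1

theorem IsGeodesicAt.continuousAt (h : F.IsGeodesicAt c t) : ContinuousAt c t := by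
  obtain ⟨e, he, h⟩ := h
  exact h.continuousAt

theorem IsGeodesicIn.comp_add_const (h : F.IsGeodesicIn e c t) (a : ℝ) :
    F.IsGeodesicIn e (fun s => c (s + a)) (t - a) := by
  have h1 : Tendsto (fun s => s + a) (𝓝 (t - a)) (𝓝 t) := by
    have : ContinuousAt (fun s => s + a) (t - a) := by fun_prop
    simpa [ContinuousAt] using this
  refine .of_hasDerivAt (v := fun s => deriv (fun r => e (c r)) (s + a)) ?_
  filter_upwards [h1.eventually h] with s hs
  exact ⟨hs.1, hs.2.1, hs.2.2.1.comp_add_const s a, hs.2.2.2.comp_add_const s a⟩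

theorem IsGeodesicAt.comp_add_const {a : ℝ} (h : F.IsGeodesicAt c (t + a)) :
    F.IsGeodesicAt (fun s => c (s + a)) t := by
  obtain ⟨e, he, h⟩ := h
  exact ⟨e, he, by simpa using h.comp_add_const a⟩

theorem IsGeodesicIn.mdifferentiableAt (he : e ∈ atlas E M) (h : F.IsGeodesicIn e c t) :
    MDifferentiableAt 𝓘(ℝ, ℝ) 𝓘(ℝ, E) c t :=
  (mdifferentiableAt_iff_chart he h.continuousAt h.self_of_nhds.1).2
    h.self_of_nhds.2.2.1.differentiableAt

theorem IsGeodesicAt.mdifferentiableAt (h : F.IsGeodesicAt c t) :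
    MDifferentiableAt 𝓘(ℝ, ℝ) 𝓘(ℝ, E) c t := by
  obtain ⟨e, he, h⟩ := h
  exact h.mdifferentiableAt he

theorem IsGeodesicIn.velocity_eq (he : e ∈ atlas E M) (h : F.IsGeodesicIn e c t) :
    velocity E c t = chartVector e (e (c t), deriv (fun s => e (c s)) t) :=
  velocity_eq_chartVector he (h.mdifferentiableAt he) h.self_of_nhds.1

theorem chartVector_injOn (he : e ∈ atlas E M) :
    InjOn (chartVector (M := M) e) (e.target ×ˢ univ) := by
  rintro ⟨y, w⟩ hy ⟨y', w'⟩ hy' h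
  have h1 : e.symm y = e.symm y' := congrArg Bundle.TotalSpace.proj h
  obtain rfl : y = y' := e.symm.injOn hy.1 hy'.1 h1
  obtain ⟨A, hA⟩ := exists_equiv_mfderiv_symm he hy.1
  have h2 : A w = A w' := by
    rw [← hA, ← hA]
    exact eq_of_heq (Bundle.TotalSpace.mk.inj h).2
  rw [A.injective h2]

theorem localLagrangian_eq_half {v : TangentBundle 𝓘(ℝ, E) M} (hv : F.toFun v = 1) {y w : E}
    (h : chartVector e (y, w) = v) : F.localLagrangian e y w = 1 / 2 := by
  rw [localLagrangian_eq, h, hv]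
  norm_num

theorem IsGeodesicIn.hasDerivAt_half_sq (he : e ∈ atlas E M) [FiniteDimensional ℝ E]
    (h : F.IsGeodesicIn e c t) :
    HasDerivAt (fun s => (1 / 2 : ℝ) * F.toFun (velocity E c s) ^ 2) 0 t := by
  have h1 := h.self_of_nhds
  refine ((F.isFinslerLagrangian he).hasDerivAt_energy h1.2.2.1 h1.2.2.2 (e.map_source h1.1)
    h1.2.1).congr_of_eventuallyEq ?_
  filter_upwards [eventually_eventually_nhds.2 h] with s hs
  exact F.half_sq_velocity he (IsGeodesicIn.mdifferentiableAt he hs) hs.self_of_nhds.1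

/-- Speed is constant along geodesics. -/
theorem toFun_velocity_eq [FiniteDimensional ℝ E] {J : Set ℝ} (hJ : IsOpen J)
    (hJc : IsPreconnected J) (h : ∀ t ∈ J, F.IsGeodesicAt c t) {t s : ℝ} (ht : t ∈ J)
    (hs : s ∈ J) : F.toFun (velocity E c t) = F.toFun (velocity E c s) := by
  have h1 : ∀ t ∈ J, HasDerivAt (fun s => (1 / 2 : ℝ) * F.toFun (velocity E c s) ^ 2) 0 t := by
    intro t ht
    obtain ⟨e, he, h⟩ := h t ht
    exact h.hasDerivAt_half_sq he
  have h2 := hJ.is_const_of_deriv_eq_zero hJc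
    (fun t ht => (h1 t ht).differentiableAt.differentiableWithinAt)
    (fun t ht => (h1 t ht).deriv) ht hs
  rw [F.toFun_eq_sqrt, F.toFun_eq_sqrt (velocity E c s)]
  rw [h2]

theorem IsGeodesicIn.change [FiniteDimensional ℝ E] (he : e ∈ atlas E M) (he' : e' ∈ atlas E M)
    (h : F.IsGeodesicIn e c t) (ht : c t ∈ e'.source) : F.IsGeodesicIn e' c t := by
  have hV := (e.symm.trans e').open_source
  have hφ := contDiffOn_chart_change he he'
  refine .of_hasDerivAt
    (v := fun s => fderiv ℝ (fun y => e' (e.symm y)) (e (c s)) (deriv (fun r => e (c r)) s)) ?_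
  filter_upwards [eventually_eventually_nhds.2 h,
    h.continuousAt.eventually (e'.open_source.mem_nhds ht)] with s hs hs'
  obtain ⟨h1, h2, h3, h4⟩ := hs.self_of_nhds
  have hys : e (c s) ∈ (e.symm.trans e').source :=
    ⟨e.map_source h1, by
      change e.symm (e (c s)) ∈ e'.source
      rw [e.left_inv h1]
      exact hs'⟩
  have heq : (fun r => e' (e.symm (e (c r)))) =ᶠ[𝓝 s] fun r => e' (c r) :=
    hs.mono fun r hr => by simp only [e.left_inv hr.1]
  refine ⟨hs', ?_, ?_, ?_⟩
  · intro h0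
    exact h2 (injective_fderiv_chart_change he he' hys (by rw [h0, map_zero]))
  · have hd : HasFDerivAt (fun y => e' (e.symm y)) (fderiv ℝ (fun y => e' (e.symm y)) (e (c s)))
        (e (c s)) :=
      ((hφ.contDiffAt (hV.mem_nhds hys)).differentiableAt (by simp)).hasFDerivAt
    have h5 := hd.comp_hasDerivAt s h3
    exact h5.congr_of_eventuallyEq (f₁ := fun r => e' (c r)) heq.symm
  · have h5 := (F.isFinslerLagrangian he).hasDerivAt_spray_of_change (F.isFinslerLagrangian he') hV
      (fun y hy => hy.1) hφ (fun y hy => e'.map_source hy.2) (fun y hy =>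
        ⟨injective_fderiv_chart_change he he' hy, LinearMap.injective_iff_surjective.1
          (injective_fderiv_chart_change he he' hy)⟩) (fun y hy w => by
        rw [localLagrangian_eq, localLagrangian_eq, chartVector_change he he' hy]) h3 h4 hys h2
    rwa [e.left_inv h1] at h5

theorem IsGeodesicAt.isGeodesicIn [FiniteDimensional ℝ E] (h : F.IsGeodesicAt c t)
    (he : e ∈ atlas E M) (ht : c t ∈ e.source) : F.IsGeodesicIn e c t := by
  obtain ⟨e', he', h⟩ := h
  exact h.change he' he ht

theorem IsGeodesicIn.contMDiffAt [FiniteDimensional ℝ E] (he : e ∈ atlas E M)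
    (h : F.IsGeodesicIn e c t) : ContMDiffAt 𝓘(ℝ, ℝ) 𝓘(ℝ, E) 2 c t := by
  have h0 := h.self_of_nhds
  obtain ⟨r, hr, hsub⟩ := Metric.mem_nhds_iff.1 h
  have h2 : ContDiffOn ℝ 2 (fun s => e (c s)) (ball t r) := by
    have h21 : (2 : WithTop ℕ∞) = 1 + 1 := by norm_num
    have h10 : (1 : WithTop ℕ∞) = 0 + 1 := by norm_num
    rw [h21, contDiffOn_succ_iff_deriv_of_isOpen isOpen_ball]
    refine ⟨fun s hs => (hsub hs).2.2.1.differentiableAt.differentiableWithinAt, by simp, ?_⟩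
    rw [h10, contDiffOn_succ_iff_deriv_of_isOpen isOpen_ball]
    refine ⟨fun s hs => (hsub hs).2.2.2.differentiableAt.differentiableWithinAt, by simp, ?_⟩
    rw [contDiffOn_zero]
    refine ContinuousOn.congr (f := fun s =>
      spray (F.localLagrangian e) (e (c s)) (deriv (fun r => e (c r)) s)) ?_
      fun s hs => (hsub hs).2.2.2.deriv
    exact (F.isFinslerLagrangian he).contDiffOn_spray.continuousOn.comp (f := fun s =>
      (e (c s), deriv (fun r => e (c r)) s))
      (ContinuousOn.prodMk (fun s hs => (hsub hs).2.2.1.continuousAt.continuousWithinAt)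
        fun s hs => (hsub hs).2.2.2.continuousAt.continuousWithinAt)
      fun s hs => ⟨e.map_source (hsub hs).1, (hsub hs).2.1⟩
  have h3 : ContMDiffAt 𝓘(ℝ, ℝ) 𝓘(ℝ, E) 2 (fun s => e (c s)) t :=
    (h2.contDiffAt (ball_mem_nhds t hr)).contMDiffAt
  have h4 : ContMDiffAt 𝓘(ℝ, E) 𝓘(ℝ, E) 2 e.symm (e (c t)) :=
    ((contMDiffOn_symm_of_mem_atlas he).contMDiffAt
      (e.open_target.mem_nhds (e.map_source h0.1))).of_le ENat.LEInfty.out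
  refine (h4.comp t h3).congr_of_eventuallyEq ?_
  exact h.mono fun s hs => (e.left_inv hs.1).symm

theorem isGeodesic_of_forall [FiniteDimensional ℝ E] (h : ∀ t, F.IsGeodesicAt c t) :
    F.IsGeodesic c := by
  refine ⟨fun t => ?_, fun e he t ht => ?_⟩
  · obtain ⟨e, he, h⟩ := h t
    exact h.contMDiffAt he
  · have h1 := ((h t).isGeodesicIn he ht).self_of_nhds
    exact (F.isFinslerLagrangian he).hasDerivAt_momentum_of_spray h1.2.2.1 h1.2.2.2
      (e.map_source h1.1) h1.2.1

theorem IsGeodesic.isGeodesicAt [FiniteDimensional ℝ E] (h : F.IsGeodesic c)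
    (hne : ∀ s, F.toFun (velocity E c s) ≠ 0) (t : ℝ) : F.IsGeodesicAt c t := by
  set e := chartAt E (c t) with he_def
  have he : e ∈ atlas E M := chart_mem_atlas E _
  refine ⟨e, he, ?_⟩
  have hct : c t ∈ e.source := mem_chart_source E _
  have hcont : Continuous c := h.1.continuous
  have hC : ∀ s, c s ∈ e.source → ContDiffAt ℝ 2 (fun r => e (c r)) s := by
    intro s hs
    rw [← contMDiffAt_iff_contDiffAt]
    exact (((contMDiffOn_of_mem_atlas he).contMDiffAt
      (e.open_source.mem_nhds hs)).of_le ENat.LEInfty.out).comp s h.1.contMDiffAt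
  filter_upwards [hcont.continuousAt.eventually (e.open_source.mem_nhds hct)] with s hs
  have h1 : HasDerivAt (fun r => e (c r)) (deriv (fun r => e (c r)) s) s :=
    ((hC s hs).differentiableAt (by simp)).hasDerivAt
  have h2 : HasDerivAt (deriv fun r => e (c r)) (deriv (deriv fun r => e (c r)) s) s := by
    have : DifferentiableAt ℝ (fderiv ℝ fun r => e (c r)) s :=
      ((hC s hs).fderiv_right (m := 1) (by norm_num)).differentiableAt (by simp)
    exact (this.clm_apply (differentiableAt_const 1)).hasDerivAt
  have hv : deriv (fun r => e (c r)) s ≠ 0 := by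
    intro h0
    have h3 := velocity_eq_chartVector he
      ((mdifferentiableAt_iff_chart he hcont.continuousAt hs).2 h1.differentiableAt) hs
    rw [h0] at h3
    apply hne s
    rw [h3]
    have h4 : chartVector e (e (c s), 0) = ⟨e.symm (e (c s)), 0⟩ :=
      congrArg (Bundle.TotalSpace.mk _) (mfderiv 𝓘(ℝ, E) 𝓘(ℝ, E) e.symm (e (c s))).map_zero
    rw [h4, F.toFun_zero]
  refine ⟨hs, hv, h1, ?_⟩
  rw [← (F.isFinslerLagrangian he).eq_spray h1 h2 (e.map_source hs) hv (h.2 e he s hs)]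
  exact h2

end FinslerMetric

/-! ### The geodesic flow -/

namespace FinslerMetric

variable {E : Type*} [NormedAddCommGroup E] [NormedSpace ℝ E] [FiniteDimensional ℝ E]
  {M : Type*} [TopologicalSpace M] [ChartedSpace E M] [IsManifold 𝓘(ℝ, E) ∞ M]
  {F : FinslerMetric E M} {e : OpenPartialHomeomorph M E} {c c₁ c₂ : ℝ → M} {t : ℝ}

theorem IsGeodesicAt.eventuallyEq (h₁ : F.IsGeodesicAt c₁ t) (h₂ : F.IsGeodesicAt c₂ t)
    (h : velocity E c₁ t = velocity E c₂ t) : c₁ =ᶠ[𝓝 t] c₂ := by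
  obtain ⟨e, he, h₁⟩ := h₁
  have hc : c₁ t = c₂ t := congrArg Bundle.TotalSpace.proj h
  have h1 := h₁.self_of_nhds
  have h₂ := h₂.isGeodesicIn he (hc ▸ h1.1)
  have h2 := h₂.self_of_nhds
  rw [h₁.velocity_eq he, h₂.velocity_eq he] at h
  have h3 := Prod.ext_iff.1 (chartVector_injOn he ⟨e.map_source h1.1, trivial⟩
    ⟨e.map_source h2.1, trivial⟩ h)
  have h4 := (F.isFinslerLagrangian he).eventually_eq_of_initial
    (h₁.mono fun s hs => hs.2.2) (h₂.mono fun s hs => hs.2.2) (e.map_source h1.1) h1.2.1 h3.1 h3.2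
  filter_upwards [h4, h₁, h₂] with s hs hs1 hs2
  exact e.injOn hs1.1 hs2.1 hs.1

/-- Uniqueness of geodesics with given initial velocity. -/
theorem eqOn_of_velocity_eq [T2Space M] {J : Set ℝ} (hJo : IsOpen J) (hJ : IsPreconnected J)
    (h₁ : ∀ t ∈ J, F.IsGeodesicAt c₁ t) (h₂ : ∀ t ∈ J, F.IsGeodesicAt c₂ t) {t₀ : ℝ} (ht₀ : t₀ ∈ J)
    (h : velocity E c₁ t₀ = velocity E c₂ t₀) : EqOn c₁ c₂ J := by
  set A := {t | t ∈ J ∧ c₁ =ᶠ[𝓝 t] c₂} with hA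
  have hAo : IsOpen A := by
    rw [isOpen_iff_mem_nhds]
    intro t ht
    filter_upwards [hJo.mem_nhds ht.1, ht.2.eventuallyEq_nhds] with s hs hs' using ⟨hs, hs'⟩
  have hsub : J ⊆ A := by
    refine hJ.subset_of_closure_inter_subset hAo
      ⟨t₀, ht₀, ht₀, (h₁ t₀ ht₀).eventuallyEq (h₂ t₀ ht₀) h⟩ ?_
    rintro t ⟨htA, htJ⟩
    refine ⟨htJ, (h₁ t htJ).eventuallyEq (h₂ t htJ) ?_⟩
    have hne : (𝓝[A] t).NeBot := mem_closure_iff_nhdsWithin_neBot.1 htA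
    have hA1 : ∀ᶠ s in 𝓝[A] t, c₁ =ᶠ[𝓝 s] c₂ := eventually_mem_nhdsWithin.mono fun s hs => hs.2
    have hc : c₁ t = c₂ t := by
      refine tendsto_nhds_unique (l := 𝓝[A] t)
        ((h₁ t htJ).continuousAt.mono_left nhdsWithin_le_nhds) ?_
      refine ((h₂ t htJ).continuousAt.mono_left nhdsWithin_le_nhds).congr' ?_
      exact hA1.mono fun s hs => hs.self_of_nhds.symm
    obtain ⟨e, he, g₁⟩ := h₁ t htJ
    have g₂ := (h₂ t htJ).isGeodesicIn he (hc ▸ g₁.self_of_nhds.1)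
    have hv : deriv (fun r => e (c₁ r)) t = deriv (fun r => e (c₂ r)) t := by
      refine tendsto_nhds_unique (l := 𝓝[A] t)
        (g₁.self_of_nhds.2.2.2.continuousAt.mono_left nhdsWithin_le_nhds) ?_
      refine (g₂.self_of_nhds.2.2.2.continuousAt.mono_left nhdsWithin_le_nhds).congr' ?_
      refine hA1.mono fun s hs => ?_
      exact (Filter.EventuallyEq.deriv_eq (hs.mono fun r hr => by simp only [hr])).symm
    rw [g₁.velocity_eq he, g₂.velocity_eq he, hc, hv]
  exact fun t ht => (hsub ht).2.self_of_nhds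

open Classical in
theorem exists_glue [T2Space M] {J₁ J₂ : Set ℝ} (hJ₁ : IsOpen J₁) (hJ₂ : IsOpen J₂)
    (hJ : IsPreconnected (J₁ ∩ J₂)) (h₁ : ∀ t ∈ J₁, F.IsGeodesicAt c₁ t)
    (h₂ : ∀ t ∈ J₂, F.IsGeodesicAt c₂ t) {t₀ : ℝ} (ht₀ : t₀ ∈ J₁ ∩ J₂)
    (h : velocity E c₁ t₀ = velocity E c₂ t₀) :
    ∃ c : ℝ → M, EqOn c c₁ J₁ ∧ ∀ t ∈ J₁ ∪ J₂, F.IsGeodesicAt c t := by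
  have heq := eqOn_of_velocity_eq (hJ₁.inter hJ₂) hJ (fun t ht => h₁ t ht.1)
    (fun t ht => h₂ t ht.2) ht₀ h
  refine ⟨fun t => if t ∈ J₁ then c₁ t else c₂ t, fun t ht => if_pos ht, fun t ht => ?_⟩
  rcases ht with ht | ht
  · refine (h₁ t ht).congr ?_
    filter_upwards [hJ₁.mem_nhds ht] with s hs using (if_pos hs).symm
  · refine (h₂ t ht).congr ?_
    filter_upwards [hJ₂.mem_nhds ht] with s hs
    by_cases hs1 : s ∈ J₁
    · rw [if_pos hs1, heq ⟨hs1, hs⟩]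
    · rw [if_neg hs1]

variable (F)

omit [FiniteDimensional ℝ E] in
/-- Every point has a neighbourhood over which the unit vectors form a compact set in a chart. -/
theorem exists_chart_closedBall (x : M) : ∃ e ∈ atlas E M, ∃ (y : E) (R : ℝ),
    closedBall y R ⊆ e.target ∧ ∃ W ∈ 𝓝 x, ∀ v : TangentBundle 𝓘(ℝ, E) M, v.1 ∈ W →
      F.toFun v = 1 → ∃ z : E × E, z.1 ∈ closedBall y R ∧ F.localLagrangian e z.1 z.2 = 1 / 2 ∧
        chartVector e z = v := by
  set e := chartAt E x with he_def
  have he : e ∈ atlas E M := chart_mem_atlas E _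
  have hx : x ∈ e.source := mem_chart_source E _
  obtain ⟨R, hR, hsub⟩ := Metric.nhds_basis_closedBall.mem_iff.1
    (e.open_target.mem_nhds (e.map_source hx))
  refine ⟨e, he, e x, R, hsub, e.source ∩ e ⁻¹' closedBall (e x) R, ?_, ?_⟩
  · exact inter_mem (e.open_source.mem_nhds hx)
      ((e.continuousAt hx).preimage_mem_nhds (closedBall_mem_nhds _ hR))
  · rintro v ⟨hv1, hv2⟩ hv
    obtain ⟨w, hw⟩ := exists_chartVector_eq he v hv1
    exact ⟨(e v.1, w), hv2, localLagrangian_eq_half hv hw, hw⟩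

theorem compactSpace_unitBundle [CompactSpace M] : CompactSpace F.UnitBundle := by
  refine (isCompact_iff_compactSpace (s := {v : TangentBundle 𝓘(ℝ, E) M | F.toFun v = 1})).1 ?_
  have h : ∃ K : Set (TangentBundle 𝓘(ℝ, E) M), IsCompact K ∧ K ⊆ {v | F.toFun v = 1} ∧
      {v | v.1 ∈ (univ : Set M) ∧ F.toFun v = 1} ⊆ K := by
    refine isCompact_univ.induction_on (p := fun s => ∃ K : Set (TangentBundle 𝓘(ℝ, E) M),
      IsCompact K ∧ K ⊆ {v | F.toFun v = 1} ∧ {v | v.1 ∈ s ∧ F.toFun v = 1} ⊆ K)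
      ⟨∅, isCompact_empty, empty_subset _, fun v hv => hv.1.elim⟩ ?_ ?_ ?_
    · rintro s t hst ⟨K, h1, h2, h3⟩
      exact ⟨K, h1, h2, fun v hv => h3 ⟨hst hv.1, hv.2⟩⟩
    · rintro s t ⟨K, h1, h2, h3⟩ ⟨K', h1', h2', h3'⟩
      refine ⟨K ∪ K', h1.union h1', union_subset h2 h2', ?_⟩
      rintro v ⟨hv | hv, hv'⟩
      · exact Or.inl (h3 ⟨hv, hv'⟩)
      · exact Or.inr (h3' ⟨hv, hv'⟩)
    · intro x _
      obtain ⟨e, he, y, R, hR, W, hW, h⟩ := F.exists_chart_closedBall x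
      refine ⟨W, mem_nhdsWithin_of_mem_nhds hW, _,
        ((F.isFinslerLagrangian he).isCompact_unit_closedBall hR).image_of_continuousOn
          ((continuousOn_chartVector he).mono fun z hz => ⟨hR hz.1, trivial⟩), ?_, ?_⟩
      · rintro v ⟨z, hz, rfl⟩
        have h1 := hz.2
        rw [localLagrangian_eq] at h1
        have h2 := F.nonneg (chartVector e z)
        change F.toFun (chartVector e z) = 1
        nlinarith
      · rintro v ⟨hv1, hv2⟩
        obtain ⟨z, hz1, hz2, hz3⟩ := h v hv1 hv2
        exact ⟨z, ⟨hz1, hz2⟩, hz3⟩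
  obtain ⟨K, h1, h2, h3⟩ := h
  rwa [h2.antisymm fun v hv => h3 ⟨trivial, hv⟩] at h1

theorem exists_geodesic_uniform [CompactSpace M] :
    ∃ δ > 0, ∀ v : TangentBundle 𝓘(ℝ, E) M, F.toFun v = 1 → ∃ c : ℝ → M, velocity E c 0 = v ∧
      ∀ t ∈ Ioo (-δ) δ, F.IsGeodesicAt c t := by
  have h : ∃ δ > 0, ∀ v : TangentBundle 𝓘(ℝ, E) M, v.1 ∈ (univ : Set M) → F.toFun v = 1 →
      ∃ c : ℝ → M, velocity E c 0 = v ∧ ∀ t ∈ Ioo (-δ) δ, F.IsGeodesicAt c t := by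
    refine isCompact_univ.induction_on (p := fun s => ∃ δ > 0, ∀ v : TangentBundle 𝓘(ℝ, E) M,
      v.1 ∈ s → F.toFun v = 1 → ∃ c : ℝ → M, velocity E c 0 = v ∧
        ∀ t ∈ Ioo (-δ) δ, F.IsGeodesicAt c t) ⟨1, one_pos, fun v hv => hv.elim⟩ ?_ ?_ ?_
    · rintro s t hst ⟨δ, hδ, h⟩
      exact ⟨δ, hδ, fun v hv => h v (hst hv)⟩
    · rintro s t ⟨δ, hδ, h⟩ ⟨δ', hδ', h'⟩
      refine ⟨min δ δ', lt_min hδ hδ', fun v hv hv1 => ?_⟩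
      rcases hv with hv | hv
      · obtain ⟨c, h0, h1⟩ := h v hv hv1
        exact ⟨c, h0, fun t ht => h1 t
          ⟨by linarith [ht.1, min_le_left δ δ'], ht.2.trans_le (min_le_left _ _)⟩⟩
      · obtain ⟨c, h0, h1⟩ := h' v hv hv1
        exact ⟨c, h0, fun t ht => h1 t
          ⟨by linarith [ht.1, min_le_right δ δ'], ht.2.trans_le (min_le_right _ _)⟩⟩
    · intro x _
      obtain ⟨e, he, y, R, hR, W, hW, h⟩ := F.exists_chart_closedBall x
      have hL := F.isFinslerLagrangian he
      obtain ⟨δ, hδ, hiv⟩ := hL.exists_initial_value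
        (hL.isCompact_unit_closedBall hR) (fun z hz => ⟨hR hz.1, fun h0 => by
          have h1 := hz.2
          rw [show z.2 = 0 from h0, hL.apply_zero (hR hz.1)] at h1
          norm_num at h1⟩)
      refine ⟨W, mem_nhdsWithin_of_mem_nhds hW, δ, hδ, fun v hv hv1 => ?_⟩
      obtain ⟨z, hz1, hz2, hz3⟩ := h v hv hv1
      obtain ⟨u, w, hu0, hw0, huw⟩ := hiv z ⟨hz1, hz2⟩
      have hgeo : ∀ t ∈ Ioo (-δ) δ, F.IsGeodesicIn e (fun t => e.symm (u t)) t := by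
        intro t ht
        have hev : ∀ᶠ s in 𝓝 t, s ∈ Ioo (-δ) δ := Ioo_mem_nhds ht.1 ht.2
        refine .of_hasDerivAt (v := w) ?_
        filter_upwards [hev, hev.eventually_nhds] with s hs hs'
        obtain ⟨h1, h2, h3, h4⟩ := huw s hs
        refine ⟨e.map_target h3, h4, ?_, by rwa [e.right_inv h3]⟩
        exact h1.congr_of_eventuallyEq (hs'.mono fun r hr => e.right_inv (huw r hr).2.2.1)
      have h0 : (0 : ℝ) ∈ Ioo (-δ) δ := ⟨by linarith, hδ⟩
      refine ⟨fun t => e.symm (u t), ?_, fun t ht => ⟨e, he, hgeo t ht⟩⟩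
      have hd : deriv (fun s => e (e.symm (u s))) 0 = w 0 := by
        refine ((huw 0 h0).1.congr_of_eventuallyEq ?_).deriv
        filter_upwards [Ioo_mem_nhds h0.1 h0.2] with r hr
        exact e.right_inv (huw r hr).2.2.1
      rw [(hgeo 0 h0).velocity_eq he, e.right_inv (huw 0 h0).2.2.1, hd, hu0, hw0, hz3]
  obtain ⟨δ, hδ, h⟩ := h
  exact ⟨δ, hδ, fun v hv => h v trivial hv⟩

theorem exists_geodesic_ball [CompactSpace M] [T2Space M] {v : TangentBundle 𝓘(ℝ, E) M}
    (hv : F.toFun v = 1) (T : ℝ) : ∃ c : ℝ → M, velocity E c 0 = v ∧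
      ∀ t ∈ Ioo (-T) T, F.IsGeodesicAt c t := by
  obtain ⟨δ, hδ, hex⟩ := F.exists_geodesic_uniform
  have key : ∀ n : ℕ, ∃ c : ℝ → M, velocity E c 0 = v ∧
      ∀ t ∈ Ioo (-(n * (δ / 2) + δ)) (n * (δ / 2) + δ), F.IsGeodesicAt c t := by
    intro n
    induction n with
    | zero => simpa using hex v hv
    | succ n ih =>
      obtain ⟨c, hc0, hc⟩ := ih
      set T := n * (δ / 2) + δ with hT
      have hTδ : δ ≤ T := by
        have : 0 ≤ n * (δ / 2) := by positivity
        linarith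
      have h0 : (0 : ℝ) ∈ Ioo (-T) T := ⟨by linarith, by linarith⟩
      have hunit : ∀ (c' : ℝ → M) (t : ℝ) (a b : ℝ), velocity E c' 0 = v →
          (∀ t ∈ Ioo a b, F.IsGeodesicAt c' t) → (0 : ℝ) ∈ Ioo a b → t ∈ Ioo a b →
          F.toFun (velocity E c' t) = 1 := by
        intro c' t a b hc' hg h0 ht
        rw [toFun_velocity_eq isOpen_Ioo isPreconnected_Ioo hg ht h0, hc', hv]
      have hext : ∀ (c' : ℝ → M) (t₀ : ℝ), F.IsGeodesicAt c' t₀ →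
          F.toFun (velocity E c' t₀) = 1 → ∃ c₁ : ℝ → M, velocity E c' t₀ = velocity E c₁ t₀ ∧
            ∀ t ∈ Ioo (t₀ - δ) (t₀ + δ), F.IsGeodesicAt c₁ t := by
        intro c' t₀ hg h1
        obtain ⟨c₁, hc₁, hg₁⟩ := hex _ h1
        refine ⟨fun t => c₁ (t + -t₀), ?_, fun t ht => ?_⟩
        · rw [velocity_comp_add_const (add_neg_cancel _)
            (hg₁ 0 ⟨by linarith, hδ⟩).mdifferentiableAt, hc₁]
        · exact (hg₁ _ ⟨by linarith [ht.1], by linarith [ht.2]⟩).comp_add_const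
      have hr : T - δ / 2 ∈ Ioo (-T) T := ⟨by linarith, by linarith⟩
      obtain ⟨c₁, hc₁, hg₁⟩ := hext c _ (hc _ hr) (hunit c _ _ _ hc0 hc h0 hr)
      obtain ⟨c₂, heq₂, hg₂⟩ := exists_glue isOpen_Ioo isOpen_Ioo
        ((Ioo_inter_Ioo (a₁ := -T)).symm ▸ isPreconnected_Ioo) hc hg₁
        ⟨hr, by linarith, by linarith⟩ hc₁
      have hc₂0 : velocity E c₂ 0 = v := by
        rw [velocity_congr (heq₂.eventuallyEq_of_mem (Ioo_mem_nhds h0.1 h0.2)), hc0]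
      have hg₂' : ∀ t ∈ Ioo (-T) (T + δ / 2), F.IsGeodesicAt c₂ t := by
        intro t ht
        refine hg₂ t ?_
        by_cases h : t < T
        · exact Or.inl ⟨ht.1, h⟩
        · exact Or.inr ⟨by linarith [not_lt.1 h], by linarith [ht.2]⟩
      have h0' : (0 : ℝ) ∈ Ioo (-T) (T + δ / 2) := ⟨by linarith, by linarith⟩
      have hl : -T + δ / 2 ∈ Ioo (-T) (T + δ / 2) := ⟨by linarith, by linarith⟩
      obtain ⟨c₃, hc₃, hg₃⟩ := hext c₂ _ (hg₂' _ hl) (hunit c₂ _ _ _ hc₂0 hg₂' h0' hl)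
      obtain ⟨c₄, heq₄, hg₄⟩ := exists_glue isOpen_Ioo isOpen_Ioo
        ((Ioo_inter_Ioo (a₁ := -T)).symm ▸ isPreconnected_Ioo) hg₂' hg₃
        ⟨hl, by linarith, by linarith⟩ hc₃
      refine ⟨c₄, ?_, fun t ht => hg₄ t ?_⟩
      · rw [velocity_congr (heq₄.eventuallyEq_of_mem (Ioo_mem_nhds h0'.1 h0'.2)), hc₂0]
      · have e1 : ((n + 1 : ℕ) : ℝ) * (δ / 2) + δ = T + δ / 2 := by
          push_cast
          rw [hT]
          ring
        rw [e1] at ht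
        by_cases h : -T < t
        · exact Or.inl ⟨h, ht.2⟩
        · exact Or.inr ⟨by linarith [ht.1], by linarith [not_lt.1 h]⟩
  obtain ⟨n, hn⟩ := exists_nat_gt (T / (δ / 2))
  obtain ⟨c, hc0, hc⟩ := key n
  refine ⟨c, hc0, fun t ht => hc t ?_⟩
  rw [div_lt_iff₀ (by positivity)] at hn
  exact ⟨by linarith [ht.1], by linarith [ht.2]⟩

/-- Geodesics of a Finsler metric on a compact manifold are complete. -/
theorem exists_geodesic [CompactSpace M] [T2Space M] {v : TangentBundle 𝓘(ℝ, E) M}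
    (hv : F.toFun v = 1) : ∃ c : ℝ → M, velocity E c 0 = v ∧ ∀ t, F.IsGeodesicAt c t := by
  choose c hc0 hc using fun n : ℕ => F.exists_geodesic_ball hv (n + 1)
  have hmono : ∀ m n : ℕ, m ≤ n → EqOn (c m) (c n) (Ioo (-(m + 1 : ℝ)) (m + 1)) := by
    intro m n hmn
    have hmn' : (m : ℝ) ≤ n := Nat.cast_le.2 hmn
    exact eqOn_of_velocity_eq isOpen_Ioo isPreconnected_Ioo (hc m)
      (fun t ht => hc n t ⟨by linarith [ht.1], by linarith [ht.2]⟩)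
      (t₀ := 0) ⟨by linarith [m.cast_nonneg (α := ℝ)], by linarith [m.cast_nonneg (α := ℝ)]⟩
      (by rw [hc0, hc0])
  have hlocal : ∀ n : ℕ, ∀ t ∈ Ioo (-(n : ℝ)) n, c ⌈|t|⌉₊ t = c n t := by
    intro n t ht
    refine hmono _ n (Nat.ceil_le.2 (abs_lt.2 ht).le) ?_
    refine abs_lt.1 ?_
    linarith [Nat.le_ceil |t|]
  refine ⟨fun t => c ⌈|t|⌉₊ t, ?_, fun t => ?_⟩
  · rw [← hc0 1]
    refine velocity_congr ?_
    filter_upwards [Ioo_mem_nhds (show -((1 : ℕ) : ℝ) < 0 by simp) (show 0 < ((1 : ℕ) : ℝ) by simp)]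
      with s hs using hlocal 1 s hs
  · obtain ⟨n, hn⟩ := exists_nat_gt |t|
    rw [abs_lt] at hn
    refine (hc n t ⟨by linarith [hn.1], by linarith [hn.2]⟩).congr ?_
    filter_upwards [Ioo_mem_nhds hn.1 hn.2] with s hs using (hlocal n s hs).symm

variable {F} in
/-- The geodesic flow moves along geodesics. -/
theorem geodesicFlow_eq_velocity [T2Space M] (hc : ∀ t, F.IsGeodesicAt c t) {v : F.UnitBundle}
    (hv : velocity E c 0 = v) (t : ℝ) :
    (F.geodesicFlow t v : TangentBundle 𝓘(ℝ, E) M) = velocity E c t := by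
  have hunit : ∀ t, F.toFun (velocity E c t) = 1 := by
    intro t
    rw [toFun_velocity_eq isOpen_univ isPreconnected_univ (fun t _ => hc t) (mem_univ t)
      (mem_univ 0), hv, v.2]
  have h : ∃ σ : ℝ → F.UnitBundle, F.IsGeodesicLift σ ∧ σ 0 = v :=
    ⟨fun t => ⟨velocity E c t, hunit t⟩, ⟨c, isGeodesic_of_forall hc, fun t => rfl⟩,
      Subtype.ext hv⟩
  have h1 : F.geodesicFlow t v = h.choose t := by
    rw [geodesicFlow, dif_pos h]
  obtain ⟨⟨c', hc', hσ⟩, h0⟩ := h.choose_spec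
  have hgeo : ∀ t, F.IsGeodesicAt c' t := hc'.isGeodesicAt fun s => by
    rw [← hσ, (h.choose s).2]
    norm_num
  have heq : c' = c := funext fun s => eqOn_of_velocity_eq isOpen_univ isPreconnected_univ
    (fun t _ => hgeo t) (fun t _ => hc t) (mem_univ 0) (by rw [← hσ, h0, hv]) (mem_univ s)
  rw [h1, hσ, heq]

end FinslerMetric

/-! ### Homotopy classes of parametrized curves -/

section HomotopyClass

open unitInterval

variable {M : Type*} [TopologicalSpace M]

/-- The affine path from `a` to `b` on the line. -/
def segmentPath (a b : ℝ) : Path a b where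
  toFun s := a + s * (b - a)
  continuous_toFun := by fun_prop
  source' := by simp
  target' := by simp

theorem segmentPath_mem {a b : ℝ} (hab : a ≤ b) (s : I) : segmentPath a b s ∈ Icc a b := by
  change a + (s : ℝ) * (b - a) ∈ Icc a b
  have h1 : 0 ≤ (s : ℝ) * (b - a) := mul_nonneg s.2.1 (sub_nonneg.2 hab)
  have h2 : (s : ℝ) * (b - a) ≤ 1 * (b - a) := mul_le_mul_of_nonneg_right s.2.2 (sub_nonneg.2 hab)
  exact ⟨by linarith, by linarith⟩

/-- The restriction to `[a, b]` of the curve `c` represents the homotopy class `q`. -/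
def RepresentsOn (c : ℝ → M) (a b : ℝ) {x y : M} (q : Path.Homotopic.Quotient x y) : Prop :=
  ∃ p : Path x y, Path.Homotopic.Quotient.mk p = q ∧ ∃ θ : Path a b, ∀ s, p s = c (θ s)

namespace RepresentsOn

variable {c c' : ℝ → M} {a b d : ℝ} {x y z : M}

theorem of_path (p : Path x y) (θ : Path a b) (h : ∀ s, p s = c (θ s)) :
    RepresentsOn c a b (Path.Homotopic.Quotient.mk p) := ⟨p, rfl, θ, h⟩

theorem left_eq {q : Path.Homotopic.Quotient x y} (h : RepresentsOn c a b q) : c a = x := by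
  obtain ⟨p, -, θ, h⟩ := h
  simpa using (h 0).symm

theorem right_eq {q : Path.Homotopic.Quotient x y} (h : RepresentsOn c a b q) : c b = y := by
  obtain ⟨p, -, θ, h⟩ := h
  simpa using (h 1).symm

/-- The path that is traced out by `c` on `[a, b]`. -/
def tracePath (hc : Continuous c) (a b : ℝ) : Path (c a) (c b) := (segmentPath a b).map hc

theorem of_continuous (hc : Continuous c) (a b : ℝ) :
    RepresentsOn c a b (Path.Homotopic.Quotient.mk (tracePath hc a b)) :=
  of_path _ (segmentPath a b) fun _ => rfl

theorem unique (hc : Continuous c) {q q' : Path.Homotopic.Quotient x y}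
    (h : RepresentsOn c a b q) (h' : RepresentsOn c a b q') : q = q' := by
  obtain rfl := h.left_eq
  obtain rfl := h.right_eq
  obtain ⟨p, rfl, θ, h⟩ := h
  obtain ⟨p', rfl, θ', h'⟩ := h'
  obtain rfl : p = θ.map hc := Path.ext (funext h)
  obtain rfl : p' = θ'.map hc := Path.ext (funext h')
  exact Path.Homotopic.Quotient.eq.2
    ((SimplyConnectedSpace.paths_homotopic θ θ').map ⟨c, hc⟩)

theorem trans {q : Path.Homotopic.Quotient x y} {q' : Path.Homotopic.Quotient y z}
    (h : RepresentsOn c a b q) (h' : RepresentsOn c b d q') :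
    RepresentsOn c a d (q.trans q') := by
  obtain ⟨p, rfl, θ, h⟩ := h
  obtain ⟨p', rfl, θ', h'⟩ := h'
  refine ⟨p.trans p', Path.Homotopic.Quotient.mk_trans _ _, θ.trans θ', fun s => ?_⟩
  rw [Path.trans_apply, Path.trans_apply]
  split_ifs
  · exact h _
  · exact h' _

theorem of_comp {f : ℝ → ℝ} (hf : Continuous f) {q : Path.Homotopic.Quotient x y}
    (h : RepresentsOn (fun t => c (f t)) a b q) : RepresentsOn c (f a) (f b) q := by
  obtain ⟨p, rfl, θ, h⟩ := h
  exact ⟨p, rfl, θ.map hf, h⟩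

theorem comp (hc : Continuous c) {f : ℝ → ℝ} (hf : Continuous f)
    {q : Path.Homotopic.Quotient x y} (h : RepresentsOn c (f a) (f b) q) :
    RepresentsOn (fun t => c (f t)) a b q := by
  obtain rfl := h.left_eq
  obtain rfl := h.right_eq
  have h1 := of_continuous (hc.comp hf) a b
  have h2 : RepresentsOn c (f a) (f b) _ := of_comp hf h1
  rw [unique hc h h2]
  exact h1

theorem exists_trace (hc : Continuous c) (hab : a ≤ b) {q : Path.Homotopic.Quotient x y}
    (h : RepresentsOn c a b q) :
    ∃ p : Path x y, Path.Homotopic.Quotient.mk p = q ∧ ∃ θ : I → ℝ, (∀ s, θ s ∈ Icc a b) ∧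
      (∀ s, p s = c (θ s)) ∧ θ = segmentPath a b := by
  obtain rfl := h.left_eq
  obtain rfl := h.right_eq
  exact ⟨tracePath hc a b, unique hc (of_continuous hc a b) h, segmentPath a b,
    segmentPath_mem hab, fun s => rfl, rfl⟩

theorem congr (hc : Continuous c) (hab : a ≤ b) {q : Path.Homotopic.Quotient x y}
    (h : RepresentsOn c a b q) (heq : EqOn c c' (Icc a b)) : RepresentsOn c' a b q := by
  obtain ⟨p, rfl, θ, h1, h2, rfl⟩ := h.exists_trace hc hab
  exact of_path p (segmentPath a b) fun s => (h2 s).trans (heq (h1 s))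

theorem of_const (hab : a ≤ b) (h : ∀ t ∈ Icc a b, c t = x) :
    RepresentsOn c a b (Path.Homotopic.Quotient.refl x) :=
  of_path (Path.refl x) (segmentPath a b) fun s => (h _ (segmentPath_mem hab s)).symm

theorem split (hc : Continuous c) (b : ℝ) {q : Path.Homotopic.Quotient x y}
    (h : RepresentsOn c a d q) : ∃ (q₁ : Path.Homotopic.Quotient x (c b))
      (q₂ : Path.Homotopic.Quotient (c b) y), RepresentsOn c a b q₁ ∧ RepresentsOn c b d q₂ ∧
        q = q₁.trans q₂ := by
  obtain rfl := h.left_eq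
  obtain rfl := h.right_eq
  exact ⟨_, _, of_continuous hc a b, of_continuous hc b d,
    unique hc h ((of_continuous hc a b).trans (of_continuous hc b d))⟩

/-- A homotopy in a convex piece of a chart. -/
theorem of_chart {E : Type*} [NormedAddCommGroup E] [NormedSpace ℝ E]
    {e : OpenPartialHomeomorph M E} {B : Set E} (hB : Convex ℝ B) (hBe : B ⊆ e.target)
    {p p' : Path x y} (hp : ∀ s, p s ∈ e.source ∧ e (p s) ∈ B)
    (hp' : ∀ s, p' s ∈ e.source ∧ e (p' s) ∈ B) : p.Homotopic p' := by
  have hcp : Continuous fun s => e (p s) := by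
    rw [continuous_iff_continuousAt]
    exact fun s => ContinuousAt.comp (g := e) (e.continuousAt (hp s).1) p.continuous.continuousAt
  have hcp' : Continuous fun s => e (p' s) := by
    rw [continuous_iff_continuousAt]
    exact fun s => ContinuousAt.comp (g := e) (e.continuousAt (hp' s).1) p'.continuous.continuousAt
  refine ⟨{ toFun := fun z => e.symm ((1 - (z.1 : ℝ)) • e (p z.2) + (z.1 : ℝ) • e (p' z.2)),
            continuous_toFun := ?_, map_zero_left := ?_, map_one_left := ?_, prop' := ?_ }⟩
  · refine e.continuousOn_symm.comp_continuous ?_ fun z => hBe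
      (hB (hp z.2).2 (hp' z.2).2 (sub_nonneg.2 z.1.2.2) z.1.2.1 (by ring))
    exact ((continuous_const.sub (continuous_subtype_val.comp continuous_fst)).smul
      (hcp.comp continuous_snd)).add ((continuous_subtype_val.comp continuous_fst).smul
        (hcp'.comp continuous_snd))
  · intro s
    simp [e.left_inv (hp s).1]
  · intro s
    simp [e.left_inv (hp' s).1]
  · rintro s t (rfl | ht)
    · have h := hp 0
      simp only [Path.source] at h
      simp [← add_smul, e.left_inv h.1]
    · obtain rfl : t = 1 := ht
      have h := hp 1
      simp only [Path.target] at h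
      simp [← add_smul, e.left_inv h.1]

/-- Two curves that agree at the endpoints and stay in a convex piece of a chart represent the same
classes. -/
theorem congr_of_chart {E : Type*} [NormedAddCommGroup E] [NormedSpace ℝ E]
    {e : OpenPartialHomeomorph M E} {B : Set E} (hB : Convex ℝ B) (hBe : B ⊆ e.target)
    (hc : Continuous c) (hc' : Continuous c') (hab : a ≤ b) {q : Path.Homotopic.Quotient x y}
    (h : RepresentsOn c a b q) (hm : ∀ t ∈ Icc a b, c t ∈ e.source ∧ e (c t) ∈ B)
    (hm' : ∀ t ∈ Icc a b, c' t ∈ e.source ∧ e (c' t) ∈ B) (ha : c a = c' a) (hb : c b = c' b) :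
    RepresentsOn c' a b q := by
  obtain ⟨p, rfl, θ, h1, h2, rfl⟩ := h.exists_trace hc hab
  obtain rfl : c' a = x := ha.symm.trans h.left_eq
  obtain rfl : c' b = y := hb.symm.trans h.right_eq
  have h3 : p.Homotopic (tracePath hc' a b) := of_chart hB hBe
    (fun s => by rw [h2]; exact hm _ (h1 s)) fun s => hm' _ (segmentPath_mem hab s)
  rw [Path.Homotopic.Quotient.eq.2 h3]
  exact of_continuous hc' a b

/-- Replacing a piece of a curve by a piece of the same class. -/
theorem replace (hc : Continuous c) {a' b' : ℝ} (h1 : a ≤ a') (h2 : a' ≤ b')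
    (h3 : b' ≤ b) {q : Path.Homotopic.Quotient x y} (h : RepresentsOn c a b q)
    (heq : ∀ t ∈ Icc a b, t ∉ Ioo a' b' → c t = c' t)
    (hmid : ∀ q : Path.Homotopic.Quotient (c a') (c b'), RepresentsOn c a' b' q →
      RepresentsOn c' a' b' q) : RepresentsOn c' a b q := by
  obtain ⟨q₁, q₂, g₁, g₂, rfl⟩ := h.split hc a'
  obtain ⟨q₂, q₃, g₂', g₃, rfl⟩ := g₂.split hc b'
  refine (g₁.congr hc h1 fun t ht => heq t ⟨ht.1, ht.2.trans (h2.trans h3)⟩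
    fun h => h.1.not_ge ht.2).trans ((hmid _ g₂').trans (g₃.congr hc h3 fun t ht =>
      heq t ⟨(h1.trans h2).trans ht.1, ht.2⟩ fun h => h.2.not_ge ht.1))

end RepresentsOn

end HomotopyClass

section CloseCurves

open unitInterval

/-- In a compact locally path connected metric space nearby points are joined by short paths. -/
theorem exists_path_mem_ball {M : Type*} [MetricSpace M] [CompactSpace M]
    [LocallyPathConnectedSpace M] {ε : ℝ} (hε : 0 < ε) :
    ∃ η > 0, ∀ z w : M, dist z w < η → ∃ p : Path z w, ∀ s, p s ∈ ball z ε := by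
  have h : ∀ x : M, ∃ W : Set M, IsOpen W ∧ x ∈ W ∧ IsPathConnected W ∧ W ⊆ ball x (ε / 2) := by
    intro x
    obtain ⟨W, ⟨h1, h2, h3⟩, h4⟩ := (isOpen_isPathConnected_basis x).mem_iff.1
      (ball_mem_nhds x (half_pos hε))
    exact ⟨W, h1, h2, h3, h4⟩
  choose W hWo hxW hWc hWb using h
  obtain ⟨η, hη, hleb⟩ := lebesgue_number_lemma_of_metric isCompact_univ hWo
    (fun x _ => mem_iUnion.2 ⟨x, hxW x⟩)
  refine ⟨η, hη, fun z w hzw => ?_⟩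
  obtain ⟨x, hx⟩ := hleb z trivial
  have hz : z ∈ W x := hx (mem_ball_self hη)
  obtain ⟨p, hp⟩ := (hWc x).joinedIn z hz w (hx (by rwa [mem_ball, dist_comm]))
  refine ⟨p, fun s => ?_⟩
  have h1 := hWb x (hp s)
  have h2 := hWb x hz
  rw [mem_ball] at *
  rw [dist_comm] at h2
  linarith [dist_triangle (p s) x z]

/-- Curves with the same endpoints that are uniformly close are homotopic. -/
theorem RepresentsOn.of_dist_lt {M : Type*} [MetricSpace M] {ε η : ℝ} (hε : 0 < ε) (hηε : η ≤ ε)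
    (hhom : ∀ (z x y : M) (p q : Path x y), (∀ s, p s ∈ ball z (4 * ε)) →
      (∀ s, q s ∈ ball z (4 * ε)) → p.Homotopic q)
    (hjoin : ∀ z w : M, dist z w < η → ∃ p : Path z w, ∀ s, p s ∈ ball z (3 * ε))
    {p q : ℝ → M} (hp : Continuous p) (hq : Continuous q) {a b : ℝ} (hab : a ≤ b)
    (hpq : ∀ t ∈ Icc a b, dist (p t) (q t) < η) {x y : M} {α β : Path.Homotopic.Quotient x y}
    (hα : RepresentsOn p a b α) (hβ : RepresentsOn q a b β) : α = β := by
  obtain ⟨δ, hδ, hunif⟩ := Metric.uniformContinuousOn_iff.1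
    (isCompact_Icc.uniformContinuousOn_of_continuous hp.continuousOn (s := Icc a b)) ε hε
  obtain ⟨n, hn⟩ := exists_nat_gt ((b - a) / δ)
  have hba : 0 ≤ b - a := sub_nonneg.2 hab
  have hn0 : (0 : ℝ) < n := (div_nonneg hba hδ.le).trans_lt hn
  set τ : ℕ → ℝ := fun i => a + i * ((b - a) / n) with hτ
  have hstep : (b - a) / n < δ := by
    rw [div_lt_iff₀ hδ] at hn
    rw [div_lt_iff₀ hn0]
    linarith
  have hstep0 : 0 ≤ (b - a) / n := by positivity
  have hτs : ∀ i, τ (i + 1) = τ i + (b - a) / n := fun i => by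
    simp only [hτ]
    push_cast
    ring
  have hτn : τ n = b := by
    simp only [hτ]
    field_simp
    ring
  have hτmem : ∀ i ≤ n, τ i ∈ Icc a b := by
    intro i hi
    have h1 : (i : ℝ) * ((b - a) / n) ≤ n * ((b - a) / n) :=
      mul_le_mul_of_nonneg_right (Nat.cast_le.2 hi) hstep0
    have h2 : (n : ℝ) * ((b - a) / n) = b - a := by field_simp
    have h3 : 0 ≤ (i : ℝ) * ((b - a) / n) := by positivity
    exact ⟨by simp only [hτ]; linarith, by simp only [hτ]; linarith⟩
  have key : ∀ i ≤ n, ∀ (u w : M) (m : Path u w), (∀ s, m s ∈ ball u (3 * ε)) →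
      ∀ (α : Path.Homotopic.Quotient x u) (β : Path.Homotopic.Quotient x w),
      RepresentsOn p a (τ i) α → RepresentsOn q a (τ i) β →
      α.trans (Path.Homotopic.Quotient.mk m) = β := by
    intro i
    induction i with
    | zero =>
      intro _ u w m hm α' β' hα' hβ'
      have h0 : τ 0 = a := by simp [hτ]
      rw [h0] at hα' hβ'
      obtain rfl : u = x := hα'.right_eq.symm.trans hα'.left_eq
      obtain rfl : w = u := hβ'.right_eq.symm.trans hβ'.left_eq
      have hm' : m.Homotopic (Path.refl w) :=
        hhom w w w m _ (fun s => ball_subset_ball (by linarith) (hm s))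
          fun s => mem_ball_self (by linarith)
      have h1 : α' = .refl w := hα'.unique hp (.of_const le_rfl fun t ht => by
        rw [← hα'.left_eq, le_antisymm ht.2 ht.1])
      have h2 : β' = .refl w := hβ'.unique hq (.of_const le_rfl fun t ht => by
        rw [← hβ'.left_eq, le_antisymm ht.2 ht.1])
      rw [h1, h2, Path.Homotopic.Quotient.eq.2 hm', Path.Homotopic.Quotient.mk_refl,
        Path.Homotopic.Quotient.trans_refl]
    | succ i ih =>
      intro hi u w m' hm' α' β' hα' hβ'
      obtain rfl := hα'.right_eq
      obtain rfl := hβ'.right_eq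
      have hi' : i ≤ n := (Nat.le_succ i).trans hi
      have ht := hτmem i hi'
      have ht' := hτmem (i + 1) hi
      obtain ⟨m, hm⟩ := hjoin _ _ (hpq _ ht)
      obtain ⟨α, α₁, hα, hα₁, rfl⟩ := hα'.split hp (τ i)
      obtain ⟨β, β₁, hβ, hβ₁, rfl⟩ := hβ'.split hq (τ i)
      have hle : τ i ≤ τ (i + 1) := by linarith [hτs i]
      obtain ⟨r, rfl, θ, hθ, hr, -⟩ := hα₁.exists_trace hp hle
      obtain ⟨r', rfl, θ', hθ', hr', -⟩ := hβ₁.exists_trace hq hle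
      have hclose : ∀ t ∈ Icc (τ i) (τ (i + 1)), dist (p t) (p (τ i)) < ε := by
        intro t htt
        refine hunif t ⟨ht.1.trans htt.1, htt.2.trans ht'.2⟩ _ ht ?_
        rw [Real.dist_eq, abs_of_nonneg (sub_nonneg.2 htt.1)]
        linarith [htt.2, hτs i]
      have hsq : (r.trans m').Homotopic (m.trans r') := by
        refine hhom (p (τ i)) _ _ _ _ (fun s => ?_) fun s => ?_
        · rw [Path.trans_apply]
          split_ifs
          · rw [hr, mem_ball]
            linarith [hclose _ (hθ ⟨2 * (s : ℝ), (unitInterval.mul_pos_mem_iff zero_lt_two).2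
              ⟨s.2.1, by assumption⟩⟩)]
          · rw [mem_ball]
            have h1 := hm' ⟨2 * (s : ℝ) - 1, unitInterval.two_mul_sub_one_mem_iff.2
              ⟨(not_le.1 (by assumption)).le, s.2.2⟩⟩
            have h2 := hclose (τ (i + 1)) ⟨hle, le_rfl⟩
            rw [mem_ball] at h1
            linarith [dist_triangle (m' ⟨2 * (s : ℝ) - 1, unitInterval.two_mul_sub_one_mem_iff.2
              ⟨(not_le.1 (by assumption)).le, s.2.2⟩⟩) (p (τ (i + 1))) (p (τ i))]
        · rw [Path.trans_apply]
          split_ifs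
          · exact ball_subset_ball (by linarith) (hm _)
          · rw [hr', mem_ball]
            set t := θ' ⟨2 * (s : ℝ) - 1, unitInterval.two_mul_sub_one_mem_iff.2
              ⟨(not_le.1 (by assumption)).le, s.2.2⟩⟩ with htdef
            have h0 : t ∈ Icc (τ i) (τ (i + 1)) := hθ' _
            have h1 := hclose t h0
            have h2 := hpq t ⟨ht.1.trans h0.1, h0.2.trans ht'.2⟩
            rw [dist_comm] at h2
            linarith [dist_triangle (q t) (p t) (p (τ i))]
      have h1 := ih hi' _ _ m hm α β hα hβ
      rw [Path.Homotopic.Quotient.trans_assoc, ← Path.Homotopic.Quotient.mk_trans,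
        Path.Homotopic.Quotient.eq.2 hsq, Path.Homotopic.Quotient.mk_trans,
        ← Path.Homotopic.Quotient.trans_assoc, h1]
  have h := key n le_rfl y y (Path.refl y) (fun s => mem_ball_self (by linarith)) α β
    (by rwa [hτn]) (by rwa [hτn])
  rwa [Path.Homotopic.Quotient.mk_refl, Path.Homotopic.Quotient.trans_refl] at h

/-- On a compact manifold, curves with the same endpoints that are uniformly close are
homotopic. -/
theorem exists_nhdsSet_diagonal_homotopic (E : Type*) [NormedAddCommGroup E] [NormedSpace ℝ E]
    [FiniteDimensional ℝ E] (M : Type*) [TopologicalSpace M] [ChartedSpace E M] [T2Space M]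
    [CompactSpace M] : ∃ N ∈ 𝓝ˢ (diagonal M), ∀ (p q : ℝ → M) (a b : ℝ), Continuous p →
      Continuous q → a ≤ b → (∀ t ∈ Icc a b, (p t, q t) ∈ N) →
      ∀ (x y : M) (α β : Path.Homotopic.Quotient x y), RepresentsOn p a b α →
        RepresentsOn q a b β → α = β := by
  have : TopologicalSpace.MetrizableSpace M := Manifold.metrizableSpace 𝓘(ℝ, E) M
  let _ := TopologicalSpace.metrizableSpaceMetric M
  have : LocallyPathConnectedSpace M := ChartedSpace.locallyPathConnectedSpace E M
  have h : ∀ x : M, ∃ R > 0, closedBall (chartAt E x x) R ⊆ (chartAt E x).target := fun x =>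
    Metric.nhds_basis_closedBall.mem_iff.1
      ((chartAt E x).open_target.mem_nhds (mem_chart_target E x))
  choose R hR hRt using h
  obtain ⟨ε, hε, hleb⟩ := lebesgue_number_lemma_of_metric (s := (univ : Set M)) isCompact_univ
    (c := fun x => (chartAt E x).source ∩ chartAt E x ⁻¹' ball (chartAt E x x) (R x))
    (fun x => (chartAt E x).isOpen_inter_preimage isOpen_ball)
    (fun x _ => mem_iUnion.2 ⟨x, mem_chart_source E x, mem_ball_self (hR x)⟩)
  obtain ⟨η, hη, hjoin⟩ := exists_path_mem_ball (M := M) (ε := 3 * (ε / 4)) (by positivity)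
  refine ⟨{z | dist z.1 z.2 < min η (ε / 4)}, ?_, ?_⟩
  · have ho : IsOpen {z : M × M | dist z.1 z.2 < min η (ε / 4)} :=
      isOpen_lt continuous_dist continuous_const
    refine ho.mem_nhdsSet.2 ?_
    rintro ⟨x, y⟩ (rfl : x = y)
    simp [hη, hε]
  · intro p q a b hp hq hab hpq x y α β hα hβ
    refine RepresentsOn.of_dist_lt (ε := ε / 4) (by positivity) (min_le_right η _) ?_
      (fun z w hzw => hjoin z w (hzw.trans_le (min_le_left _ _))) hp hq hab hpq hα hβ
    intro z x y p q hp hq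
    obtain ⟨i, hi⟩ := hleb z trivial
    rw [show 4 * (ε / 4) = ε by ring] at hp hq
    exact RepresentsOn.of_chart (convex_ball (chartAt E i i) (R i))
      (ball_subset_closedBall.trans (hRt i)) (fun s => hi (hp s)) fun s => hi (hq s)

end CloseCurves

/-! ### The energy of curves -/

section Admissible

variable {M : Type*}

/-- The curve that follows `c` up to time `a` and `c'` afterwards. -/
def joinAt (a : ℝ) (c c' : ℝ → M) (t : ℝ) : M := if t ≤ a then c t else c' t

variable {a t : ℝ} {c c' : ℝ → M}

theorem joinAt_of_le (h : t ≤ a) : joinAt a c c' t = c t := if_pos h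

theorem joinAt_of_lt (h : a < t) : joinAt a c c' t = c' t := if_neg h.not_ge

theorem joinAt_of_ge (hcc : c a = c' a) (h : a ≤ t) : joinAt a c c' t = c' t := by
  rcases h.eq_or_lt with rfl | h
  · rw [joinAt_of_le le_rfl, hcc]
  · exact joinAt_of_lt h

theorem joinAt_eventuallyEq_left (h : t < a) : c =ᶠ[𝓝 t] joinAt a c c' := by
  filter_upwards [Iio_mem_nhds h] with s hs using (joinAt_of_le (mem_Iio.1 hs).le).symm

theorem joinAt_eventuallyEq_right (h : a < t) : c' =ᶠ[𝓝 t] joinAt a c c' := by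
  filter_upwards [Ioi_mem_nhds h] with s hs using (joinAt_of_lt hs).symm

variable [TopologicalSpace M]

theorem continuous_joinAt (hc : Continuous c) (hc' : Continuous c') (h : c a = c' a) :
    Continuous (joinAt a c c') :=
  hc.if_le hc' continuous_id continuous_const fun t ht => by
    obtain rfl : t = a := ht
    exact h

variable {E : Type*} [NormedAddCommGroup E] [NormedSpace ℝ E] [ChartedSpace E M]

variable (E) in
/-- Continuous curves that are differentiable off a countable set. -/
structure IsAdmissible (c : ℝ → M) : Prop where
  continuous : Continuous c
  exists_countable : ∃ s : Set ℝ, s.Countable ∧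
    ∀ t ∉ s, MDifferentiableAt 𝓘(ℝ, ℝ) 𝓘(ℝ, E) c t

theorem IsAdmissible.joinAt (hc : IsAdmissible E c) (hc' : IsAdmissible E c') (h : c a = c' a) :
    IsAdmissible E (joinAt a c c') := by
  obtain ⟨s, hs, hd⟩ := hc.exists_countable
  obtain ⟨s', hs', hd'⟩ := hc'.exists_countable
  refine ⟨continuous_joinAt hc.continuous hc'.continuous h, insert a (s ∪ s'),
    (hs.union hs').insert a, fun t ht => ?_⟩
  simp only [mem_insert_iff, mem_union, not_or] at ht
  rcases lt_or_gt_of_ne ht.1 with h1 | h1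
  · exact (hd t ht.2.1).congr_of_eventuallyEq (joinAt_eventuallyEq_left h1).symm
  · exact (hd' t ht.2.2).congr_of_eventuallyEq (joinAt_eventuallyEq_right h1).symm

theorem IsAdmissible.comp_add_const (hc : IsAdmissible E c) (a : ℝ) :
    IsAdmissible E (fun t => c (t + a)) := by
  obtain ⟨s, hs, hd⟩ := hc.exists_countable
  refine ⟨hc.continuous.comp (continuous_add_const a), (fun t => t + a) ⁻¹' s,
    hs.preimage (add_left_injective a), fun t ht => ?_⟩
  have h1 : MDifferentiableAt 𝓘(ℝ, ℝ) 𝓘(ℝ, ℝ) (fun t : ℝ => t + a) t :=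
    (differentiableAt_id.add_const a).mdifferentiableAt
  exact (hd _ ht).comp t h1

end Admissible

namespace FinslerMetric

variable {E : Type*} [NormedAddCommGroup E] [NormedSpace ℝ E]
  {M : Type*} [TopologicalSpace M] [ChartedSpace E M] [IsManifold 𝓘(ℝ, E) ∞ M]
  (F : FinslerMetric E M) {e : OpenPartialHomeomorph M E} {c c' : ℝ → M} {a b d : ℝ}

/-- The energy of a curve over a time interval. -/
def energy (c : ℝ → M) (a b : ℝ) : ℝ≥0∞ :=
  ∫⁻ t in Ioc a b, ENNReal.ofReal ((1 / 2 : ℝ) * F.toFun (velocity E c t) ^ 2)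

theorem energy_add (h : a ≤ b) (h' : b ≤ d) :
    F.energy c a b + F.energy c b d = F.energy c a d := by
  rw [energy, energy, energy, ← Ioc_union_Ioc_eq_Ioc h h',
    lintegral_union measurableSet_Ioc (Ioc_disjoint_Ioc_of_le le_rfl)]

theorem energy_mono {a' b' : ℝ} (h : a ≤ a') (h' : b' ≤ b) :
    F.energy c a' b' ≤ F.energy c a b :=
  lintegral_mono_set (Ioc_subset_Ioc h h')

theorem energy_congr (h : ∀ t ∈ Ioo a b, c =ᶠ[𝓝 t] c') : F.energy c a b = F.energy c' a b := by
  rw [energy, energy, ← Measure.restrict_congr_set Ioo_ae_eq_Ioc]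
  exact setLIntegral_congr_fun measurableSet_Ioo fun t ht => by
    simp only [velocity_congr (h t ht)]

theorem energy_comp_add_const (hc : IsAdmissible E c) (a b d : ℝ) :
    F.energy (fun t => c (t + d)) a b = F.energy c (a + d) (b + d) := by
  have h := (measurePreserving_add_right volume d).setLIntegral_comp_preimage_emb
    (measurableEmbedding_addRight d)
    (fun t => ENNReal.ofReal ((1 / 2 : ℝ) * F.toFun (velocity E c t) ^ 2)) (Ioc (a + d) (b + d))
  rw [energy, energy, ← h]
  have h1 : (fun t => t + d) ⁻¹' Ioc (a + d) (b + d) = Ioc a b := by simp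
  rw [h1]
  obtain ⟨s, hs, hd⟩ := hc.exists_countable
  refine setLIntegral_congr_fun_ae measurableSet_Ioc ?_
  have h2 : ((fun t => t + d) ⁻¹' s).Countable := hs.preimage (add_left_injective d)
  filter_upwards [compl_mem_ae_iff.2 (h2.measure_zero volume)] with t ht _
  rw [velocity_comp_add_const rfl (hd _ ht)]

variable {F}

theorem half_sq_velocity_of_continuousAt (he : e ∈ atlas E M) {t : ℝ}
    (hc : ContinuousAt c t) (ht : c t ∈ e.source) :
    (1 / 2 : ℝ) * F.toFun (velocity E c t) ^ 2
      = F.localLagrangian e (e (c t)) (deriv (fun s => e (c s)) t) := by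
  by_cases h : MDifferentiableAt 𝓘(ℝ, ℝ) 𝓘(ℝ, E) c t
  · exact F.half_sq_velocity he h ht
  · have h1 : velocity E c t = ⟨c t, 0⟩ := by
      refine Bundle.TotalSpace.ext rfl (heq_of_eq ?_)
      change mfderiv 𝓘(ℝ, ℝ) 𝓘(ℝ, E) c t (1 : ℝ) = _
      rw [mfderiv_zero_of_not_mdifferentiableAt h]
      rfl
    rw [h1, F.toFun_zero, deriv_zero_of_not_differentiableAt
      (fun h2 => h ((mdifferentiableAt_iff_chart he hc ht).2 h2)),
      (F.isFinslerLagrangian he).apply_zero (e.map_source ht)]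
    norm_num

theorem energy_eq_chart (he : e ∈ atlas E M) (hc : Continuous c)
    (h : ∀ t ∈ Icc a b, c t ∈ e.source) : F.energy c a b =
      ∫⁻ t in Ioc a b, ENNReal.ofReal
        (F.localLagrangian e (e (c t)) (deriv (fun s => e (c s)) t)) :=
  setLIntegral_congr_fun measurableSet_Ioc fun t ht => by
    simp only [half_sq_velocity_of_continuousAt he hc.continuousAt (h t (Ioc_subset_Icc_self ht))]

theorem _root_.IsAdmissible.exists_countable_chart (he : e ∈ atlas E M) (hc : IsAdmissible E c)
    (h : ∀ t ∈ Icc a b, c t ∈ e.source) : ∃ s : Set ℝ, s.Countable ∧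
      ∀ t ∈ Ioo a b \ s, DifferentiableAt ℝ (fun t => e (c t)) t := by
  obtain ⟨s, hs, hd⟩ := hc.exists_countable
  exact ⟨s, hs, fun t ht => (mdifferentiableAt_iff_chart he hc.continuous.continuousAt
    (h t (Ioo_subset_Icc_self ht.1))).1 (hd t ht.2)⟩

/-- Displacement in a chart is bounded by the energy. -/
theorem sq_norm_chart_sub_le [FiniteDimensional ℝ E] (he : e ∈ atlas E M) (hc : IsAdmissible E c)
    {y₀ : E} {R m : ℝ} (hm : 0 < m) (hbound : ∀ y ∈ closedBall y₀ R, ∀ w, m * ‖w‖ ^ 2 ≤ F.localLagrangian e y w)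
    (hab : a < b) (h : ∀ t ∈ Icc a b, c t ∈ e.source ∧ e (c t) ∈ closedBall y₀ R) :
    ENNReal.ofReal (m * ‖e (c b) - e (c a)‖ ^ 2 / (b - a)) ≤ F.energy c a b := by
  rw [energy_eq_chart he hc.continuous fun t ht => (h t ht).1]
  obtain ⟨s, hs, hd⟩ := hc.exists_countable_chart he fun t ht => (h t ht).1
  exact sq_norm_sub_le_energy (u := fun t => e (c t)) hab hm
    (fun t ht => hbound _ (h t (Ioc_subset_Icc_self ht)).2 _)
    (e.continuousOn.comp hc.continuous.continuousOn fun t ht => (h t ht).1) hs hd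

end FinslerMetric

section Exit

variable {E : Type*} [NormedAddCommGroup E] [NormedSpace ℝ E] [FiniteDimensional ℝ E]
  {M : Type*} [TopologicalSpace M] [T2Space M]

theorem mem_closedBall_of_displacement_right {e : OpenPartialHomeomorph M E} {y₀ : E} {ρ : ℝ}
    (hρ : 0 < ρ)
    (hR : closedBall y₀ ρ ⊆ e.target) {c : ℝ → M} (hc : Continuous c) {a b : ℝ}
    (hdisp : ∀ t ∈ Icc a b, (∀ r ∈ Icc a t, c r ∈ e.source ∧ e (c r) ∈ closedBall y₀ ρ) →
      ‖e (c t) - e (c a)‖ < ρ / 2) (ha : c a ∈ e.source ∧ e (c a) ∈ closedBall y₀ (ρ / 2)) :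
    ∀ t ∈ Icc a b, c t ∈ e.source ∧ e (c t) ∈ closedBall y₀ ρ := by
  have : ProperSpace E := FiniteDimensional.proper_real E
  set G := e.source ∩ e ⁻¹' ball y₀ ρ with hG
  have hGo : IsOpen G := e.isOpen_inter_preimage isOpen_ball
  have hKc : IsClosed (e.symm '' closedBall y₀ ρ) :=
    ((isCompact_closedBall y₀ ρ).image_of_continuousOn (e.continuousOn_symm.mono hR)).isClosed
  have hGK : G ⊆ e.symm '' closedBall y₀ ρ := fun z hz =>
    ⟨e z, ball_subset_closedBall hz.2, e.left_inv hz.1⟩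
  have hK : ∀ z ∈ e.symm '' closedBall y₀ ρ, z ∈ e.source ∧ e z ∈ closedBall y₀ ρ := by
    rintro z ⟨y, hy, rfl⟩
    exact ⟨e.map_target (hR hy), by rwa [e.right_inv (hR hy)]⟩
  have hall : ∀ t ∈ Icc a b, c t ∈ G := by
    by_contra! hne
    obtain ⟨t₂, ht₂, hbad⟩ := hne
    have hcl : IsClosed (Icc a b ∩ c ⁻¹' Gᶜ) := isClosed_Icc.inter (hGo.isClosed_compl.preimage hc)
    have hcomp : IsCompact (Icc a b ∩ c ⁻¹' Gᶜ) :=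
      isCompact_Icc.of_isClosed_subset hcl inter_subset_left
    obtain ⟨t₁, ⟨ht₁, hb₁⟩, hmin⟩ := hcomp.exists_isLeast ⟨t₂, ht₂, hbad⟩
    have hlt : ∀ r ∈ Ico a t₁, c r ∈ G := by
      intro r hr
      by_contra h
      exact hr.2.not_ge (hmin ⟨⟨hr.1, hr.2.le.trans ht₁.2⟩, h⟩)
    have hat : a < t₁ := by
      rcases ht₁.1.eq_or_lt with h | h
      · exfalso
        apply hb₁
        rw [← h]
        exact ⟨ha.1, closedBall_subset_ball (by linarith) ha.2⟩
      · exact h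
    have ht₁K : c t₁ ∈ e.symm '' closedBall y₀ ρ := by
      have h1 : t₁ ∈ closure (Ico a t₁) := by
        rw [closure_Ico hat.ne]
        exact ⟨hat.le, le_rfl⟩
      have h2 : c '' Ico a t₁ ⊆ e.symm '' closedBall y₀ ρ :=
        image_subset_iff.2 fun r hr => hGK (hlt r hr)
      exact hKc.closure_subset_iff.2 h2 (image_closure_subset_closure_image hc ⟨t₁, h1, rfl⟩)
    have h2 := hdisp t₁ ht₁ fun r hr => by
      rcases hr.2.eq_or_lt with h | h
      · rw [h]
        exact hK _ ht₁K
      · exact hK _ (hGK (hlt r ⟨hr.1, h⟩))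
    refine hb₁ ⟨(hK _ ht₁K).1, ?_⟩
    have h3 := ha.2
    rw [mem_closedBall, dist_eq_norm] at h3
    change e (c t₁) ∈ ball y₀ ρ
    rw [mem_ball, dist_eq_norm]
    calc ‖e (c t₁) - y₀‖ ≤ ‖e (c t₁) - e (c a)‖ + ‖e (c a) - y₀‖ :=
          norm_sub_le_norm_sub_add_norm_sub _ _ _
      _ < ρ := by linarith
  exact fun t ht => hK _ (hGK (hall t ht))

theorem mem_closedBall_of_displacement {e : OpenPartialHomeomorph M E} {y₀ : E} {ρ : ℝ}
    (hρ : 0 < ρ) (hR : closedBall y₀ ρ ⊆ e.target) {c : ℝ → M} (hc : Continuous c) {a b t₀ : ℝ}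
    (ht₀ : t₀ ∈ Icc a b) (hdisp : ∀ s ∈ Icc a b, ∀ t ∈ Icc a b, s ≤ t →
      (∀ r ∈ Icc s t, c r ∈ e.source ∧ e (c r) ∈ closedBall y₀ ρ) → ‖e (c t) - e (c s)‖ < ρ / 2)
    (h₀ : c t₀ ∈ e.source ∧ e (c t₀) ∈ closedBall y₀ (ρ / 2)) :
    ∀ t ∈ Icc a b, c t ∈ e.source ∧ e (c t) ∈ closedBall y₀ ρ := by
  intro t ht
  rcases le_total t₀ t with h | h
  · exact mem_closedBall_of_displacement_right hρ hR hc (a := t₀) (b := b)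
      (fun s hs => hdisp t₀ ht₀ s ⟨ht₀.1.trans hs.1, hs.2⟩ hs.1) h₀ t ⟨h, ht.2⟩
  · have h1 := mem_closedBall_of_displacement_right hρ hR (c := fun s => c (-s))
      (hc.comp continuous_neg) (a := -t₀) (b := -a) (fun s hs hr => by
        rw [norm_sub_rev]
        refine hdisp (-s) ⟨by linarith [hs.2], by linarith [hs.1, ht₀.2]⟩ (- -t₀)
          (by simpa using ht₀) (by linarith [hs.1]) fun r hr' => ?_
        simpa using hr (-r) ⟨by linarith [hr'.2], by linarith [hr'.1]⟩) (by simpa using h₀) (-t)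
      ⟨by linarith, by linarith [ht.1]⟩
    simpa using h1

end Exit

/-! ### Minimizing sequences -/

/-- A property of intervals that is additive and holds for short intervals holds for all. -/
theorem interval_induction {P : ℝ → ℝ → Prop} {a b : ℝ} (hab : a < b)
    (hadd : ∀ r s t, a ≤ r → r < s → s < t → t ≤ b → P r s → P s t → P r t)
    (hloc : ∀ t ∈ Icc a b, ∃ δ > 0, ∀ r ∈ Icc a b, ∀ s ∈ Icc a b, r < s → |r - t| ≤ δ →
      |s - t| ≤ δ → P r s) : P a b := by
  choose! δ hδ hP using hloc
  obtain ⟨η, hη, hleb⟩ := lebesgue_number_lemma_of_metric (s := Icc a b)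
    (c := fun t : Icc a b => ball (t : ℝ) (δ t)) isCompact_Icc (fun _ => isOpen_ball)
    (fun t ht => mem_iUnion.2 ⟨⟨t, ht⟩, mem_ball_self (hδ t ht)⟩)
  have hshort : ∀ r ∈ Icc a b, ∀ s ∈ Icc a b, r < s → s - r < η → P r s := by
    intro r hr s hs hrs hlt
    obtain ⟨t, ht⟩ := hleb r hr
    refine hP t t.2 r hr s hs hrs ?_ ?_
    · exact (mem_ball.1 (ht (mem_ball_self hη))).le
    · refine (mem_ball.1 (ht ?_)).le
      rwa [mem_ball, Real.dist_eq, abs_of_pos (sub_pos.2 hrs)]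
  obtain ⟨n, hn⟩ := exists_nat_gt ((b - a) / η)
  have hba : 0 < b - a := sub_pos.2 hab
  have hn0 : (0 : ℝ) < n := (div_pos hba hη).trans hn
  have hstep0 : 0 < (b - a) / n := by positivity
  have hstep : (b - a) / n < η := by
    rw [div_lt_iff₀ hη] at hn
    rw [div_lt_iff₀ hn0]
    linarith
  have hsum : (n : ℝ) * ((b - a) / n) = b - a := by field_simp
  have key : ∀ i : ℕ, i + 1 ≤ n → P a (a + (i + 1 : ℕ) * ((b - a) / n)) := by
    intro i
    induction i with
    | zero =>
      intro hi
      have hi' : (1 : ℝ) ≤ n := by exact_mod_cast hi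
      refine hshort a ⟨le_rfl, hab.le⟩ _ ⟨?_, ?_⟩ ?_ ?_ <;> push_cast <;> nlinarith
    | succ i ih =>
      intro hi
      have hi' : (i : ℝ) + 1 + 1 ≤ n := by exact_mod_cast hi
      have h0 : (0 : ℝ) ≤ i := i.cast_nonneg
      refine hadd a (a + (i + 1 : ℕ) * ((b - a) / n)) _ le_rfl ?_ ?_ ?_ (ih (by omega))
        (hshort _ ⟨?_, ?_⟩ _ ⟨?_, ?_⟩ ?_ ?_) <;> push_cast <;> nlinarith
  have hn1 : 1 ≤ n := by exact_mod_cast hn0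
  have h := key (n - 1) (by omega)
  rwa [Nat.sub_add_cancel hn1, hsum, add_sub_cancel] at h

namespace FinslerMetric

variable {E : Type*} [NormedAddCommGroup E] [NormedSpace ℝ E]
  {M : Type*} [TopologicalSpace M] [ChartedSpace E M] [IsManifold 𝓘(ℝ, E) ∞ M]
  {F : FinslerMetric E M} {e : OpenPartialHomeomorph M E}

/-- A ball in a chart whose points at distance at most `ρ` from the centre are joined by unique
short geodesics. -/
structure IsWindow (F : FinslerMetric E M) (e : OpenPartialHomeomorph M E) (y₀ : E)
    (R ρ κ C m : ℝ) : Prop where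
  mem_atlas : e ∈ atlas E M
  subset : closedBall y₀ R ⊆ e.target
  ρ_pos : 0 < ρ
  ρ_le : ρ ≤ R
  κ_pos : 0 < κ
  m_pos : 0 < m
  bound : ∀ y ∈ closedBall y₀ R, ∀ w, m * ‖w‖ ^ 2 ≤ F.localLagrangian e y w
  exists_family : ∀ a b : ℝ, a < b → ∃ γ v : E → E → ℝ → E, ∀ p ∈ closedBall y₀ ρ,
    ∀ q ∈ closedBall y₀ ρ, IsShortGeodesicFamily (F.localLagrangian e) y₀ R ρ κ C a b γ v p q

theorem exists_isWindow [FiniteDimensional ℝ E] (F : FinslerMetric E M) (x : M) {N : Set (M × M)}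
    (hN : N ∈ 𝓝ˢ (diagonal M)) : ∃ (e : OpenPartialHomeomorph M E) (R ρ κ C m : ℝ),
      x ∈ e.source ∧ F.IsWindow e (e x) R ρ κ C m ∧
      ∀ y ∈ closedBall (e x) R, ∀ y' ∈ closedBall (e x) R, (e.symm y, e.symm y') ∈ N := by
  set e := chartAt E x with he_def
  have he : e ∈ atlas E M := chart_mem_atlas E _
  have hx : x ∈ e.source := mem_chart_source E _
  have hL := F.isFinslerLagrangian he
  have hN' : N ∈ 𝓝 (x, x) := nhds_le_nhdsSet (mem_diagonal x) hN
  have hc : ContinuousAt (fun z : E × E => (e.symm z.1, e.symm z.2)) (e x, e x) := by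
    have h := e.continuousAt_symm (e.map_source hx)
    exact (ContinuousAt.comp (f := Prod.fst) h continuousAt_fst).prodMk
      (ContinuousAt.comp (f := Prod.snd) h continuousAt_snd)
  have h1 : ∀ᶠ z : E × E in 𝓝 (e x, e x), (e.symm z.1, e.symm z.2) ∈ N :=
    hc.eventually (by simpa [e.left_inv hx] using hN')
  obtain ⟨ε, hε, hsub⟩ := Metric.nhds_basis_closedBall.mem_iff.1 h1
  obtain ⟨R, hR, hRε, hRU, ρ, hρ, hρR, κ, hκ, C, hC, hfam⟩ :=
    hL.exists_short_geodesics (e.map_source hx) hε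
  obtain ⟨m, hm, _, _, hbd⟩ := hL.exists_bounds hRU
  refine ⟨e, R, ρ, κ, C, m, hx, ⟨he, hRU, hρ, hρR, hκ, hm, fun y hy w => (hbd y hy w).1, hfam⟩, ?_⟩
  intro y hy y' hy'
  have h2 : (y, y') ∈ closedBall (e x, e x) ε := by
    rw [← closedBall_prod_same]
    exact ⟨closedBall_subset_closedBall hRε hy, closedBall_subset_closedBall hRε hy'⟩
  exact hsub h2

variable {y₀ : E} {R ρ κ C m : ℝ}

theorem IsWindow.mem_closedBall_of_energy_le [FiniteDimensional ℝ E] [T2Space M]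
    (W : F.IsWindow e y₀ R ρ κ C m) {A : ℝ} {c : ℝ → M} (hc : IsAdmissible E c) {a b t₀ : ℝ}
    (ht₀ : t₀ ∈ Icc a b) (hA : F.energy c a b ≤ ENNReal.ofReal A) (hA0 : 0 ≤ A)
    (hab : (b - a) * A < m * ρ ^ 2 / 4)
    (h₀ : c t₀ ∈ e.source ∧ e (c t₀) ∈ closedBall y₀ (ρ / 2)) :
    ∀ t ∈ Icc a b, c t ∈ e.source ∧ e (c t) ∈ closedBall y₀ ρ := by
  have hρ := W.ρ_pos
  have hm := W.m_pos
  have hsub : closedBall y₀ ρ ⊆ closedBall y₀ R := closedBall_subset_closedBall W.ρ_le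
  refine mem_closedBall_of_displacement hρ (hsub.trans W.subset) hc.continuous ht₀ ?_ h₀
  intro s hs t ht hst hin
  rcases hst.eq_or_lt with rfl | hst
  · simpa using half_pos hρ
  have h1 := sq_norm_chart_sub_le (F := F) W.mem_atlas hc hm W.bound hst
    fun r hr => ⟨(hin r hr).1, hsub (hin r hr).2⟩
  have h2 := h1.trans ((F.energy_mono hs.1 ht.2).trans hA)
  rw [ENNReal.ofReal_le_ofReal_iff hA0, div_le_iff₀ (sub_pos.2 hst)] at h2
  have h3 : A * (t - s) ≤ (b - a) * A := by nlinarith [hs.1, ht.2]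
  have h4 : m * ‖e (c t) - e (c s)‖ ^ 2 < m * (ρ / 2) ^ 2 := by nlinarith
  have h5 := lt_of_mul_lt_mul_left h4 hm.le
  exact lt_of_pow_lt_pow_left₀ 2 (by positivity) h5

/-- Replacing a piece of a curve by the short geodesic with the same endpoints decreases the
energy. -/
theorem IsWindow.exists_replacement [FiniteDimensional ℝ E] (W : F.IsWindow e y₀ R ρ κ C m)
    {c : ℝ → M} (hc : IsAdmissible E c) {a b α β : ℝ} (haα : a ≤ α) (hαβ : α < β) (hβb : β ≤ b)
    (hin : ∀ t ∈ Icc α β, c t ∈ e.source ∧ e (c t) ∈ closedBall y₀ ρ) {γ v : E → E → ℝ → E}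
    (hfam : IsShortGeodesicFamily (F.localLagrangian e) y₀ R ρ κ C α β γ v (e (c α)) (e (c β)))
    {x y : M} {g : Path.Homotopic.Quotient x y} (hg : RepresentsOn c a b g) :
    ∃ c' : ℝ → M, IsAdmissible E c' ∧ RepresentsOn c' a b g ∧ ∀ t ∈ Icc α β,
      F.energy c' a b + ENNReal.ofReal (κ * ‖e (c t) - γ (e (c α)) (e (c β)) t‖ ^ 2 / (β - α)) ≤
        F.energy c a b := by
  have he := W.mem_atlas
  have hL := F.isFinslerLagrangian he
  set γ₀ := γ (e (c α)) (e (c β)) with hγ₀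
  set v₀ := v (e (c α)) (e (c β)) with hv₀
  set σ : ℝ → M := fun t => e.symm (γ₀ (projIcc α β hαβ.le t)) with hσ
  have hσc : Continuous σ := e.continuousOn_symm.comp_continuous
    (hfam.continuous.comp (continuous_subtype_val.comp continuous_projIcc))
    fun t => W.subset (hfam.mem _ (projIcc α β hαβ.le t).2)
  have hσeq : ∀ t ∈ Icc α β, σ t = e.symm (γ₀ t) := fun t ht => by
    simp only [hσ, projIcc_of_mem hαβ.le ht]
  have hα : α ∈ Icc α β := left_mem_Icc.2 hαβ.le
  have hβ : β ∈ Icc α β := right_mem_Icc.2 hαβ.le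
  have hσα : σ α = c α := by rw [hσeq α hα, hγ₀, hfam.left, e.left_inv (hin α hα).1]
  have hσβ : σ β = c β := by rw [hσeq β hβ, hγ₀, hfam.right, e.left_inv (hin β hβ).1]
  have heσ : ∀ t ∈ Icc α β, σ t ∈ e.source ∧ e (σ t) = γ₀ t := fun t ht => by
    rw [hσeq t ht]
    exact ⟨e.map_target (W.subset (hfam.mem t ht)), e.right_inv (W.subset (hfam.mem t ht))⟩
  have heσ' : ∀ t ∈ Ioo α β, (fun s => e (σ s)) =ᶠ[𝓝 t] γ₀ := fun t ht => by
    filter_upwards [Ioo_mem_nhds ht.1 ht.2] with s hs using (heσ s (Ioo_subset_Icc_self hs)).2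
  have hderiv : ∀ t ∈ Ioo α β, HasDerivAt (fun s => e (σ s)) (v₀ t) t := fun t ht =>
    (hfam.hasDerivAt t ht).congr_of_eventuallyEq (heσ' t ht)
  set c' := joinAt α c (joinAt β σ c) with hc'
  have hj1 : c α = joinAt β σ c α := by rw [joinAt_of_le hαβ.le, hσα]
  have hcσ : ∀ t ∈ Ioo α β, σ =ᶠ[𝓝 t] c' := fun t ht =>
    (joinAt_eventuallyEq_left ht.2).trans (joinAt_eventuallyEq_right ht.1)
  have hc'σ : ∀ t ∈ Icc α β, c' t = σ t := fun t ht => by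
    rw [hc', joinAt_of_ge hj1 ht.1, joinAt_of_le ht.2]
  have hout : ∀ t, t ∉ Ioo α β → c' t = c t := by
    intro t ht
    rcases le_or_gt t α with h | h
    · rw [hc', joinAt_of_le h]
    · have h' : β ≤ t := not_lt.1 fun h' => ht ⟨h, h'⟩
      rw [hc', joinAt_of_lt h, joinAt_of_ge hσβ h']
  have hcont : Continuous c' :=
    continuous_joinAt hc.continuous (continuous_joinAt hσc hc.continuous hσβ) hj1
  have hadm : IsAdmissible E c' := by
    refine ⟨hcont, ?_⟩
    obtain ⟨s, hs, hd⟩ := hc.exists_countable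
    refine ⟨insert α (insert β s), (hs.insert β).insert α, fun t ht => ?_⟩
    simp only [mem_insert_iff, not_or] at ht
    rcases lt_or_gt_of_ne ht.1 with h | h
    · exact (hd t ht.2.2).congr_of_eventuallyEq (joinAt_eventuallyEq_left h).symm
    rcases lt_or_gt_of_ne ht.2.1 with h' | h'
    · refine MDifferentiableAt.congr_of_eventuallyEq ?_ (hcσ t ⟨h, h'⟩).symm
      exact (mdifferentiableAt_iff_chart he hσc.continuousAt (heσ t ⟨h.le, h'.le⟩).1).2
        (hderiv t ⟨h, h'⟩).differentiableAt
    · exact (hd t ht.2.2).congr_of_eventuallyEq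
        ((joinAt_eventuallyEq_right h').trans (joinAt_eventuallyEq_right h)).symm
  have hsub : closedBall y₀ ρ ⊆ closedBall y₀ R := closedBall_subset_closedBall W.ρ_le
  refine ⟨c', hadm, ?_, fun t ht => ?_⟩
  · refine hg.replace hc.continuous haα hαβ.le hβb (fun t _ ht => (hout t ht).symm) fun q hq => ?_
    refine hq.congr_of_chart (convex_closedBall y₀ R) W.subset hc.continuous hcont hαβ.le
      (fun t ht => ⟨(hin t ht).1, hsub (hin t ht).2⟩) (fun t ht => ?_)
      (hout α (by simp)).symm (hout β (by simp)).symm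
    rw [hc'σ t ht, (heσ t ht).2]
    exact ⟨(heσ t ht).1, hfam.mem t ht⟩
  · have hmid : F.energy c' α β =
        ENNReal.ofReal ((β - α) * F.localLagrangian e (e (c α)) (v₀ α)) := by
      rw [← F.energy_congr hcσ, energy_eq_chart he hσc fun t ht => (heσ t ht).1,
        ← Measure.restrict_congr_set Ioo_ae_eq_Ioc,
        setLIntegral_congr_fun (g := fun _ => ENNReal.ofReal
          (F.localLagrangian e (e (c α)) (v₀ α))) measurableSet_Ioo fun t ht => by
            simp only [(heσ t (Ioo_subset_Icc_self ht)).2, (hderiv t ht).deriv,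
              hγ₀, hv₀, hfam.energy t (Ioo_subset_Icc_self ht)],
        setLIntegral_const, Real.volume_Ioo, ← ENNReal.ofReal_mul
          (hL.nonneg _ (e.map_source (hin α hα).1)), mul_comm]
    obtain ⟨s, hs, hd⟩ := hc.exists_countable_chart he fun t ht => (hin t ht).1
    have hcmp := hfam.comparison (fun t => e (c t)) s
      (e.continuousOn.comp hc.continuous.continuousOn fun t ht => (hin t ht).1)
      (fun t ht => hsub (hin t ht).2) hs hd rfl rfl t ht
    rw [← energy_eq_chart he hc.continuous fun t ht => (hin t ht).1] at hcmp
    have hl : 0 < β - α := sub_pos.2 hαβ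
    have hκ := W.κ_pos
    rw [ENNReal.ofReal_add (mul_nonneg hl.le (hL.nonneg _ (e.map_source (hin α hα).1)))
      (by positivity), ← hv₀, ← hmid] at hcmp
    have hleft : F.energy c' a α = F.energy c a α :=
      (F.energy_congr fun t ht => joinAt_eventuallyEq_left ht.2).symm
    have hright : F.energy c' β b = F.energy c β b :=
      (F.energy_congr fun t ht => (joinAt_eventuallyEq_right ht.1).trans
        (joinAt_eventuallyEq_right (hαβ.trans ht.1))).symm
    rw [← F.energy_add (c := c') (haα.trans hαβ.le) hβb, ← F.energy_add (c := c') haα hαβ.le,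
      ← F.energy_add (c := c) (haα.trans hαβ.le) hβb, ← F.energy_add (c := c) haα hαβ.le,
      hleft, hright]
    calc _ = F.energy c a α + (F.energy c' α β +
          ENNReal.ofReal (κ * ‖e (c t) - γ₀ t‖ ^ 2 / (β - α))) + F.energy c β b := by ring
      _ ≤ _ := by gcongr

end FinslerMetric

namespace FinslerMetric

variable {E : Type*} [NormedAddCommGroup E] [NormedSpace ℝ E]
  {M : Type*} [TopologicalSpace M] [ChartedSpace E M] [IsManifold 𝓘(ℝ, E) ∞ M]
  {F : FinslerMetric E M} {e : OpenPartialHomeomorph M E}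

/-- A sequence of curves that represent the class `g` over `[0, T]` and whose energy tends to the
infimum over that class. -/
structure IsMinimizingSequence (F : FinslerMetric E M) (T A : ℝ) {x y : M}
    (g : Path.Homotopic.Quotient x y) (cs : ℕ → ℝ → M) : Prop where
  admissible : ∀ k, IsAdmissible E (cs k)
  represents : ∀ k, RepresentsOn (cs k) 0 T g
  energy_le : ∀ k, F.energy (cs k) 0 T ≤ ENNReal.ofReal A
  minimizing : ∀ k c, IsAdmissible E c → RepresentsOn c 0 T g →
    F.energy (cs k) 0 T ≤ F.energy c 0 T + ENNReal.ofReal (1 / (k + 1 : ℝ))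

theorem exists_isMinimizingSequence {T A : ℝ} {x y : M} {g : Path.Homotopic.Quotient x y}
    {c₀ : ℝ → M} (hc₀ : IsAdmissible E c₀) (hg : RepresentsOn c₀ 0 T g)
    (hA : F.energy c₀ 0 T ≤ ENNReal.ofReal A) :
    ∃ cs : ℕ → ℝ → M, F.IsMinimizingSequence T A g cs := by
  set S := (fun c => F.energy c 0 T) '' {c | IsAdmissible E c ∧ RepresentsOn c 0 T g} with hS
  have hle : ∀ c, IsAdmissible E c → RepresentsOn c 0 T g → sInf S ≤ F.energy c 0 T :=
    fun c h1 h2 => sInf_le ⟨c, ⟨h1, h2⟩, rfl⟩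
  have hfin : sInf S ≠ ⊤ := ((hle c₀ hc₀ hg).trans_lt (hA.trans_lt ENNReal.ofReal_lt_top)).ne
  have h : ∀ k : ℕ, ∃ c, IsAdmissible E c ∧ RepresentsOn c 0 T g ∧
      F.energy c 0 T ≤ ENNReal.ofReal A ∧
      F.energy c 0 T ≤ sInf S + ENNReal.ofReal (1 / (k + 1 : ℝ)) := by
    intro k
    have hpos : (0 : ℝ) < 1 / (k + 1 : ℝ) := by positivity
    have hlt : sInf S < sInf S + ENNReal.ofReal (1 / (k + 1 : ℝ)) :=
      ENNReal.lt_add_right hfin (ENNReal.ofReal_pos.2 hpos).ne'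
    obtain ⟨_, ⟨c, ⟨h1, h2⟩, rfl⟩, hc⟩ := sInf_lt_iff.1 hlt
    rcases le_total (F.energy c 0 T) (ENNReal.ofReal A) with h | h
    · exact ⟨c, h1, h2, h, hc.le⟩
    · exact ⟨c₀, hc₀, hg, hA, (hA.trans h).trans hc.le⟩
  choose cs h1 h2 h3 h4 using h
  exact ⟨cs, h1, h2, h3, fun k c hc hcg => (h4 k).trans (by gcongr; exact hle c hc hcg)⟩

/-- What the limit of a minimizing sequence looks like on a short time interval. -/
structure IsLimitPiece (F : FinslerMetric E M) (cs : ℕ → ℝ → M) (N : Set (M × M)) (c : ℝ → M)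
    (α β : ℝ) : Prop where
  continuousOn : ContinuousOn c (Icc α β)
  close : ∀ᶠ k in (hyperfilter ℕ : Filter ℕ), ∀ t ∈ Icc α β, (cs k t, c t) ∈ N
  const_or_geodesic : (∀ t ∈ Icc α β, c t = c α) ∨ ∃ ℓ : ℝ,
    (∀ t ∈ Ioo α β, F.IsGeodesicAt c t ∧ (1 / 2 : ℝ) * F.toFun (velocity E c t) ^ 2 = ℓ) ∧
    ∀ ε > 0, ∀ᶠ k in (hyperfilter ℕ : Filter ℕ),
      ENNReal.ofReal ((β - α) * ℓ) ≤ F.energy (cs k) α β + ENNReal.ofReal ε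

theorem IsWindow.ofReal_le_energy {y₀ : E} {R ρ κ C m : ℝ} (W : F.IsWindow e y₀ R ρ κ C m)
    {c : ℝ → M} (hc : IsAdmissible E c) {α β : ℝ} (hαβ : α < β)
    (hin : ∀ t ∈ Icc α β, c t ∈ e.source ∧ e (c t) ∈ closedBall y₀ ρ) {γ v : E → E → ℝ → E}
    (hfam : IsShortGeodesicFamily (F.localLagrangian e) y₀ R ρ κ C α β γ v (e (c α)) (e (c β))) :
    ENNReal.ofReal ((β - α) * F.localLagrangian e (e (c α)) (v (e (c α)) (e (c β)) α)) ≤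
      F.energy c α β := by
  have he := W.mem_atlas
  have hα : α ∈ Icc α β := left_mem_Icc.2 hαβ.le
  have hl : 0 < β - α := sub_pos.2 hαβ
  have hκ := W.κ_pos
  obtain ⟨s, hs, hd⟩ := hc.exists_countable_chart he fun t ht => (hin t ht).1
  have hcmp := hfam.comparison (fun t => e (c t)) s
    (e.continuousOn.comp hc.continuous.continuousOn fun t ht => (hin t ht).1)
    (fun t ht => closedBall_subset_closedBall W.ρ_le (hin t ht).2) hs hd rfl rfl α hα
  rw [← energy_eq_chart he hc.continuous fun t ht => (hin t ht).1] at hcmp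
  exact (ENNReal.ofReal_le_ofReal (le_add_of_nonneg_right (by positivity))).trans hcmp

theorem isGeodesicAt_of_family (he : e ∈ atlas E M) {y₀ : E} {R ρ κ C : ℝ} {c : ℝ → M}
    {α β : ℝ} {γ v : E → E → ℝ → E} {p q : E}
    (hfam : IsShortGeodesicFamily (F.localLagrangian e) y₀ R ρ κ C α β γ v p q)
    (heq : ∀ t ∈ Icc α β, c t ∈ e.source ∧ e (c t) = γ p q t) (hne : ∀ t, v p q t ≠ 0) :
    ∀ t ∈ Ioo α β, F.IsGeodesicAt c t ∧
      (1 / 2 : ℝ) * F.toFun (velocity E c t) ^ 2 = F.localLagrangian e p (v p q α) := by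
  have hd : ∀ t ∈ Ioo α β, HasDerivAt (fun s => e (c s)) (v p q t) t := by
    intro t ht
    refine (hfam.hasDerivAt t ht).congr_of_eventuallyEq ?_
    filter_upwards [Ioo_mem_nhds ht.1 ht.2] with r hr using (heq r (Ioo_subset_Icc_self hr)).2
  intro t ht
  have ht' := Ioo_subset_Icc_self ht
  have hg : F.IsGeodesicIn e c t := by
    refine .of_hasDerivAt (v := v p q) ?_
    filter_upwards [Ioo_mem_nhds ht.1 ht.2] with s hs
    have hs' := Ioo_subset_Icc_self hs
    refine ⟨(heq s hs').1, hne s, hd s hs, ?_⟩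
    rw [(heq s hs').2]
    exact hfam.hasDerivAt_vel s hs
  refine ⟨⟨e, he, hg⟩, ?_⟩
  rw [F.half_sq_velocity he (hg.mdifferentiableAt he) (heq t ht').1, (hd t ht).deriv, (heq t ht').2]
  exact hfam.energy t ht'

variable [FiniteDimensional ℝ E]

theorem _root_.IsShortGeodesicFamily.eq_of_vel_eq_zero {L : E → E → ℝ} {y₀ : E}
    {R ρ κ C α β : ℝ} {γ v : E → E → ℝ → E} {p q : E}
    (hfam : IsShortGeodesicFamily L y₀ R ρ κ C α β γ v p q) (h0 : ∀ t, v p q t = 0) :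
    ∀ t ∈ Icc α β, γ p q t = p := by
  intro t ht
  have h := integral_eq_of_hasDerivAt_off_countable_of_le (γ p q) (fun _ => 0) ht.1
    countable_empty hfam.continuous.continuousOn (fun s hs => by
      have h1 := hfam.hasDerivAt s ⟨hs.1.1, hs.1.2.trans_le ht.2⟩
      rwa [h0] at h1) (by simp)
  rw [intervalIntegral.integral_zero, hfam.left] at h
  exact (sub_eq_zero.1 h.symm)

theorem _root_.IsFinslerLagrangian.tendsto {U : Set E} {L : E → E → ℝ}
    (hL : IsFinslerLagrangian U L) {ι : Type*} {l : Filter ι} {u v : ι → E} {y w : E} (hy : y ∈ U)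
    (hu : Tendsto u l (𝓝 y)) (hv : Tendsto v l (𝓝 w)) :
    Tendsto (fun k => L (u k) (v k)) l (𝓝 (L y w)) := by
  have h1 : ContinuousAt (fun z : E × E => L z.1 z.2) (y, w) :=
    hL.continuousOn_lagrangian.continuousAt (prod_mem_nhds (hL.isOpen.mem_nhds hy) univ_mem)
  exact Tendsto.comp (f := fun k => (u k, v k)) h1 (hu.prodMk_nhds hv)

variable [T2Space M]

theorem IsMinimizingSequence.isLimitPiece {T A : ℝ} {x y : M} {g : Path.Homotopic.Quotient x y}
    {cs : ℕ → ℝ → M} (hcs : F.IsMinimizingSequence T A g cs) {c : ℝ → M}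
    (hc : ∀ t, Tendsto (fun k => cs k t) (hyperfilter ℕ) (𝓝 (c t)))
    {y₀ : E} {R ρ κ C m : ℝ} (W : F.IsWindow e y₀ R ρ κ C m) {N : Set (M × M)}
    (hN : ∀ y ∈ closedBall y₀ R, ∀ y' ∈ closedBall y₀ R, (e.symm y, e.symm y') ∈ N)
    {α β : ℝ} (h0α : 0 ≤ α) (hαβ : α < β) (hβT : β ≤ T)
    (hin : ∀ᶠ k in (hyperfilter ℕ : Filter ℕ), ∀ t ∈ Icc α β,
      cs k t ∈ e.source ∧ e (cs k t) ∈ closedBall y₀ ρ) : F.IsLimitPiece cs N c α β := by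
  have : ProperSpace E := FiniteDimensional.proper_real E
  have he := W.mem_atlas
  have hL := F.isFinslerLagrangian he
  have hl : 0 < β - α := sub_pos.2 hαβ
  have hκ := W.κ_pos
  have hsub : closedBall y₀ ρ ⊆ closedBall y₀ R := closedBall_subset_closedBall W.ρ_le
  have hα : α ∈ Icc α β := left_mem_Icc.2 hαβ.le
  have hβ : β ∈ Icc α β := right_mem_Icc.2 hαβ.le
  have hKc : IsClosed (e.symm '' closedBall y₀ ρ) :=
    ((isCompact_closedBall y₀ ρ).image_of_continuousOn
      (e.continuousOn_symm.mono (hsub.trans W.subset))).isClosed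
  have hcin : ∀ t ∈ Icc α β, c t ∈ e.source ∧ e (c t) ∈ closedBall y₀ ρ := by
    intro t ht
    have h1 : c t ∈ e.symm '' closedBall y₀ ρ := hKc.mem_of_tendsto (hc t)
      (hin.mono fun k hk => ⟨e (cs k t), (hk t ht).2, e.left_inv (hk t ht).1⟩)
    obtain ⟨z, hz, hzc⟩ := h1
    rw [← hzc, e.right_inv (W.subset (hsub hz))]
    exact ⟨e.map_target (W.subset (hsub hz)), hz⟩
  have hlim : ∀ t ∈ Icc α β, Tendsto (fun k => e (cs k t)) (hyperfilter ℕ) (𝓝 (e (c t))) :=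
    fun t ht => (e.continuousAt (hcin t ht).1).tendsto.comp (hc t)
  obtain ⟨γ, v, hfam⟩ := W.exists_family α β hαβ
  have hfc := hfam _ (hcin α hα).2 _ (hcin β hβ).2
  set γ₀ := γ (e (c α)) (e (c β)) with hγ₀
  set v₀ := v (e (c α)) (e (c β)) with hv₀
  have hsum : Tendsto (fun k => C * (‖e (cs k α) - e (c α)‖ + ‖e (cs k β) - e (c β)‖))
      (hyperfilter ℕ) (𝓝 0) := by
    have h1 := (tendsto_iff_norm_sub_tendsto_zero.1 (hlim α hα)).add
      (tendsto_iff_norm_sub_tendsto_zero.1 (hlim β hβ))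
    simpa using h1.const_mul C
  have hγlim : ∀ t ∈ Icc α β,
      Tendsto (fun k => γ (e (cs k α)) (e (cs k β)) t) (hyperfilter ℕ) (𝓝 (γ₀ t)) := by
    intro t ht
    rw [tendsto_iff_norm_sub_tendsto_zero]
    refine squeeze_zero' (Eventually.of_forall fun k => norm_nonneg _) (hin.mono fun k hk => ?_)
      hsum
    exact (hfam _ (hk α hα).2 _ (hk β hβ).2).dist_le _ (hcin α hα).2 _ (hcin β hβ).2 t ht
  have hvlim : Tendsto (fun k => v (e (cs k α)) (e (cs k β)) α) (hyperfilter ℕ) (𝓝 (v₀ α)) := by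
    rw [tendsto_iff_norm_sub_tendsto_zero]
    refine squeeze_zero' (g := fun k => (β - α)⁻¹ *
      (C * (‖e (cs k α) - e (c α)‖ + ‖e (cs k β) - e (c β)‖)))
      (Eventually.of_forall fun k => norm_nonneg _) (hin.mono fun k hk => ?_)
      (by simpa using hsum.const_mul (β - α)⁻¹)
    exact (hfam _ (hk α hα).2 _ (hk β hβ).2).dist_vel_le _ (hcin α hα).2 _ (hcin β hβ).2 α hα
  have hdist : ∀ t ∈ Icc α β, Tendsto (fun k => e (cs k t) - γ (e (cs k α)) (e (cs k β)) t)
      (hyperfilter ℕ) (𝓝 0) := by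
    intro t ht
    have h1 : ∀ᶠ k in (hyperfilter ℕ : Filter ℕ),
        ‖e (cs k t) - γ (e (cs k α)) (e (cs k β)) t‖ ^ 2 ≤ (β - α) / κ * (1 / (k + 1 : ℝ)) := by
      filter_upwards [hin] with k hk
      obtain ⟨c', hc'a, hc'r, hc'e⟩ := W.exists_replacement (hcs.admissible k) h0α hαβ hβT hk
        (hfam _ (hk α hα).2 _ (hk β hβ).2) (hcs.represents k)
      have h2 := (hc'e t ht).trans (hcs.minimizing k c' hc'a hc'r)
      have hne : F.energy c' 0 T ≠ ⊤ := by
        have h3 : F.energy c' 0 T ≤ ENNReal.ofReal A :=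
          le_self_add.trans ((hc'e t ht).trans (hcs.energy_le k))
        exact (h3.trans_lt ENNReal.ofReal_lt_top).ne
      have h4 := (ENNReal.add_le_add_iff_left hne).1 h2
      rw [ENNReal.ofReal_le_ofReal_iff (by positivity), div_le_iff₀ hl] at h4
      rw [div_mul_eq_mul_div, le_div_iff₀ hκ]
      linarith
    rw [tendsto_zero_iff_norm_tendsto_zero]
    have h5 : Tendsto (fun k : ℕ => (β - α) / κ * (1 / (k + 1 : ℝ))) (hyperfilter ℕ) (𝓝 0) := by
      have h6 := (tendsto_one_div_add_atTop_nhds_zero_nat (𝕜 := ℝ)).const_mul ((β - α) / κ)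
      rw [mul_zero] at h6
      exact h6.mono_left Nat.hyperfilter_le_atTop
    have h7 := squeeze_zero' (Eventually.of_forall fun k => sq_nonneg _) h1 h5
    have h8 := h7.sqrt
    simpa [Real.sqrt_sq (norm_nonneg _)] using h8
  have heq : ∀ t ∈ Icc α β, e (c t) = γ₀ t := by
    intro t ht
    have h1 := (hdist t ht).add (hγlim t ht)
    simp only [sub_add_cancel, zero_add] at h1
    exact tendsto_nhds_unique (hlim t ht) h1
  have hceq : ∀ t ∈ Icc α β, c t = e.symm (γ₀ t) := fun t ht => by
    rw [← heq t ht, e.left_inv (hcin t ht).1]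
  refine ⟨?_, ?_, ?_⟩
  · refine ContinuousOn.congr ?_ hceq
    exact e.continuousOn_symm.comp hfc.continuous.continuousOn fun t ht => W.subset (hfc.mem t ht)
  · filter_upwards [hin] with k hk t ht
    have h1 := hN _ (hsub (hk t ht).2) _ (hsub (hcin t ht).2)
    rwa [e.left_inv (hk t ht).1, e.left_inv (hcin t ht).1] at h1
  · rcases hfc.ne_or_eq with hne | h0
    · right
      refine ⟨F.localLagrangian e (e (c α)) (v₀ α), isGeodesicAt_of_family he hfc
        (fun t ht => ⟨(hcin t ht).1, heq t ht⟩) hne, fun ε hε => ?_⟩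
      have hLlim : Tendsto (fun k => (β - α) * F.localLagrangian e (e (cs k α))
          (v (e (cs k α)) (e (cs k β)) α)) (hyperfilter ℕ)
          (𝓝 ((β - α) * F.localLagrangian e (e (c α)) (v₀ α))) := by
        exact (hL.tendsto (e.map_source (hcin α hα).1) (hlim α hα) hvlim).const_mul _
      filter_upwards [hin, hLlim.eventually (lt_mem_nhds (sub_lt_self _ hε))] with k hk hk'
      have hf := hfam _ (hk α hα).2 _ (hk β hβ).2
      calc ENNReal.ofReal ((β - α) * F.localLagrangian e (e (c α)) (v₀ α))
          ≤ ENNReal.ofReal ((β - α) * F.localLagrangian e (e (cs k α))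
              (v (e (cs k α)) (e (cs k β)) α) + ε) := ENNReal.ofReal_le_ofReal (by linarith)
        _ ≤ ENNReal.ofReal ((β - α) * F.localLagrangian e (e (cs k α))
              (v (e (cs k α)) (e (cs k β)) α)) + ENNReal.ofReal ε := ENNReal.ofReal_add_le
        _ ≤ _ := by
          gcongr
          exact W.ofReal_le_energy (hcs.admissible k) hαβ hk hf
    · left
      intro t ht
      rw [hceq t ht, hceq α hα, hγ₀, hfc.eq_of_vel_eq_zero h0 t ht,
        hfc.eq_of_vel_eq_zero h0 α hα]

end FinslerMetric

theorem RepresentsOn.exists_class {M : Type*} [TopologicalSpace M] {c : ℝ → M} (hc : Continuous c)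
    {a b : ℝ} {x y : M} (ha : c a = x) (hb : c b = y) :
    ∃ q : Path.Homotopic.Quotient x y, RepresentsOn c a b q := by
  subst ha hb
  exact ⟨_, RepresentsOn.of_continuous hc a b⟩

namespace FinslerMetric

variable {E : Type*} [NormedAddCommGroup E] [NormedSpace ℝ E]
  {M : Type*} [TopologicalSpace M] [ChartedSpace E M] [IsManifold 𝓘(ℝ, E) ∞ M]
  {F : FinslerMetric E M} {e : OpenPartialHomeomorph M E} {c : ℝ → M}

theorem IsGeodesicIn.comp_mul (he : e ∈ atlas E M) {r t : ℝ} (hr : 0 < r)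
    (h : F.IsGeodesicIn e c (r * t)) : F.IsGeodesicIn e (fun s => c (r * s)) t := by
  have h1 : Tendsto (fun s => r * s) (𝓝 t) (𝓝 (r * t)) := by
    have : ContinuousAt (fun s => r * s) t := by fun_prop
    exact this
  refine .of_hasDerivAt (v := fun s => r • deriv (fun r => e (c r)) (r * s)) ?_
  filter_upwards [h1.eventually h] with s hs
  have hmul : HasDerivAt (fun s => r * s) r s := by simpa using (hasDerivAt_id s).const_mul r
  refine ⟨hs.1, smul_ne_zero hr.ne' hs.2.1, hs.2.2.1.scomp s hmul, ?_⟩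
  have h2 := (hs.2.2.2.scomp s hmul).const_smul r
  refine h2.congr_deriv ?_
  rw [(F.isFinslerLagrangian he).spray_smul (e.map_source hs.1) hr, smul_smul, sq]

theorem IsGeodesicAt.comp_mul {r t : ℝ} (hr : 0 < r) (h : F.IsGeodesicAt c (r * t)) :
    F.IsGeodesicAt (fun s => c (r * s)) t := by
  obtain ⟨e, he, h⟩ := h
  exact ⟨e, he, h.comp_mul he hr⟩

theorem toFun_velocity_comp {f : ℝ → ℝ} {r t : ℝ} (hr : 0 < r) (hf : HasDerivAt f r t)
    (h : MDifferentiableAt 𝓘(ℝ, ℝ) 𝓘(ℝ, E) c (f t)) :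
    F.toFun (velocity E (fun s => c (f s)) t) = r * F.toFun (velocity E c (f t)) := by
  rw [velocity_comp h hf]
  exact F.homogeneous _ _ r hr

theorem IsGeodesicAt.toFun_pos {t : ℝ} (h : F.IsGeodesicAt c t) :
    0 < F.toFun (velocity E c t) := by
  obtain ⟨e, he, h⟩ := h
  have h0 := h.self_of_nhds
  have h1 := F.half_sq_velocity he (h.mdifferentiableAt he) h0.1
  have h2 := (F.isFinslerLagrangian he).pos (e.map_source h0.1) h0.2.1
  rw [← h1] at h2
  refine lt_of_le_of_ne (F.nonneg _) fun h3 => ?_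
  rw [← h3] at h2
  norm_num at h2

theorem IsGeodesicAt.not_eventually_const {t : ℝ} (h : F.IsGeodesicAt c t) {z : M} :
    ¬ c =ᶠ[𝓝 t] fun _ => z := by
  intro hc
  obtain ⟨e, he, h⟩ := h
  apply h.self_of_nhds.2.1
  have h1 : (fun s => e (c s)) =ᶠ[𝓝 t] fun _ => e z := hc.mono fun s hs => by simp only [hs]
  rw [h1.deriv_eq, deriv_const]

variable [FiniteDimensional ℝ E] [T2Space M]

theorem IsMinimizingSequence.exists_isLimitPiece {T A : ℝ} (hA : 0 ≤ A) {x y : M}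
    {g : Path.Homotopic.Quotient x y} {cs : ℕ → ℝ → M} (hcs : F.IsMinimizingSequence T A g cs)
    {c : ℝ → M} (hc : ∀ t, Tendsto (fun k => cs k t) (hyperfilter ℕ) (𝓝 (c t)))
    {N : Set (M × M)} (hN : N ∈ 𝓝ˢ (diagonal M)) {t : ℝ} (ht : t ∈ Icc 0 T) :
    ∃ δ > 0, ∀ α ∈ Icc 0 T, ∀ β ∈ Icc 0 T, α < β → |α - t| ≤ δ → |β - t| ≤ δ →
      F.IsLimitPiece cs N c α β := by
  obtain ⟨e, R, ρ, κ, C, m, hx, W, hWN⟩ := F.exists_isWindow (c t) hN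
  have hρ := W.ρ_pos
  have hm := W.m_pos
  refine ⟨m * ρ ^ 2 / (16 * (A + 1)), by positivity, fun α hα β hβ hαβ h1 h2 => ?_⟩
  set δ := m * ρ ^ 2 / (16 * (A + 1)) with hδ
  have hδA : 16 * (δ * (A + 1)) = m * ρ ^ 2 := by
    rw [hδ]
    field_simp
  refine hcs.isLimitPiece hc W hWN hα.1 hαβ hβ.2 ?_
  have h3 : ∀ᶠ k in (hyperfilter ℕ : Filter ℕ),
      cs k t ∈ e.source ∧ e (cs k t) ∈ closedBall (e (c t)) (ρ / 2) :=
    ((hc t).eventually (e.open_source.mem_nhds hx)).and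
      (((e.continuousAt hx).tendsto.comp (hc t)).eventually
        (closedBall_mem_nhds _ (half_pos hρ)))
  have hδ0 : 0 < δ := by positivity
  filter_upwards [h3] with k hk s hs
  rw [abs_le] at h1 h2
  refine W.mem_closedBall_of_energy_le (hcs.admissible k) (a := max 0 (t - δ)) (b := min T (t + δ))
    (A := A) ⟨max_le ht.1 (by linarith), le_min ht.2 (by linarith)⟩
    ((F.energy_mono (le_max_left _ _) (min_le_left _ _)).trans (hcs.energy_le k)) hA ?_ hk s
    ⟨max_le (hα.1.trans hs.1) (by linarith [hs.1]), le_min (hs.2.trans hβ.2) (by linarith [hs.2])⟩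
  have h4 : min T (t + δ) - max 0 (t - δ) ≤ 2 * δ := by
    linarith [min_le_right T (t + δ), le_max_right 0 (t - δ)]
  nlinarith [mul_nonneg hδ0.le hA]

/-- A geodesic over `(0, T)` extends to a unit speed geodesic over `ℝ` after reparametrization. -/
theorem exists_unit_geodesic_extension [CompactSpace M] {T : ℝ} (hT : 0 < T)
    (hc : ContinuousOn c (Icc 0 T)) (hgeo : ∀ t ∈ Ioo 0 T, F.IsGeodesicAt c t) {r : ℝ}
    (hr : 0 < r) (hspeed : ∀ t ∈ Ioo 0 T, F.toFun (velocity E c t) = r) :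
    ∃ σ : ℝ → M, (∀ t, F.IsGeodesicAt σ t) ∧ (∀ t, F.toFun (velocity E σ t) = 1) ∧
      ∀ s ∈ Icc 0 (r * T), σ s = c (r⁻¹ * s) := by
  have hrT : 0 < r * T := mul_pos hr hT
  have hmem : ∀ s ∈ Ioo 0 (r * T), r⁻¹ * s ∈ Ioo 0 T := fun s hs =>
    ⟨mul_pos (inv_pos.2 hr) hs.1, by rw [inv_mul_lt_iff₀ hr]; exact hs.2⟩
  have hmem' : ∀ s ∈ Icc 0 (r * T), r⁻¹ * s ∈ Icc 0 T := fun s hs =>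
    ⟨mul_nonneg (inv_pos.2 hr).le hs.1, by rw [inv_mul_le_iff₀ hr]; exact hs.2⟩
  have hg : ∀ s ∈ Ioo 0 (r * T), F.IsGeodesicAt (fun s => c (r⁻¹ * s)) s := fun s hs =>
    (hgeo _ (hmem s hs)).comp_mul (inv_pos.2 hr)
  have hs₁ : r * T / 2 ∈ Ioo 0 (r * T) := ⟨by linarith, by linarith⟩
  have hunit : F.toFun (velocity E (fun s => c (r⁻¹ * s)) (r * T / 2)) = 1 := by
    have hmul : HasDerivAt (fun s => r⁻¹ * s) r⁻¹ (r * T / 2) := by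
      simpa using (hasDerivAt_id (r * T / 2)).const_mul r⁻¹
    rw [toFun_velocity_comp (inv_pos.2 hr) hmul (hgeo _ (hmem _ hs₁)).mdifferentiableAt,
      hspeed _ (hmem _ hs₁), inv_mul_cancel₀ hr.ne']
  obtain ⟨σ₀, h0, hσ₀⟩ := F.exists_geodesic hunit
  have hσ : ∀ t, F.IsGeodesicAt (fun s => σ₀ (s + -(r * T / 2))) t := fun t =>
    (hσ₀ _).comp_add_const
  have hvel : velocity E (fun s => σ₀ (s + -(r * T / 2))) (r * T / 2) =
      velocity E (fun s => c (r⁻¹ * s)) (r * T / 2) := by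
    rw [velocity_comp_add_const (add_neg_cancel _) (hσ₀ 0).mdifferentiableAt, h0]
  have heq : EqOn (fun s => σ₀ (s + -(r * T / 2))) (fun s => c (r⁻¹ * s)) (Ioo 0 (r * T)) :=
    eqOn_of_velocity_eq isOpen_Ioo isPreconnected_Ioo (fun t _ => hσ t) hg hs₁ hvel
  refine ⟨fun s => σ₀ (s + -(r * T / 2)), hσ, fun t => ?_, ?_⟩
  · rw [toFun_velocity_eq isOpen_univ isPreconnected_univ (fun t _ => hσ t) (mem_univ t)
      (mem_univ (r * T / 2)), hvel, hunit]
  · refine heq.of_subset_closure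
      (fun t _ => (hσ t).continuousAt.continuousWithinAt) (hc.comp (by fun_prop) hmem')
      Ioo_subset_Icc_self ?_
    rw [closure_Ioo hrT.ne]

/-- Every nontrivial class is represented by a unit speed geodesic loop that is as short as the
energy of any representative allows. -/
theorem exists_unit_geodesic [CompactSpace M] {x : M} {g : Path.Homotopic.Quotient x x}
    (hg1 : g ≠ .refl x) {T A : ℝ} (hT : 0 < T) (hA : 0 ≤ A) {c₀ : ℝ → M}
    (hc₀ : IsAdmissible E c₀) (hg : RepresentsOn c₀ 0 T g)
    (hE : F.energy c₀ 0 T ≤ ENNReal.ofReal A) :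
    ∃ (σ : ℝ → M) (ℓ : ℝ), 0 < ℓ ∧ ℓ ^ 2 ≤ 2 * A * T ∧ (∀ t, F.IsGeodesicAt σ t) ∧
      (∀ t, F.toFun (velocity E σ t) = 1) ∧ RepresentsOn σ 0 ℓ g := by
  obtain ⟨N, hN, hclose⟩ := exists_nhdsSet_diagonal_homotopic E M
  obtain ⟨cs, hcs⟩ := exists_isMinimizingSequence hc₀ hg hE
  have hlim : ∀ t, ∃ z, Tendsto (fun k => cs k t) (hyperfilter ℕ) (𝓝 z) := by
    intro t
    obtain ⟨z, -, hz⟩ := isCompact_univ.ultrafilter_le_nhds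
      ((hyperfilter ℕ).map fun k => cs k t) (by simp)
    exact ⟨z, hz⟩
  choose c hc using hlim
  have hloc := fun t ht => hcs.exists_isLimitPiece hA hc hN (t := t) ht
  have hcont : ContinuousOn c (Icc 0 T) := by
    refine interval_induction (P := fun r s => ContinuousOn c (Icc r s)) hT ?_ ?_
    · intro r s t _ hrs hst _ h1 h2
      rw [← Icc_union_Icc_eq_Icc hrs.le hst.le]
      exact h1.union_of_isClosed h2 isClosed_Icc isClosed_Icc
    · intro t ht
      obtain ⟨δ, hδ, h⟩ := hloc t ht
      exact ⟨δ, hδ, fun r hr s hs h1 h2 h3 => (h r hr s hs h1 h2 h3).continuousOn⟩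
  have hnear : ∀ᶠ k in (hyperfilter ℕ : Filter ℕ), ∀ t ∈ Icc 0 T, (cs k t, c t) ∈ N := by
    refine interval_induction (P := fun r s => ∀ᶠ k in (hyperfilter ℕ : Filter ℕ),
      ∀ t ∈ Icc r s, (cs k t, c t) ∈ N) hT ?_ ?_
    · intro r s t _ hrs hst _ h1 h2
      filter_upwards [h1, h2] with k h1 h2 τ hτ
      rcases le_total τ s with h | h
      · exact h1 τ ⟨hτ.1, h⟩
      · exact h2 τ ⟨h, hτ.2⟩
    · intro t ht
      obtain ⟨δ, hδ, h⟩ := hloc t ht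
      exact ⟨δ, hδ, fun r hr s hs h1 h2 h3 => (h r hr s hs h1 h2 h3).close⟩
  set cb : ℝ → M := fun t => c (projIcc 0 T hT.le t) with hcb
  have hcbc : Continuous cb := hcont.comp_continuous
    (continuous_subtype_val.comp continuous_projIcc) fun t => (projIcc 0 T hT.le t).2
  have hcbeq : ∀ t ∈ Icc 0 T, cb t = c t := fun t ht => by
    simp only [hcb, projIcc_of_mem hT.le ht]
  have hend : ∀ t, (∀ k, cs k t = x) → c t = x := fun t h => by
    have h1 := hc t
    simp only [h] at h1
    exact (tendsto_nhds_unique h1 tendsto_const_nhds)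
  have h0T : (0 : ℝ) ∈ Icc 0 T := ⟨le_rfl, hT.le⟩
  have hTT : T ∈ Icc 0 T := ⟨hT.le, le_rfl⟩
  have hcb0 : cb 0 = x := (hcbeq 0 h0T).trans (hend 0 fun k => (hcs.represents k).left_eq)
  have hcbT : cb T = x := (hcbeq T hTT).trans (hend T fun k => (hcs.represents k).right_eq)
  have hcbg : RepresentsOn cb 0 T g := by
    obtain ⟨q, hq⟩ := RepresentsOn.exists_class hcbc hcb0 hcbT
    obtain ⟨k, hk⟩ := hnear.exists
    rwa [hclose (cs k) cb 0 T (hcs.admissible k).continuous hcbc hT.le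
      (fun t ht => by rw [hcbeq t ht]; exact hk t ht) x x g q (hcs.represents k) hq]
  have hpiece : ∀ t ∈ Ioo 0 T, ∃ α ∈ Icc 0 T, ∃ β ∈ Icc 0 T, t ∈ Ioo α β ∧
      F.IsLimitPiece cs N c α β := by
    intro t ht
    obtain ⟨δ, hδ, h⟩ := hloc t (Ioo_subset_Icc_self ht)
    have h1 : max 0 (t - δ) < t := max_lt ht.1 (by linarith)
    have h2 : t < min T (t + δ) := lt_min ht.2 (by linarith)
    have h3 := le_max_right 0 (t - δ)
    have h4 := min_le_right T (t + δ)
    exact ⟨max 0 (t - δ), ⟨le_max_left _ _, h1.le.trans ht.2.le⟩, min T (t + δ),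
      ⟨ht.1.le.trans h2.le, min_le_left _ _⟩, ⟨h1, h2⟩,
      h _ ⟨le_max_left _ _, h1.le.trans ht.2.le⟩ _ ⟨ht.1.le.trans h2.le, min_le_left _ _⟩
        (h1.trans h2) (abs_le.2 ⟨by linarith, by linarith⟩) (abs_le.2 ⟨by linarith, by linarith⟩)⟩
  have hor : Ioo 0 T ⊆ {t | c =ᶠ[𝓝 t] fun _ => c t} ∨ Ioo 0 T ⊆ {t | F.IsGeodesicAt c t} := by
    refine isPreconnected_Ioo.subset_or_subset ?_ ?_ ?_ ?_
    · rw [isOpen_iff_mem_nhds]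
      intro t ht
      filter_upwards [eventually_eventually_nhds.2 ht] with s hs
      have h1 : c s = c t := hs.self_of_nhds
      exact hs.mono fun r hr => hr.trans h1.symm
    · rw [isOpen_iff_mem_nhds]
      rintro t ⟨e, he, ht⟩
      filter_upwards [eventually_eventually_nhds.2 ht] with s hs using ⟨e, he, hs⟩
    · exact disjoint_left.2 fun t h1 h2 => h2.not_eventually_const h1
    · intro t ht
      obtain ⟨α, hα, β, hβ, htαβ, hp⟩ := hpiece t ht
      rcases hp.const_or_geodesic with h | ⟨ℓ, h, -⟩
      · left
        filter_upwards [Ioo_mem_nhds htαβ.1 htαβ.2] with s hs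
        rw [h s (Ioo_subset_Icc_self hs), h t (Ioo_subset_Icc_self htαβ)]
      · exact Or.inr (h t htαβ).1
  rcases hor with hconst | hgeo
  · exfalso
    have h1 : ∀ t ∈ Icc 0 T, c t = c 0 := by
      refine interval_induction (P := fun r s => ∀ t ∈ Icc r s, c t = c r) hT ?_ ?_
      · intro r s t _ hrs hst _ h1 h2 τ hτ
        rcases le_total τ s with h | h
        · exact h1 τ ⟨hτ.1, h⟩
        · rw [h2 τ ⟨h, hτ.2⟩, h1 s ⟨hrs.le, le_rfl⟩]
      · intro t ht
        obtain ⟨δ, hδ, h⟩ := hloc t ht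
        refine ⟨δ, hδ, fun r hr s hs hrs h2 h3 => ?_⟩
        rcases (h r hr s hs hrs h2 h3).const_or_geodesic with h | ⟨ℓ, h, -⟩
        · exact h
        · obtain ⟨τ, hτ⟩ := nonempty_Ioo.2 hrs
          exact ((h τ hτ).1.not_eventually_const
            (hconst ⟨hr.1.trans_lt hτ.1, hτ.2.trans_le hs.2⟩)).elim
    refine hg1 (hcbg.unique hcbc (.of_const hT.le fun t ht => ?_))
    rw [hcbeq t ht, h1 t ht, ← hcbeq 0 h0T, hcb0]
  · have hmid : T / 2 ∈ Ioo 0 T := ⟨by linarith, by linarith⟩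
    set r := F.toFun (velocity E c (T / 2)) with hr_def
    have hr : 0 < r := (hgeo hmid).toFun_pos
    have hspeed : ∀ t ∈ Ioo 0 T, F.toFun (velocity E c t) = r := fun t ht =>
      toFun_velocity_eq isOpen_Ioo isPreconnected_Ioo hgeo ht hmid
    have henergy : ∀ ε > 0, ∀ᶠ k in (hyperfilter ℕ : Filter ℕ),
        ENNReal.ofReal ((T - 0) * (1 / 2 * r ^ 2)) ≤ F.energy (cs k) 0 T + ENNReal.ofReal ε := by
      refine interval_induction (P := fun a b => ∀ ε > 0, ∀ᶠ k in (hyperfilter ℕ : Filter ℕ),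
        ENNReal.ofReal ((b - a) * (1 / 2 * r ^ 2)) ≤
          F.energy (cs k) a b + ENNReal.ofReal ε) hT ?_ ?_
      · intro a b d _ hab hbd _ h1 h2 ε hε
        filter_upwards [h1 (ε / 2) (half_pos hε), h2 (ε / 2) (half_pos hε)] with k h1 h2
        have hsum : (d - a) * (1 / 2 * r ^ 2) =
            (b - a) * (1 / 2 * r ^ 2) + (d - b) * (1 / 2 * r ^ 2) := by ring
        rw [hsum]
        calc _ ≤ _ := ENNReal.ofReal_add_le
          _ ≤ _ := add_le_add h1 h2
          _ = (F.energy (cs k) a b + F.energy (cs k) b d) +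
              (ENNReal.ofReal (ε / 2) + ENNReal.ofReal (ε / 2)) := by ring
          _ = _ := by
            rw [F.energy_add hab.le hbd.le, ← ENNReal.ofReal_add (half_pos hε).le (half_pos hε).le,
              add_halves]
      · intro t ht
        obtain ⟨δ, hδ, h⟩ := hloc t ht
        refine ⟨δ, hδ, fun a ha b hb hab h2 h3 => ?_⟩
        obtain ⟨τ, hτ⟩ := nonempty_Ioo.2 hab
        have hτT : τ ∈ Ioo 0 T := ⟨ha.1.trans_lt hτ.1, hτ.2.trans_le hb.2⟩
        rcases (h a ha b hb hab h2 h3).const_or_geodesic with h | ⟨ℓ, h, hℓ⟩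
        · refine ((hgeo hτT).not_eventually_const (z := c a) ?_).elim
          filter_upwards [Ioo_mem_nhds hτ.1 hτ.2] with s hs using h s (Ioo_subset_Icc_self hs)
        · have h4 := (h τ hτ).2
          rw [hspeed τ hτT] at h4
          rwa [h4]
    have hrA : T * (1 / 2 * r ^ 2) ≤ A := by
      refine le_of_forall_pos_le_add fun ε hε => ?_
      obtain ⟨k, hk⟩ := (henergy ε hε).exists
      have h1 := hk.trans (add_le_add (hcs.energy_le k) le_rfl)
      rwa [← ENNReal.ofReal_add hA hε.le, ENNReal.ofReal_le_ofReal_iff (by positivity),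
        sub_zero] at h1
    obtain ⟨σ, hσ1, hσ2, hσ3⟩ := exists_unit_geodesic_extension hT hcont hgeo hr hspeed
    refine ⟨σ, r * T, mul_pos hr hT, by nlinarith, hσ1, hσ2, ?_⟩
    have hf : Continuous fun s : ℝ => r⁻¹ * s := by fun_prop
    have h2 : RepresentsOn (fun s => cb (r⁻¹ * s)) 0 (r * T) g :=
      RepresentsOn.comp hcbc (f := fun s => r⁻¹ * s) hf (by
        simpa [inv_mul_cancel_left₀ hr.ne'] using hcbg)
    refine h2.congr (hcbc.comp hf) (mul_pos hr hT).le fun s hs => ?_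
    have hs' : r⁻¹ * s ∈ Icc 0 T := ⟨mul_nonneg (inv_pos.2 hr).le hs.1, by
      rw [inv_mul_le_iff₀ hr]; exact hs.2⟩
    rw [hσ3 s hs]
    exact hcbeq _ hs'

end FinslerMetric

namespace FinslerMetric

variable {E : Type*} [NormedAddCommGroup E] [NormedSpace ℝ E]
  {M : Type*} [TopologicalSpace M] [ChartedSpace E M] [IsManifold 𝓘(ℝ, E) ∞ M]
  (F : FinslerMetric E M)

/-- The class `g` contains a loop over `[0, τ]` of energy at most `A`. -/
def HasLoopOfEnergyLE {x : M} (g : FundamentalGroup M x) (τ A : ℝ) : Prop :=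
  ∃ c : ℝ → M, IsAdmissible E c ∧ RepresentsOn c 0 τ (FundamentalGroup.toPath g) ∧
    F.energy c 0 τ ≤ ENNReal.ofReal A

variable {F} {x : M}

omit [IsManifold 𝓘(ℝ, E) ∞ M] in
theorem isAdmissible_const (x : M) : IsAdmissible E fun _ : ℝ => x :=
  ⟨continuous_const, ∅, countable_empty, fun _ _ => mdifferentiableAt_const⟩

theorem HasLoopOfEnergyLE.one : F.HasLoopOfEnergyLE (1 : FundamentalGroup M x) 0 0 :=
  ⟨fun _ => x, isAdmissible_const x, .of_const le_rfl fun _ _ => rfl, by simp [energy]⟩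

theorem HasLoopOfEnergyLE.mul {g h : FundamentalGroup M x} {τ τ' A A' : ℝ} (hτ : 0 ≤ τ)
    (hτ' : 0 ≤ τ') (hA : 0 ≤ A) (hA' : 0 ≤ A') (hg : F.HasLoopOfEnergyLE g τ A)
    (hh : F.HasLoopOfEnergyLE h τ' A') : F.HasLoopOfEnergyLE (g * h) (τ' + τ) (A' + A) := by
  obtain ⟨c, hc, hcr, hce⟩ := hg
  obtain ⟨c', hc', hcr', hce'⟩ := hh
  have hsh : IsAdmissible E fun t => c (t + -τ') := hc.comp_add_const _
  have hj : c' τ' = c (τ' + -τ') := by rw [hcr'.right_eq, add_neg_cancel, hcr.left_eq]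
  have hcs : RepresentsOn (fun t => c (t + -τ')) τ' (τ' + τ) (FundamentalGroup.toPath g) :=
    RepresentsOn.comp hc.continuous (f := fun t => t + -τ') (by fun_prop) (by simpa using hcr)
  refine ⟨joinAt τ' c' fun t => c (t + -τ'), hc'.joinAt hsh hj, ?_, ?_⟩
  · exact (hcr'.congr hc'.continuous hτ' fun t ht => (joinAt_of_le ht.2).symm).trans
      (hcs.congr hsh.continuous (by linarith) fun t ht =>
        (joinAt_of_ge (c := c') (c' := fun t => c (t + -τ')) hj ht.1).symm)
  · rw [← F.energy_add hτ' (show τ' ≤ τ' + τ by linarith), ENNReal.ofReal_add hA' hA]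
    gcongr
    · rw [← F.energy_congr fun t ht => joinAt_eventuallyEq_left ht.2]
      exact hce'
    · rw [← F.energy_congr fun t ht => joinAt_eventuallyEq_right ht.1,
        F.energy_comp_add_const hc]
      simpa using hce

theorem HasLoopOfEnergyLE.list_prod {τ A : ℝ} (hτ : 0 ≤ τ) (hA : 0 ≤ A)
    {l : List (FundamentalGroup M x)} (h : ∀ g ∈ l, F.HasLoopOfEnergyLE g τ A) :
    F.HasLoopOfEnergyLE l.prod (l.length * τ) (l.length * A) := by
  induction l with
  | nil => simpa using HasLoopOfEnergyLE.one
  | cons g l ih =>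
    have h1 := HasLoopOfEnergyLE.mul hτ (by positivity) hA (by positivity)
      (h g (by simp)) (ih fun g hg => h g (by simp [hg]))
    rw [List.prod_cons, List.length_cons]
    push_cast
    rwa [add_one_mul, add_one_mul]

/-! #### Finite energy representatives -/

variable [FiniteDimensional ℝ E]

theorem exists_chart_segment {e : OpenPartialHomeomorph M E} (he : e ∈ atlas E M) {y₀ : E} {R : ℝ}
    (hR : closedBall y₀ R ⊆ e.target) {a b : ℝ} (hab : a < b) {p q : E}
    (hp : p ∈ closedBall y₀ R) (hq : q ∈ closedBall y₀ R) :
    ∃ c : ℝ → M, IsAdmissible E c ∧ c a = e.symm p ∧ c b = e.symm q ∧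
      (∀ t ∈ Icc a b, c t ∈ e.source ∧ e (c t) ∈ closedBall y₀ R) ∧ F.energy c a b ≠ ⊤ := by
  have hl : 0 < b - a := sub_pos.2 hab
  set w : E := (b - a)⁻¹ • (q - p) with hw
  set u : ℝ → E := fun t => p + (t - a) • w with hu
  have hud : ∀ t, HasDerivAt u w t := fun t => by
    simpa [hu] using (((hasDerivAt_id t).sub_const a).smul_const w).const_add p
  have hua : u a = p := by simp [hu]
  have hub : u b = q := by simp [hu, hw, smul_smul, mul_inv_cancel₀ hl.ne']
  have hum : ∀ t ∈ Icc a b, u t ∈ closedBall y₀ R := by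
    intro t ht
    have h1 : u t = (1 - (t - a) / (b - a)) • p + ((t - a) / (b - a)) • q := by
      simp only [hu, hw, smul_smul, div_eq_mul_inv, smul_sub, sub_smul, one_smul]
      abel
    rw [h1]
    refine convex_closedBall y₀ R hp hq ?_ (div_nonneg (by linarith [ht.1]) hl.le) (by ring)
    rw [sub_nonneg, div_le_one hl]
    linarith [ht.2]
  set c : ℝ → M := fun t => e.symm (u (projIcc a b hab.le t)) with hc
  have hucont : Continuous u := continuous_iff_continuousAt.2 fun t => (hud t).continuousAt
  have hcc : Continuous c := e.continuousOn_symm.comp_continuous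
    (hucont.comp (continuous_subtype_val.comp continuous_projIcc))
    fun t => hR (hum _ (projIcc a b hab.le t).2)
  have hceq : ∀ t ∈ Icc a b, c t = e.symm (u t) := fun t ht => by
    simp only [hc, projIcc_of_mem hab.le ht]
  have hmem : ∀ t ∈ Icc a b, c t ∈ e.source ∧ e (c t) = u t := fun t ht => by
    rw [hceq t ht]
    exact ⟨e.map_target (hR (hum t ht)), e.right_inv (hR (hum t ht))⟩
  have hderiv : ∀ t ∈ Ioo a b, HasDerivAt (fun s => e (c s)) w t := fun t ht => by
    refine (hud t).congr_of_eventuallyEq ?_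
    filter_upwards [Ioo_mem_nhds ht.1 ht.2] with s hs using (hmem s (Ioo_subset_Icc_self hs)).2
  have hadm : IsAdmissible E c := by
    refine ⟨hcc, {a, b}, (countable_singleton b).insert a, fun t ht => ?_⟩
    simp only [mem_insert_iff, mem_singleton_iff, not_or] at ht
    rcases lt_or_gt_of_ne ht.1 with h | h
    · refine (mdifferentiableAt_const (c := e.symm (u a))).congr_of_eventuallyEq ?_
      filter_upwards [Iio_mem_nhds h] with s hs
      simp only [hc, projIcc_of_le_left hab.le (mem_Iio.1 hs).le]
    rcases lt_or_gt_of_ne ht.2 with h' | h'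
    · exact (mdifferentiableAt_iff_chart he hcc.continuousAt (hmem t ⟨h.le, h'.le⟩).1).2
        (hderiv t ⟨h, h'⟩).differentiableAt
    · refine (mdifferentiableAt_const (c := e.symm (u b))).congr_of_eventuallyEq ?_
      filter_upwards [Ioi_mem_nhds h'] with s hs
      simp only [hc, projIcc_of_right_le hab.le (mem_Ioi.1 hs).le]
  refine ⟨c, hadm, by rw [hceq a ⟨le_rfl, hab.le⟩, hua], by rw [hceq b ⟨hab.le, le_rfl⟩, hub],
    fun t ht => ⟨(hmem t ht).1, by rw [(hmem t ht).2]; exact hum t ht⟩, ?_⟩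
  obtain ⟨_, _, C, _, hb⟩ := (F.isFinslerLagrangian he).exists_bounds hR
  rw [energy_eq_chart he hcc fun t ht => (hmem t ht).1, ← Measure.restrict_congr_set Ioo_ae_eq_Ioc]
  refine (lt_of_le_of_lt (b := ∫⁻ _ in Ioo a b, ENNReal.ofReal (C * ‖w‖ ^ 2))
    (setLIntegral_mono' measurableSet_Ioo fun t ht => ENNReal.ofReal_le_ofReal ?_) ?_).ne
  · rw [(hmem t (Ioo_subset_Icc_self ht)).2, (hderiv t ht).deriv]
    exact (hb _ (hum t (Ioo_subset_Icc_self ht)) w).2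
  · rw [setLIntegral_const, Real.volume_Ioo]
    exact ENNReal.mul_lt_top ENNReal.ofReal_lt_top ENNReal.ofReal_lt_top

/-- Every homotopy class has a representative of finite energy. -/
theorem exists_finite_energy {p : ℝ → M} (hp : Continuous p) {a b : ℝ} (hab : a < b) :
    ∃ c : ℝ → M, IsAdmissible E c ∧ F.energy c a b ≠ ⊤ ∧ c a = p a ∧ c b = p b ∧
      ∀ (x y : M) (q : Path.Homotopic.Quotient x y), RepresentsOn p a b q →
        RepresentsOn c a b q := by
  refine interval_induction (P := fun a b => ∃ c : ℝ → M, IsAdmissible E c ∧ F.energy c a b ≠ ⊤ ∧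
    c a = p a ∧ c b = p b ∧ ∀ (x y : M) (q : Path.Homotopic.Quotient x y), RepresentsOn p a b q →
      RepresentsOn c a b q) hab ?_ ?_
  · rintro r s t - hrs hst - ⟨c, hc, hce, hcr, hcs, hcq⟩ ⟨c', hc', hce', hcr', hcs', hcq'⟩
    have hj : c s = c' s := hcs.trans hcr'.symm
    refine ⟨joinAt s c c', hc.joinAt hc' hj, ?_, ?_, ?_, fun x y q hq => ?_⟩
    · rw [← F.energy_add hrs.le hst.le,
        ← F.energy_congr fun t ht => joinAt_eventuallyEq_left ht.2,
        ← F.energy_congr fun t ht => joinAt_eventuallyEq_right ht.1]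
      exact ENNReal.add_ne_top.2 ⟨hce, hce'⟩
    · rw [joinAt_of_le hrs.le, hcr]
    · rw [joinAt_of_lt hst, hcs']
    · obtain ⟨q₁, q₂, h1, h2, rfl⟩ := hq.split hp s
      exact ((hcq _ _ _ h1).congr hc.continuous hrs.le fun t ht => (joinAt_of_le ht.2).symm).trans
        ((hcq' _ _ _ h2).congr hc'.continuous hst.le fun t ht => (joinAt_of_ge hj ht.1).symm)
  · intro t _
    set e := chartAt E (p t) with he_def
    have he : e ∈ atlas E M := chart_mem_atlas E _
    have hx : p t ∈ e.source := mem_chart_source E _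
    obtain ⟨R, hR, hsub⟩ := Metric.nhds_basis_closedBall.mem_iff.1
      (e.open_target.mem_nhds (e.map_source hx))
    have hnhds : ∀ᶠ s in 𝓝 t, p s ∈ e.source ∧ e (p s) ∈ closedBall (e (p t)) R :=
      (hp.continuousAt.eventually (e.open_source.mem_nhds hx)).and
        ((ContinuousAt.comp (f := p) (e.continuousAt hx) hp.continuousAt).eventually
          (closedBall_mem_nhds _ hR))
    obtain ⟨δ, hδ, hball⟩ := Metric.nhds_basis_closedBall.mem_iff.1 hnhds
    refine ⟨δ, hδ, fun r _ s _ hrs hr hs => ?_⟩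
    have hin : ∀ τ ∈ Icc r s, p τ ∈ e.source ∧ e (p τ) ∈ closedBall (e (p t)) R := by
      intro τ hτ
      have h : τ ∈ closedBall t δ := by
        rw [mem_closedBall, Real.dist_eq, abs_le]
        rw [abs_le] at hr hs
        exact ⟨by linarith [hτ.1], by linarith [hτ.2]⟩
      exact hball h
    have hr' := hin r ⟨le_rfl, hrs.le⟩
    have hs' := hin s ⟨hrs.le, le_rfl⟩
    obtain ⟨c, hc, hcr, hcs, hcm, hce⟩ :=
      exists_chart_segment (F := F) he hsub hrs hr'.2 hs'.2
    rw [e.left_inv hr'.1] at hcr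
    rw [e.left_inv hs'.1] at hcs
    exact ⟨c, hc, hce, hcr, hcs, fun x y q hq => hq.congr_of_chart (convex_closedBall _ _) hsub hp
      hc.continuous hrs.le hin hcm hcr.symm hcs.symm⟩

theorem _root_.RepresentsOn.extend {x y : M} (p : Path x y) :
    RepresentsOn p.extend 0 1 (Path.Homotopic.Quotient.mk p) :=
  .of_path p (segmentPath 0 1) fun s => by
    simp [segmentPath]

theorem exists_hasLoopOfEnergyLE (F : FinslerMetric E M) (g : FundamentalGroup M x) :
    ∃ A : ℝ, 0 ≤ A ∧ F.HasLoopOfEnergyLE g 1 A := by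
  obtain ⟨p, hp⟩ := Path.Homotopic.Quotient.mk_surjective (FundamentalGroup.toPath g)
  obtain ⟨c, hc, hce, -, -, hq⟩ := exists_finite_energy (F := F) p.continuous_extend zero_lt_one
  refine ⟨(F.energy c 0 1).toReal, ENNReal.toReal_nonneg, c, hc, ?_, ?_⟩
  · rw [← hp]
    exact hq _ _ _ (.extend p)
  · rw [ENNReal.ofReal_toReal hce]

end FinslerMetric

/-! ### Reparametrization of `C^1` loops -/

section Curves

variable {E : Type*} [NormedAddCommGroup E] [NormedSpace ℝ E]
  {M : Type*} [TopologicalSpace M] [ChartedSpace E M] [IsManifold 𝓘(ℝ, E) ∞ M]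

theorem exists_continuousOn_chartVector_inverse {e : OpenPartialHomeomorph M E}
    (he : e ∈ atlas E M) : ∃ g : TangentBundle 𝓘(ℝ, E) M → E × E,
      ContinuousOn g {v | v.1 ∈ e.source} ∧ ∀ v : TangentBundle 𝓘(ℝ, E) M, v.1 ∈ e.source →
        (g v).1 ∈ e.target ∧ chartVector e (g v) = v := by
  have h1 := (contMDiffOn_of_mem_atlas he).continuousOn_tangentMapWithin (by simp)
    e.open_source.uniqueMDiffOn
  refine ⟨fun v => tangentBundleModelSpaceHomeomorph 𝓘(ℝ, E)
    (tangentMapWithin 𝓘(ℝ, E) 𝓘(ℝ, E) e e.source v),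
    (tangentBundleModelSpaceHomeomorph 𝓘(ℝ, E)).continuous.comp_continuousOn h1, ?_⟩
  rintro ⟨x, ξ⟩ hx
  have he' := mdifferentiable_of_mem_atlas (I := 𝓘(ℝ, E)) he
  have h2 : mfderiv 𝓘(ℝ, E) 𝓘(ℝ, E) e.symm (e x)
      (mfderivWithin 𝓘(ℝ, E) 𝓘(ℝ, E) e e.source x ξ) = ξ := by
    rw [mfderivWithin_of_isOpen e.open_source hx]
    exact DFunLike.congr_fun (he'.symm_comp_deriv hx) ξ
  refine ⟨e.map_source hx, ?_⟩
  refine Bundle.TotalSpace.ext (e.left_inv hx) (heq_of_eq h2)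

theorem continuousOn_velocityIcc {c : ℝ → M}
    (hc : ContMDiffOn 𝓘(ℝ, ℝ) 𝓘(ℝ, E) 1 c (Icc 0 1)) :
    ContinuousOn (velocityIcc E c) (Icc 0 1) := by
  have h1 := hc.continuousOn_tangentMapWithin le_rfl
    (uniqueDiffOn_Icc zero_lt_one).uniqueMDiffOn
  have h2 : Continuous fun t : ℝ => (⟨t, (1 : ℝ)⟩ : TangentBundle 𝓘(ℝ, ℝ) ℝ) :=
    (tangentBundleModelSpaceHomeomorph 𝓘(ℝ, ℝ)).symm.continuous.comp
      (continuous_id.prodMk continuous_const : Continuous fun t : ℝ => (t, (1 : ℝ)))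
  exact h1.comp h2.continuousOn fun t ht => ht

omit [IsManifold 𝓘(ℝ, E) ∞ M] in
theorem velocityIcc_eq_velocity {c : ℝ → M} {t : ℝ} (ht : t ∈ Ioo (0 : ℝ) 1) :
    velocityIcc E c t = velocity E c t := by
  unfold velocityIcc velocity
  rw [mfderivWithin_of_mem_nhds (Icc_mem_nhds ht.1 ht.2)]

end Curves

/-- The reparametrization of `[0, 1]` by a perturbed arc length. -/
theorem exists_reparametrization {f : ℝ → ℝ} (hf : ContinuousOn f (Icc 0 1)) (hf0 : ∀ t, 0 ≤ f t)
    {ε s : ℝ} (hε : 0 < ε) (hs : (∫ t in (0 : ℝ)..1, f t) + ε ≤ s) :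
    ∃ φ : ℝ → ℝ, Continuous φ ∧ φ 0 = 0 ∧ 1 ≤ φ s ∧ StrictMono φ ∧
      ∀ t, φ t ∈ Icc (0 : ℝ) 1 → HasDerivAt φ (f (φ t) + ε)⁻¹ t := by
  set f' : ℝ → ℝ := IccExtend zero_le_one ((Icc (0 : ℝ) 1).domRestrict f) with hf'
  have hf'c : Continuous f' := (continuousOn_iff_continuous_domRestrict.1 hf).Icc_extend'
  have hf'0 : ∀ t, 0 ≤ f' t := fun t => hf0 _
  have hf'e : ∀ t ∈ Icc (0 : ℝ) 1, f' t = f t := fun t ht => IccExtend_of_mem _ _ ht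
  have hgc : Continuous fun t => f' t + ε := hf'c.add continuous_const
  set S : ℝ → ℝ := fun t => ∫ r in (0 : ℝ)..t, (f' r + ε) with hS
  have hSd : ∀ t, HasDerivAt S (f' t + ε) t := fun t =>
    (hgc.integral_hasStrictDerivAt 0 t).hasDerivAt
  have hpos : ∀ t, 0 < f' t + ε := fun t => by linarith [hf'0 t]
  have hmono : StrictMono S := strictMono_of_deriv_pos fun t => by
    rw [(hSd t).deriv]; exact hpos t
  have hS0 : S 0 = 0 := by simp [hS]
  have hlow : ∀ a b, a ≤ b → ε * (b - a) ≤ S b - S a := fun a b hab => by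
    have h := intervalIntegral.integral_add_adjacent_intervals
      (hgc.intervalIntegrable (μ := volume) 0 a) (hgc.intervalIntegrable a b)
    have h2 : ∫ r in a..b, ε ≤ ∫ r in a..b, (f' r + ε) :=
      intervalIntegral.integral_mono_on hab (by simp) (hgc.intervalIntegrable a b)
        fun r _ => by linarith [hf'0 r]
    rw [intervalIntegral.integral_const, smul_eq_mul] at h2
    simp only [hS]
    linarith
  have hSc : Continuous S := continuous_iff_continuousAt.2 fun t => (hSd t).continuousAt
  have hsurj : Function.Surjective S := by
    refine hSc.surjective ?_ ?_
    · refine tendsto_atTop_mono' atTop (f₁ := fun t => ε * t) ?_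
        (tendsto_id.const_mul_atTop hε)
      filter_upwards [eventually_ge_atTop 0] with t ht
      have := hlow 0 t ht
      rw [hS0] at this
      linarith
    · refine tendsto_atBot_mono' atBot (f₂ := S) (f₁ := fun t => ε * t) ?_
        (tendsto_id.const_mul_atBot hε)
      filter_upwards [eventually_le_atBot 0] with t ht
      have := hlow t 0 ht
      rw [hS0] at this
      linarith
  set o : ℝ ≃o ℝ := hmono.orderIsoOfSurjective S hsurj with ho
  have hoS : ∀ t, o t = S t := fun t => rfl
  refine ⟨o.symm, o.symm.continuous, ?_, ?_, o.symm.strictMono, fun t ht => ?_⟩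
  · rw [o.symm_apply_eq, hoS, hS0]
  · rw [o.le_symm_apply, hoS]
    refine le_trans (le_of_eq ?_) hs
    simp only [hS]
    rw [intervalIntegral.integral_add (hf'c.intervalIntegrable _ _) (by simp)]
    rw [intervalIntegral.integral_congr (g := f) fun t ht => hf'e t (by simpa using ht)]
    simp
  · have h := HasDerivAt.of_local_left_inverse (f := S) (g := o.symm) (a := t)
      o.symm.continuous.continuousAt (hSd _) (hpos _).ne'
      (Eventually.of_forall fun r => o.apply_symm_apply r)
    rwa [hf'e _ ht] at h

namespace FinslerMetric

variable {E : Type*} [NormedAddCommGroup E] [NormedSpace ℝ E] [FiniteDimensional ℝ E]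
  {M : Type*} [TopologicalSpace M] [ChartedSpace E M] [IsManifold 𝓘(ℝ, E) ∞ M]
  (F : FinslerMetric E M)

theorem continuous_toFun : Continuous F.toFun := by
  refine continuous_iff_continuousAt.2 fun v => ?_
  set e := chartAt E v.1 with he_def
  have he : e ∈ atlas E M := chart_mem_atlas E _
  have hv : v.1 ∈ e.source := mem_chart_source E _
  obtain ⟨g, hg, hgv⟩ := exists_continuousOn_chartVector_inverse (M := M) he
  have hopen : IsOpen {v : TangentBundle 𝓘(ℝ, E) M | v.1 ∈ e.source} :=
    e.open_source.preimage (FiberBundle.continuous_proj E (TangentSpace 𝓘(ℝ, E)))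
  have h1 : ContinuousOn (fun v => F.localLagrangian e (g v).1 (g v).2)
      {v : TangentBundle 𝓘(ℝ, E) M | v.1 ∈ e.source} :=
    (F.isFinslerLagrangian he).continuousOn_lagrangian.comp hg fun v hv => ⟨(hgv v hv).1, trivial⟩
  have h2 : ContinuousOn F.toFun {v : TangentBundle 𝓘(ℝ, E) M | v.1 ∈ e.source} := by
    refine ((h1.const_smul (2 : ℝ)).sqrt).congr fun v hv => ?_
    change _ = √(2 * ((1 / 2 : ℝ) * F.toFun (chartVector e (g v)) ^ 2))
    rw [(hgv v hv).2]
    exact F.toFun_eq_sqrt v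
  exact h2.continuousAt (hopen.mem_nhds hv)

variable {F} {x : M}

omit [FiniteDimensional ℝ E] in
theorem toFun_velocity_le_one {c : ℝ → M} {φ : ℝ → ℝ} {ε t : ℝ} (hε : 0 < ε)
    (hc : MDifferentiableAt 𝓘(ℝ, ℝ) 𝓘(ℝ, E) c (φ t))
    (hφ : HasDerivAt φ (F.toFun (velocity E c (φ t)) + ε)⁻¹ t) :
    F.toFun (velocity E (fun s => c (φ s)) t) ≤ 1 := by
  have h0 := F.nonneg (velocity E c (φ t))
  rw [velocity_comp hc hφ]
  refine (F.homogeneous _ _ _ (by positivity)).trans_le ?_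
  change (F.toFun (velocity E c (φ t)) + ε)⁻¹ * F.toFun (velocity E c (φ t)) ≤ 1
  rw [inv_mul_le_iff₀ (by positivity)]
  linarith

omit [FiniteDimensional ℝ E] in
theorem toFun_velocity_of_eventuallyEq_const {c : ℝ → M} {t : ℝ} (h : c =ᶠ[𝓝 t] fun _ => x) :
    MDifferentiableAt 𝓘(ℝ, ℝ) 𝓘(ℝ, E) c t ∧ F.toFun (velocity E c t) = 0 := by
  refine ⟨mdifferentiableAt_const.congr_of_eventuallyEq h, ?_⟩
  rw [velocity_congr h]
  have h1 : velocity E (fun _ : ℝ => x) t = ⟨x, 0⟩ := by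
    refine Bundle.TotalSpace.ext rfl (heq_of_eq ?_)
    change mfderiv 𝓘(ℝ, ℝ) 𝓘(ℝ, E) (fun _ : ℝ => x) t (1 : ℝ) = _
    rw [mfderiv_const]
    rfl
  rw [h1, F.toFun_zero]

theorem HasLoopOfLengthLE.hasLoopOfEnergyLE {g : FundamentalGroup M x} {s : ℝ} (hs : 0 < s)
    (h : F.HasLoopOfLengthLE g s) : F.HasLoopOfEnergyLE g (2 * s) s := by
  obtain ⟨p, rfl, hp, hl⟩ := h
  obtain ⟨φ, hφc, hφ0, hφ1, hφm, hφd⟩ := exists_reparametrization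
    (f := fun t => F.toFun (velocityIcc E p.extend t)) (s := 2 * s)
    (F.continuous_toFun.comp_continuousOn (continuousOn_velocityIcc hp)) (fun t => F.nonneg _) hs
    (by rw [FinslerMetric.length] at hl; linarith)
  have hloc : ∀ t, φ t ≠ 0 → φ t ≠ 1 →
      MDifferentiableAt 𝓘(ℝ, ℝ) 𝓘(ℝ, E) (fun t => p.extend (φ t)) t ∧
        F.toFun (velocity E (fun t => p.extend (φ t)) t) ≤ 1 := by
    intro t h0 h1
    rcases lt_or_gt_of_ne h0 with h0 | h0
    · have h := toFun_velocity_of_eventuallyEq_const (F := F) (x := x) (t := t)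
        (c := fun t => p.extend (φ t)) (by
          filter_upwards [hφc.continuousAt.eventually (Iio_mem_nhds h0)] with r hr
          exact p.extend_of_le_zero (le_of_lt hr))
      exact ⟨h.1, h.2.trans_le zero_le_one⟩
    rcases lt_or_gt_of_ne h1 with h1 | h1
    · have hin : φ t ∈ Ioo (0 : ℝ) 1 := ⟨h0, h1⟩
      have hd := hφd t (Ioo_subset_Icc_self hin)
      simp only [velocityIcc_eq_velocity hin] at hd
      have hc : MDifferentiableAt 𝓘(ℝ, ℝ) 𝓘(ℝ, E) p.extend (φ t) :=
        (hp.contMDiffAt (Icc_mem_nhds h0 h1)).mdifferentiableAt one_ne_zero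
      exact ⟨hc.comp t hd.differentiableAt.mdifferentiableAt, toFun_velocity_le_one hs hc hd⟩
    · have h := toFun_velocity_of_eventuallyEq_const (F := F) (x := x) (t := t)
        (c := fun t => p.extend (φ t)) (by
          filter_upwards [hφc.continuousAt.eventually (Ioi_mem_nhds h1)] with r hr
          exact p.extend_of_one_le (le_of_lt hr))
      exact ⟨h.1, h.2.trans_le zero_le_one⟩
  have hcount : (φ ⁻¹' {0, 1}).Countable :=
    (((finite_singleton (1 : ℝ)).insert 0).countable).preimage hφm.injective
  refine ⟨fun t => p.extend (φ t), ⟨p.continuous_extend.comp hφc, _, hcount, fun t ht => ?_⟩,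
    ?_, ?_⟩
  · simp only [mem_preimage, mem_insert_iff, mem_singleton_iff, not_or] at ht
    exact (hloc t ht.1 ht.2).1
  · refine RepresentsOn.comp p.continuous_extend hφc ?_
    rw [hφ0]
    have h := (RepresentsOn.extend p).trans (RepresentsOn.of_const (c := p.extend) (x := x) hφ1
      fun t ht => p.extend_of_one_le ht.1)
    rwa [Path.Homotopic.Quotient.trans_refl] at h
  · have h1 : F.energy (fun t => p.extend (φ t)) 0 (2 * s) ≤
        ∫⁻ _ in Ioc (0 : ℝ) (2 * s), ENNReal.ofReal (1 / 2) := by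
      refine lintegral_mono_ae (ae_restrict_of_ae ?_)
      filter_upwards [compl_mem_ae_iff.2 (hcount.measure_zero volume)] with t ht
      simp only [mem_compl_iff, mem_preimage, mem_insert_iff, mem_singleton_iff, not_or] at ht
      refine ENNReal.ofReal_le_ofReal ?_
      have h2 := (hloc t ht.1 ht.2).2
      have h3 := F.nonneg (velocity E (fun t => p.extend (φ t)) t)
      nlinarith
    refine h1.trans (le_of_eq ?_)
    rw [lintegral_const, Measure.restrict_apply_univ, Real.volume_Ioc,
      ← ENNReal.ofReal_mul (by norm_num)]
    congr 1
    ring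

end FinslerMetric

/-! ### Lower bounds for the topological entropy -/

section Entropy

variable {X : Type*} {d : X → X → ℝ} {φ : ℝ → X → X}

theorem dist_lt_of_flowDist_lt {C t ε : ℝ} (hC : ∀ x y, d x y ≤ C) {x y : X}
    (h : flowDist d φ t x y < ε) : ∀ τ ∈ Icc 0 t, d (φ τ x) (φ τ y) < ε := fun τ hτ =>
  (le_csSup ⟨C, by rintro _ ⟨τ, -, rfl⟩; exact hC _ _⟩ (mem_image_of_mem _ hτ)).trans_lt h

/-- Points with a length at most `T` are separated when points of nearly the same length are. -/
theorem exists_isFlowSeparated {ι : Type*} [Fintype ι] {v : ι → X} {ℓ : ι → ℝ} {C T δ ε : ℝ}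
    (hC : ∀ x y, d x y ≤ C) (hd : ∀ x, d x x = 0) (hT : 0 ≤ T) (hδ : 0 < δ) (hε : 0 < ε)
    (hℓ : ∀ i, 0 ≤ ℓ i ∧ ℓ i ≤ T)
    (h : ∀ i j, |ℓ i - ℓ j| ≤ δ → (∀ τ ∈ Icc 0 T, d (φ τ (v i)) (φ τ (v j)) < ε) → i = j) :
    ∃ A : Finset X, IsFlowSeparated d φ T ε (A : Set X) ∧
      (Fintype.card ι : ℝ) ≤ (T / δ + 1) * A.card := by
  classical
  set N := ⌊T / δ⌋₊ + 1 with hN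
  have hNpos : (0 : ℝ) < N := by positivity
  obtain ⟨j, -, hj⟩ := Finset.exists_le_card_fiber_of_nsmul_le_card_of_maps_to
    (s := (Finset.univ : Finset ι)) (t := Finset.range N) (f := fun i => ⌊ℓ i / δ⌋₊)
    (b := (Fintype.card ι : ℝ) / N) (fun i _ => by
      rw [Finset.mem_range, hN, Nat.lt_succ_iff]
      exact Nat.floor_le_floor (div_le_div_of_nonneg_right (hℓ i).2 hδ.le))
    ⟨0, Finset.mem_range.2 (Nat.succ_pos _)⟩ (by
      rw [Finset.card_range, nsmul_eq_mul, mul_div_cancel₀ _ hNpos.ne', Finset.card_univ])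
  set s : Finset ι := {i ∈ Finset.univ | ⌊ℓ i / δ⌋₊ = j} with hs
  have hclose : ∀ i ∈ s, ∀ i' ∈ s, |ℓ i - ℓ i'| ≤ δ := by
    intro i hi i' hi'
    have h1 : ∀ i ∈ s, (j : ℝ) * δ ≤ ℓ i ∧ ℓ i ≤ (j + 1) * δ := by
      intro i hi
      have hij : ⌊ℓ i / δ⌋₊ = j := (Finset.mem_filter.1 hi).2
      have h2 := Nat.floor_le (div_nonneg (hℓ i).1 hδ.le)
      have h3 := (Nat.lt_floor_add_one (ℓ i / δ)).le
      rw [hij] at h2 h3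
      exact ⟨(le_div_iff₀ hδ).1 h2, (div_le_iff₀ hδ).1 h3⟩
    have h2 := h1 i hi
    have h3 := h1 i' hi'
    rw [abs_le]
    constructor <;> linarith [h2.1, h2.2, h3.1, h3.2]
  have hinj : InjOn v (s : Set ι) := fun i hi i' hi' hv =>
    h i i' (hclose i hi i' hi') fun τ _ => by rw [hv, hd]; exact hε
  refine ⟨s.image v, ?_, ?_⟩
  · intro x hx y hy hxy
    rw [Finset.coe_image] at hx hy
    obtain ⟨i, hi, rfl⟩ := hx
    obtain ⟨i', hi', rfl⟩ := hy
    by_contra hlt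
    exact hxy (congrArg v (h i i' (hclose i hi i' hi') (dist_lt_of_flowDist_lt hC (not_le.1 hlt))))
  · rw [Finset.card_image_of_injOn hinj]
    rw [div_le_iff₀ hNpos, mul_comm] at hj
    refine hj.trans (mul_le_mul_of_nonneg_right ?_ (Nat.cast_nonneg _))
    rw [hN]
    push_cast
    linarith [Nat.floor_le (div_nonneg hT hδ.le)]

theorem eventually_linear_le_exp (D : ℝ) {η : ℝ} (hη : 0 < η) :
    ∀ᶠ n : ℕ in atTop, D * n + 2 ≤ Real.exp (η * n) := by
  filter_upwards [eventually_ge_atTop 1, eventually_ge_atTop ⌈2 * (D + 1) / η ^ 2⌉₊] with n h1 h2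
  have h1' : (1 : ℝ) ≤ n := by exact_mod_cast h1
  have h2' := (Nat.le_ceil _).trans (Nat.cast_le (α := ℝ).2 h2)
  rw [div_le_iff₀ (by positivity)] at h2'
  have h3 := Real.quadratic_le_exp_of_nonneg (x := η * n) (by positivity)
  have h4 : 0 ≤ η * n := by positivity
  nlinarith

/-- Exponentially many separated points, up to a linear factor, bound the entropy from below. -/
theorem le_topologicalEntropy {k L D ε : ℝ} (hk : 0 < k) (hL : 0 < L) (hD : 0 ≤ D) (hε : 0 < ε)
    (h : ∀ n : ℕ, ∃ A : Finset X, IsFlowSeparated d φ (n * L) ε (A : Set X) ∧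
      Real.exp (k * n) - 1 ≤ (D * n + 1) * A.card) :
    ((k / L : ℝ) : EReal) ≤ topologicalEntropy d φ := by
  refine le_trans ?_ (le_iSup₂ (f := fun (ε : ℝ) (_ : 0 < ε) => limsup
    (fun t : ℝ => ((t⁻¹ : ℝ) : EReal) * ENNReal.log (maxSeparated d φ t ε : ℝ≥0∞)) atTop) ε hε)
  refine EReal.ge_of_forall_gt_iff_ge.1 fun r hr => le_limsup_of_frequently_le' ?_
  have hr' : r * L < k := (lt_div_iff₀ hL).1 (EReal.coe_lt_coe_iff.1 hr)
  have htend : Tendsto (fun n : ℕ => (n : ℝ) * L) atTop atTop :=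
    tendsto_natCast_atTop_atTop.atTop_mul_const hL
  refine htend.frequently (Eventually.frequently ?_)
  filter_upwards [eventually_ge_atTop 1, eventually_linear_le_exp D (sub_pos.2 hr')] with n h1 h2
  have hn : (0 : ℝ) < n := by exact_mod_cast h1
  obtain ⟨A, hA, hcard⟩ := h n
  have hA1 : (1 : ℝ) ≤ A.card := by
    have h3 : 0 < (D * n + 1) * (A.card : ℝ) :=
      (sub_pos.2 (Real.one_lt_exp_iff.2 (by positivity))).trans_le hcard
    have h4 : (0 : ℝ) < A.card := pos_of_mul_pos_right h3 (by positivity)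
    exact_mod_cast h4
  have hexp : Real.exp (r * L * n) ≤ A.card := by
    have h3 : Real.exp (k * n) = Real.exp (r * L * n) * Real.exp ((k - r * L) * n) := by
      rw [← Real.exp_add]; ring_nf
    have h4 : Real.exp (k * n) ≤ (D * n + 2) * A.card := by linarith
    have h5 : Real.exp (r * L * n) * (D * n + 2) ≤ A.card * (D * n + 2) := by
      rw [mul_comm (A.card : ℝ)]
      exact ((mul_le_mul_of_nonneg_left h2 (Real.exp_pos _).le).trans h3.ge).trans h4
    exact le_of_mul_le_mul_right h5 (by positivity)
  have hle : ENNReal.ofReal (Real.exp (r * L * n)) ≤ (maxSeparated d φ (n * L) ε : ℝ≥0∞) := by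
    have h3 : ((A : Set X).encard : ℕ∞) ≤ maxSeparated d φ (n * L) ε :=
      le_iSup₂ (f := fun (A : Set X) (_ : IsFlowSeparated d φ (n * L) ε A) => A.encard)
        (A : Set X) hA
    refine le_trans ?_ (ENat.toENNReal_le.2 h3)
    rw [Set.encard_coe_eq_coe_finsetCard, ENat.toENNReal_coe]
    exact (ENNReal.ofReal_le_ofReal hexp).trans (by simp)
  have hlog := ENNReal.log_monotone hle
  rw [ENNReal.log_ofReal_of_pos (Real.exp_pos _), Real.log_exp] at hlog
  have h3 : (r : EReal) = (((n * L : ℝ)⁻¹ : ℝ) : EReal) * ((r * L * n : ℝ) : EReal) := by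
    rw [← EReal.coe_mul]
    congr 1
    field_simp
  rw [h3]
  exact mul_le_mul_of_nonneg_left hlog (EReal.coe_nonneg.2 (by positivity))

variable {Y : Type*} [t : TopologicalSpace Y] [CompactSpace Y]

theorem exists_pos_forall_dist_lt_mem (d : MetricSpace Y)
    (hd : d.toUniformSpace.toTopologicalSpace = t) {V : Set (Y × Y)} (hV : V ∈ 𝓝ˢ (diagonal Y)) :
    ∃ ε > 0, ∀ v w, d.dist v w < ε → (v, w) ∈ V := by
  subst hd
  rw [nhdsSet_diagonal_eq_uniformity] at hV
  obtain ⟨ε, hε, h⟩ := Metric.mem_uniformity_dist.1 hV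
  exact ⟨ε, hε, fun v w hvw => h hvw⟩

theorem exists_forall_dist_le (d : MetricSpace Y)
    (hd : d.toUniformSpace.toTopologicalSpace = t) : ∃ C, ∀ v w, d.dist v w ≤ C := by
  subst hd
  obtain ⟨C, hC⟩ := Metric.isBounded_iff.1 (isCompact_univ (X := Y)).isBounded
  exact ⟨C, fun v w => hC (mem_univ v) (mem_univ w)⟩

end Entropy

/-! ### Geodesic loops and entropy -/

namespace FinslerMetric

variable {E : Type*} [NormedAddCommGroup E] [NormedSpace ℝ E]
  {M : Type*} [TopologicalSpace M] [ChartedSpace E M] [IsManifold 𝓘(ℝ, E) ∞ M]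
  (F : FinslerMetric E M)

/-- A unit speed geodesic defined on the whole line. -/
structure IsUnitGeodesic (σ : ℝ → M) : Prop where
  isGeodesicAt : ∀ t, F.IsGeodesicAt σ t
  speed : ∀ t, F.toFun (velocity E σ t) = 1

variable {F} {σ σ' : ℝ → M}

theorem IsUnitGeodesic.isAdmissible (hσ : F.IsUnitGeodesic σ) : IsAdmissible E σ :=
  ⟨continuous_iff_continuousAt.2 fun t => (hσ.isGeodesicAt t).continuousAt, ∅, countable_empty,
    fun t _ => (hσ.isGeodesicAt t).mdifferentiableAt⟩

theorem IsUnitGeodesic.energy_le (hσ : F.IsUnitGeodesic σ) (a b : ℝ) :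
    F.energy σ a b ≤ ENNReal.ofReal (b - a) := by
  have h : F.energy σ a b ≤ ∫⁻ _ in Ioc a b, 1 := by
    refine lintegral_mono fun t => ?_
    rw [hσ.speed t, ← ENNReal.ofReal_one]
    exact ENNReal.ofReal_le_ofReal (by norm_num)
  refine h.trans (le_of_eq ?_)
  rw [lintegral_one, Measure.restrict_apply_univ, Real.volume_Ioc]

/-- Geodesic loops that stay close and have nearly the same length are homotopic. -/
theorem IsUnitGeodesic.class_eq {N : Set (M × M)}
    (hN : ∀ (p q : ℝ → M) (a b : ℝ), Continuous p → Continuous q → a ≤ b →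
      (∀ t ∈ Icc a b, (p t, q t) ∈ N) → ∀ (x y : M) (α β : Path.Homotopic.Quotient x y),
        RepresentsOn p a b α → RepresentsOn q a b β → α = β) {δ : ℝ}
    (hδ : ∀ s t, |s - t| ≤ δ → (σ' s, σ' t) ∈ N) (hσ : F.IsUnitGeodesic σ)
    (hσ' : F.IsUnitGeodesic σ') {ℓ ℓ' : ℝ} (hℓ : 0 ≤ ℓ) (hle : ℓ ≤ ℓ') (hℓ' : ℓ' - ℓ ≤ δ) {x : M}
    {g g' : Path.Homotopic.Quotient x x} (hg : RepresentsOn σ 0 ℓ g)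
    (hg' : RepresentsOn σ' 0 ℓ' g') (h : ∀ t ∈ Icc 0 ℓ, (σ' t, σ t) ∈ N) : g' = g := by
  have hc := hσ.isAdmissible.continuous
  have hj : σ ℓ = (fun _ : ℝ => x) ℓ := hg.right_eq
  have hq : RepresentsOn (joinAt ℓ σ fun _ => x) 0 ℓ' (g.trans (.refl x)) :=
    (hg.congr hc hℓ fun t ht => (joinAt_of_le ht.2).symm).trans
      (.of_const hle fun t ht => joinAt_of_ge hj ht.1)
  rw [Path.Homotopic.Quotient.trans_refl] at hq
  refine hN σ' _ 0 ℓ' hσ'.isAdmissible.continuous (continuous_joinAt hc continuous_const hj)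
    (hℓ.trans hle) (fun t ht => ?_) x x g' g hg' hq
  rcases le_or_gt t ℓ with htl | htl
  · rw [joinAt_of_le htl]
    exact h t ⟨ht.1, htl⟩
  · rw [joinAt_of_lt htl, ← hg'.right_eq]
    exact hδ t ℓ' (abs_le.2 ⟨by linarith, by linarith [ht.2]⟩)

variable [FiniteDimensional ℝ E] [T2Space M] [CompactSpace M]

theorem exists_uniform_modulus {N : Set (M × M)} (hN : N ∈ 𝓝ˢ (diagonal M)) :
    ∃ δ > 0, ∀ σ : ℝ → M, F.IsUnitGeodesic σ → ∀ s t, |s - t| ≤ δ → (σ s, σ t) ∈ N := by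
  have h : ∃ δ > 0, ∀ σ : ℝ → M, F.IsUnitGeodesic σ → ∀ s t, σ s ∈ (univ : Set M) → |s - t| ≤ δ →
      (σ s, σ t) ∈ N := by
    refine isCompact_univ.induction_on (p := fun S => ∃ δ > 0, ∀ σ : ℝ → M, F.IsUnitGeodesic σ →
      ∀ s t, σ s ∈ S → |s - t| ≤ δ → (σ s, σ t) ∈ N) ⟨1, one_pos, fun _ _ _ _ h => h.elim⟩ ?_ ?_ ?_
    · rintro S S' hS ⟨δ, hδ, h⟩
      exact ⟨δ, hδ, fun σ hσ s t hs => h σ hσ s t (hS hs)⟩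
    · rintro S S' ⟨δ, hδ, h⟩ ⟨δ', hδ', h'⟩
      refine ⟨min δ δ', lt_min hδ hδ', ?_⟩
      rintro σ hσ s t (hs | hs) hst
      · exact h σ hσ s t hs (hst.trans (min_le_left _ _))
      · exact h' σ hσ s t hs (hst.trans (min_le_right _ _))
    · intro x _
      obtain ⟨e, R, ρ, κ, C, m, hx, W, hWN⟩ := F.exists_isWindow x hN
      have hρ := W.ρ_pos
      have hm := W.m_pos
      set δ := min (1 / 2) (m * ρ ^ 2 / 16) with hδ
      have hδ0 : 0 < δ := lt_min (by norm_num) (by positivity)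
      have hδ1 : δ ≤ 1 / 2 := min_le_left _ _
      have hδ2 : δ ≤ m * ρ ^ 2 / 16 := min_le_right _ _
      have hmp : 0 < m * ρ ^ 2 := by positivity
      refine ⟨e.source ∩ e ⁻¹' closedBall (e x) (ρ / 2), mem_nhdsWithin_of_mem_nhds
        (inter_mem (e.open_source.mem_nhds hx) ((e.continuousAt hx).preimage_mem_nhds
          (closedBall_mem_nhds _ (half_pos hρ)))), δ, hδ0, fun σ hσ s t hs hst => ?_⟩
      have hball := W.mem_closedBall_of_energy_le hσ.isAdmissible (a := s - δ) (b := s + δ)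
        (t₀ := s) (A := 1) ⟨by linarith, by linarith⟩ ((hσ.energy_le _ _).trans
          (ENNReal.ofReal_le_ofReal (by linarith))) zero_le_one (by linarith) hs
      have h1 := hball s ⟨by linarith, by linarith⟩
      have h2 := hball t (by rw [abs_le] at hst; exact ⟨by linarith, by linarith⟩)
      have h3 := hWN _ (closedBall_subset_closedBall W.ρ_le h1.2) _
        (closedBall_subset_closedBall W.ρ_le h2.2)
      rwa [e.left_inv h1.1, e.left_inv h2.1] at h3
  obtain ⟨δ, hδ, h⟩ := h
  exact ⟨δ, hδ, fun σ hσ s t => h σ hσ s t (mem_univ _)⟩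

variable {x : M}

theorem exists_unit_geodesic_of_mem_wordBall {S : Set (FundamentalGroup M x)} {τ A : ℝ}
    (hτ : 0 < τ) (hA : 0 ≤ A)
    (hS : ∀ g : FundamentalGroup M x, g ∈ S ∨ g⁻¹ ∈ S → F.HasLoopOfEnergyLE g τ A) {n : ℕ}
    {g : FundamentalGroup M x} (hg : g ∈ wordBall S n) (hg1 : g ≠ 1) :
    ∃ σ : ℝ → M, F.IsUnitGeodesic σ ∧ ∃ ℓ : ℝ, 0 ≤ ℓ ∧ ℓ ≤ n * √(2 * A * τ) ∧
      RepresentsOn σ 0 ℓ (FundamentalGroup.toPath g) := by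
  obtain ⟨l, hl, hlS, rfl⟩ := hg
  have hl0 : 0 < l.length := by
    rw [List.length_pos_iff]
    rintro rfl
    exact hg1 List.prod_nil
  have hl0' : (0 : ℝ) < l.length := by exact_mod_cast hl0
  have hl' : (l.length : ℝ) ≤ n := by exact_mod_cast hl
  obtain ⟨c, hc, hcr, hce⟩ := HasLoopOfEnergyLE.list_prod hτ.le hA fun g hg => hS g (hlS g hg)
  obtain ⟨σ, ℓ, hℓ, hℓ2, hgeo, hunit, hrep⟩ := exists_unit_geodesic (F := F) hg1
    (mul_pos hl0' hτ) (mul_nonneg hl0'.le hA) hc hcr hce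
  refine ⟨σ, ⟨hgeo, hunit⟩, ℓ, hℓ.le, ?_, hrep⟩
  refine le_trans ?_ (mul_le_mul_of_nonneg_right hl' (Real.sqrt_nonneg _))
  refine abs_le_of_sq_le_sq' ?_ (by positivity) |>.2
  rw [mul_pow, Real.sq_sqrt (by positivity)]
  linarith

/-- The entropy is bounded below by the growth rate of the fundamental group. -/
theorem le_topologicalEntropy_of_hasLoopOfEnergyLE (d : MetricSpace F.UnitBundle)
    (hd : d.toUniformSpace.toTopologicalSpace = instTopologicalSpaceSubtype)
    {S : Set (FundamentalGroup M x)} {k τ A : ℝ} (hk : 0 < k) (hτ : 0 < τ) (hA : 0 < A)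
    (hgrowth : GrowsAtRate S k)
    (hS : ∀ g : FundamentalGroup M x, g ∈ S ∨ g⁻¹ ∈ S → F.HasLoopOfEnergyLE g τ A) :
    ((k / √(2 * A * τ) : ℝ) : EReal) ≤ topologicalEntropy d.dist F.geodesicFlow := by
  have : CompactSpace F.UnitBundle := F.compactSpace_unitBundle
  obtain ⟨N, hN, hNclass⟩ := exists_nhdsSet_diagonal_homotopic E M
  obtain ⟨δ, hδ, hmod⟩ := exists_uniform_modulus (F := F) hN
  have hproj : Continuous fun v : F.UnitBundle => (v : TangentBundle 𝓘(ℝ, E) M).1 :=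
    (FiberBundle.continuous_proj E (TangentSpace 𝓘(ℝ, E))).comp continuous_subtype_val
  have hV := (hproj.prodMap hproj).tendsto_nhdsSet (s := diagonal F.UnitBundle)
    (t := diagonal M) (fun z hz => congrArg (fun v : F.UnitBundle =>
      (v : TangentBundle 𝓘(ℝ, E) M).1) hz) hN
  obtain ⟨ε, hε, hdist⟩ := exists_pos_forall_dist_lt_mem d hd hV
  obtain ⟨C, hC⟩ := exists_forall_dist_le d hd
  have hL : 0 < √(2 * A * τ) := Real.sqrt_pos.2 (by positivity)
  refine le_topologicalEntropy hk hL (D := √(2 * A * τ) / δ) (by positivity) hε fun n => ?_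
  have hfin : (wordBall S n).Finite :=
    Set.finite_of_ncard_pos (by exact_mod_cast (Real.exp_pos _).trans_le (hgrowth n))
  set B := wordBall S n \ {1} with hB
  have hBfin : B.Finite := hfin.subset sdiff_subset
  have : Fintype B := hBfin.fintype
  choose σ hσ ℓ hℓ0 hℓ1 hrep using fun g : B =>
    exists_unit_geodesic_of_mem_wordBall hτ hA.le hS g.2.1 g.2.2
  have hflow : ∀ (g : B) (t : ℝ), (F.geodesicFlow t ⟨velocity E (σ g) 0, (hσ g).speed 0⟩ :
      TangentBundle 𝓘(ℝ, E) M).1 = σ g t := fun g t => by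
    rw [geodesicFlow_eq_velocity (hσ g).isGeodesicAt rfl t]
    rfl
  obtain ⟨A', hA', hcard⟩ := exists_isFlowSeparated (φ := F.geodesicFlow)
    (v := fun g : B => ⟨velocity E (σ g) 0, (hσ g).speed 0⟩) (ℓ := ℓ) hC d.dist_self
    (T := n * √(2 * A * τ)) (by positivity) hδ hε (fun g => ⟨hℓ0 g, hℓ1 g⟩) (by
      intro g g' hgg h
      have hclose : ∀ t ∈ Icc 0 (n * √(2 * A * τ)), (σ g t, σ g' t) ∈ N ∧ (σ g' t, σ g t) ∈ N := by
        intro t ht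
        have h1 := hdist _ _ (h t ht)
        have h2 := hdist _ _ ((d.dist_comm _ _).trans_lt (h t ht))
        simp only [mem_preimage, Prod.map_apply, hflow] at h1 h2
        exact ⟨h1, h2⟩
      rw [abs_le] at hgg
      refine Subtype.ext ?_
      rcases le_total (ℓ g) (ℓ g') with hle | hle
      · exact (IsUnitGeodesic.class_eq hNclass (hmod _ (hσ g')) (hσ g) (hσ g') (hℓ0 g) hle
          (by linarith) (hrep g) (hrep g') fun t ht =>
            (hclose t ⟨ht.1, ht.2.trans (hℓ1 g)⟩).2).symm
      · exact IsUnitGeodesic.class_eq hNclass (hmod _ (hσ g)) (hσ g') (hσ g) (hℓ0 g') hle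
          (by linarith) (hrep g') (hrep g) fun t ht =>
            (hclose t ⟨ht.1, ht.2.trans (hℓ1 g')⟩).1)
  refine ⟨A', hA', ?_⟩
  have h1 : (wordBall S n).ncard ≤ Fintype.card B + 1 := by
    rw [← Nat.card_eq_fintype_card, Nat.card_coe_set_eq]
    have := Set.pred_ncard_le_ncard_sdiff_singleton (wordBall S n) 1
    rw [← hB] at this
    omega
  have h2 : ((wordBall S n).ncard : ℝ) ≤ Fintype.card B + 1 := by exact_mod_cast h1
  have h3 : √(2 * A * τ) / δ * n + 1 = n * √(2 * A * τ) / δ + 1 := by ring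
  rw [h3]
  linarith [hgrowth n]

end FinslerMetric

theorem mainTheorem3 {E : Type*} [NormedAddCommGroup E] [NormedSpace ℝ E] [FiniteDimensional ℝ E]
    {M : Type*} [TopologicalSpace M] [ChartedSpace E M] [IsManifold 𝓘(ℝ, E) ∞ M]
    [T2Space M] [CompactSpace M] [ConnectedSpace M]
    (F : FinslerMetric E M) (x : M) (hG : HasExponentialGrowth (FundamentalGroup M x))
    (d : MetricSpace F.UnitBundle)
    (hd : d.toUniformSpace.toTopologicalSpace = instTopologicalSpaceSubtype) :
    0 < topologicalEntropy d.dist F.geodesicFlow ∧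
    ∀ (S : Finset (FundamentalGroup M x)) (k s₀ : ℝ),
      Subgroup.closure (S : Set (FundamentalGroup M x)) = ⊤ → 0 < k → 0 < s₀ →
      GrowsAtRate (S : Set (FundamentalGroup M x)) k →
      (∀ g : FundamentalGroup M x, g ∈ S ∨ g⁻¹ ∈ S → F.HasLoopOfLengthLE g s₀) →
      ((k / (2 * s₀) : ℝ) : EReal) ≤ topologicalEntropy d.dist F.geodesicFlow := by
  refine ⟨?_, ?_⟩
  · obtain ⟨S, -, k, hk, hgrowth⟩ := hG
    choose A hA hloop using F.exists_hasLoopOfEnergyLE (x := x)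
    have hsum : 0 ≤ ∑ g ∈ S, (A g + A g⁻¹) :=
      Finset.sum_nonneg fun g _ => add_nonneg (hA _) (hA _)
    have hpos : 0 < 1 + ∑ g ∈ S, (A g + A g⁻¹) := by positivity
    have hle : ∀ g ∈ S, A g + A g⁻¹ ≤ ∑ g ∈ S, (A g + A g⁻¹) := fun g hg =>
      Finset.single_le_sum (f := fun g => A g + A g⁻¹)
        (fun g _ => add_nonneg (hA _) (hA _)) hg
    refine lt_of_lt_of_le ?_ (FinslerMetric.le_topologicalEntropy_of_hasLoopOfEnergyLE d hd hk
      one_pos hpos hgrowth fun g hg => ?_)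
    · exact EReal.coe_pos.2 (div_pos hk (Real.sqrt_pos.2 (by positivity)))
    · obtain ⟨c, hc, hcr, hce⟩ := hloop g
      refine ⟨c, hc, hcr, hce.trans (ENNReal.ofReal_le_ofReal ?_)⟩
      rcases hg with hg | hg
      · linarith [hle g hg, hA g⁻¹]
      · have h := hle _ hg
        rw [inv_inv] at h
        linarith [hA g⁻¹]
  · intro S k s₀ _ hk hs₀ hgrowth hloop
    have h := FinslerMetric.le_topologicalEntropy_of_hasLoopOfEnergyLE d hd hk
      (mul_pos two_pos hs₀) hs₀ hgrowth fun g hg => (hloop g hg).hasLoopOfEnergyLE hs₀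
    rwa [show 2 * s₀ * (2 * s₀) = (2 * s₀) ^ 2 by ring, Real.sqrt_sq (by positivity)] at h

end
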